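/- Call a symmetric matrix $A\in\mathbb R^{m\times m}$ *$q$-block diagonal* (where $q\ge 1$ divides $m$) if $A=\mathrm{diag}(B_1,\dots,B_{m/q})$ with symmetric $q\times q$ matrices $B_j$, and let $\|A\|_{\mathrm{op}}$ denote the largest singular value of $A$. **Theorem.** There are a deterministic algorithm and absolute constants $K,C>0$ such that the following holds for all integers $n,q\ge 1$ and $m\ge 0$ with $q\mid m$. Given $q$-block diagonal matrices $A_1,\dots,A_n\in\mathbb R^{m\times m}$ with $\|A_i\|_{\mathrm{op}}\le 1$ for $i=1,\dots,n$ and a starting point $x^{(0)}\in[-1,1]^n$, the algorithm outputs, after at most $C\,(n^5+n^4m^3)$ steps, a vector $x\in[-1,1]^n$ with $$\Big\|\sum_{i=1}^n (x_i-x_i^{(0)})\,A_i\Big\|_{\mathrm{op}}\;\le\; K\sqrt{\,n\,\log\Big(\max\Big\{2,\frac{2qm}{n}\Big\}\Big)}$$ such that at least $\frac n2$ coordinates of $x$ lie in $\{-1,1\}$. (For $n\le qm$ the maximum is just $\frac{2qm}{n}$.) Here an algorithm is one fixed program, the same for all $n,m,q$, of a real RAM: exact real numbers, indirectly addressed arrays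 of reals, addition and truncated subtraction of natural-number indices, conversion of an index to a real, the real operations $+,-,\times,\div,\sqrt{\ }$, and comparisons of indices or of reals, each at the cost of one step; the input consists of $n,m,q$, the entries of the $A_i$, and $x^{(0)}$. -/

import Mathlib

/-- The operator norm (largest singular value) of a real square matrix: the norm of the
linear map that it induces on Euclidean space. -/
noncomputable def opNorm {m : ℕ} (A : Matrix (Fin m) (Fin m) ℝ) : ℝ :=
  ‖Matrix.toEuclideanCLM (n := Fin m) (𝕜 := ℝ) A‖

/-- `A = diag(B₁, …, B_{m/q})` with symmetric blocks of size `q × q`: the matrix is symmetric, and an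
entry vanishes unless its row and its column lie in the same of the consecutive index intervals
`{0, …, q-1}, {q, …, 2q-1}, …`. -/
def IsBlockDiagonal {m : ℕ} (q : ℕ) (A : Matrix (Fin m) (Fin m) ℝ) : Prop :=
  0 < q ∧ q ∣ m ∧ A.IsSymm ∧ ∀ i j : Fin m, (i : ℕ) / q ≠ (j : ℕ) / q → A i j = 0

namespace RealRAM

/-! The real RAM: deterministic programs over exact real numbers and natural-number indices,
with indirectly addressed arrays of reals. Every elementary instruction and every test costs one
time step. There is no rounding of a real number to an index. -/

/-- A configuration: index registers, real registers, and arrays of reals. The array `a` at the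
subscripts `i, j, k` is `arr a i j k`. -/
structure State where
  idx : ℕ → ℕ
  reg : ℕ → ℝ
  arr : ℕ → ℕ → ℕ → ℕ → ℝ

/-- Elementary instructions. The arguments are names of registers and arrays, except for the constant
`c` in `idxConst`; `d` is the destination. -/
inductive Instr where
  | idxConst (d c : ℕ)
  | idxAdd (d a b : ℕ)
  | idxSub (d a b : ℕ)
  | ofIdx (d a : ℕ)
  | add (d a b : ℕ)
  | sub (d a b : ℕ)
  | mul (d a b : ℕ)
  | div (d a b : ℕ)
  | sqrt (d a : ℕ)
  | load (d a i j k : ℕ)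
  | store (a i j k s : ℕ)

/-- The effect of an elementary instruction. -/
noncomputable def Instr.exec : Instr → State → State
  | .idxConst d c, s => { s with idx := Function.update s.idx d c }
  | .idxAdd d a b, s => { s with idx := Function.update s.idx d (s.idx a + s.idx b) }
  | .idxSub d a b, s => { s with idx := Function.update s.idx d (s.idx a - s.idx b) }
  | .ofIdx d a, s => { s with reg := Function.update s.reg d (s.idx a : ℝ) }
  | .add d a b, s => { s with reg := Function.update s.reg d (s.reg a + s.reg b) }
  | .sub d a b, s => { s with reg := Function.update s.reg d (s.reg a - s.reg b) }
  | .mul d a b, s => { s with reg := Function.update s.reg d (s.reg a * s.reg b) }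
  | .div d a b, s => { s with reg := Function.update s.reg d (s.reg a / s.reg b) }
  | .sqrt d a, s => { s with reg := Function.update s.reg d (Real.sqrt (s.reg a)) }
  | .load d a i j k, s =>
      { s with reg := Function.update s.reg d (s.arr a (s.idx i) (s.idx j) (s.idx k)) }
  | .store a i j k r, s =>
      { s with arr := fun a' i' j' k' =>
          if a' = a ∧ i' = s.idx i ∧ j' = s.idx j ∧ k' = s.idx k then s.reg r
          else s.arr a' i' j' k' }

/-- Tests: strict comparison of two index registers or of two real registers. -/
inductive Test where
  | idxLt (a b : ℕ)
  | regLt (a b : ℕ)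

/-- The outcome of a test. -/
def Test.Holds : Test → State → Prop
  | .idxLt a b, s => s.idx a < s.idx b
  | .regLt a b, s => s.reg a < s.reg b

/-- Programs. -/
inductive Prog where
  | skip
  | instr (i : Instr)
  | seq (P Q : Prog)
  | ite (c : Test) (P Q : Prog)
  | while (c : Test) (P : Prog)

/-- `Exec P s s' t`: started in `s`, the program `P` halts in `s'` after exactly `t` time steps. -/
inductive Exec : Prog → State → State → ℕ → Prop where
  | skip (s : State) : Exec .skip s s 1
  | instr (i : Instr) (s : State) : Exec (.instr i) s (i.exec s) 1
  | seq {P Q : Prog} {s₁ s₂ s₃ : State} {t₁ t₂ : ℕ} :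
      Exec P s₁ s₂ t₁ → Exec Q s₂ s₃ t₂ → Exec (.seq P Q) s₁ s₃ (t₁ + t₂)
  | ite_true {c : Test} {P Q : Prog} {s s' : State} {t : ℕ} :
      c.Holds s → Exec P s s' t → Exec (.ite c P Q) s s' (t + 1)
  | ite_false {c : Test} {P Q : Prog} {s s' : State} {t : ℕ} :
      ¬ c.Holds s → Exec Q s s' t → Exec (.ite c P Q) s s' (t + 1)
  | while_true {c : Test} {P : Prog} {s₁ s₂ s₃ : State} {t₁ t₂ : ℕ} :
      c.Holds s₁ → Exec P s₁ s₂ t₁ → Exec (.while c P) s₂ s₃ t₂ →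
      Exec (.while c P) s₁ s₃ (t₁ + t₂ + 1)
  | while_false {c : Test} {P : Prog} {s : State} :
      ¬ c.Holds s → Exec (.while c P) s s 1

/-- The initial configuration on an instance: `n, m, q` in the index registers `0, 1, 2`, the
matrices in array `0` (entry `(j, k)` of the matrix number `i` at the subscripts `i, j, k`), the starting
point in array `1` (coordinate `i` at the subscripts `i, 0, 0`), and `0` everywhere else. -/
noncomputable def input {n m : ℕ} (q : ℕ) (A : Fin n → Matrix (Fin m) (Fin m) ℝ)
    (x₀ : Fin n → ℝ) : State where
  idx := fun r => if r = 0 then n else if r = 1 then m else if r = 2 then q else 0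
  reg := fun _ => 0
  arr := fun a i j k =>
    if a = 0 then
      if h : i < n ∧ j < m ∧ k < m then A ⟨i, h.1⟩ ⟨j, h.2.1⟩ ⟨k, h.2.2⟩ else 0
    else if a = 1 then
      if h : i < n ∧ j = 0 ∧ k = 0 then x₀ ⟨i, h.1⟩ else 0
    else 0

/-- The output vector of a configuration, read from array `2`. -/
def output (n : ℕ) (s : State) : Fin n → ℝ := fun i => s.arr 2 i 0 0

/-- The program `P`, started in the configuration `s`, outputs `x : ℝⁿ` after exactly `t` time
steps. -/
def Computes {n : ℕ} (P : Prog) (s : State) (x : Fin n → ℝ) (t : ℕ) : Prop :=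
  ∃ s' : State, Exec P s s' t ∧ output n s' = x

end RealRAM

/-! Replace each Aᵢ by diag(Aᵢ, -Aᵢ): then every matrix is traceless, and an upper bound on X = ∑
(xᵢ - x₀ᵢ)Aᵢ is a bound on the norm of the original sum. With p = 2^k of order log(2qm/n) and b =
24√(np), take the barrier potential Φ = tr (b - X)^(-p) + (n/q) b^(-p). The point x moves so that b
- X stays positive definite and the energy (p/n)|x|² - log Φ never decreases. Since |x|² ≤ n, Φ
grows at most by the factor e^p (`small_potential`), which gives 16qΦ ≤ nθ^p for θ = 6/b. Since X is
traceless, convexity keeps Φ above its initial value (`potential_self_le`), so the energy can rise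
by at most p in total.

Write R = (b - X)⁻¹ and Y = ∑ zᵢAᵢ for a displacement z. `barrier_step` expands Φ to second order in
Y; the Lieb–Thirring inequality deals with the failure of Y and R to commute. A good z must have
tr(R^(p+2) Y²) = O(θ²Φ|z|²). At most n/(16q) eigenvalues r of R exceed θ, and their eigenvectors u
can be chosen inside single blocks, so that Yu = 0 amounts to only q linear conditions on z. On the
other eigenvectors r^(p+2) ≤ θ²r^p, and averaging over an orthonormal system of admissible
directions gives the bound (`exists_small_direction`). The algorithm computes no eigenvectors: it
takes a column of the inverse of G = (second-order form) + τ, τ = θ²Φ, whose diagonal entry is at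
least 1/(4τ) (`exists_inv_diag_ge`).

The sign of z makes the first-order term harmless, and x moves along z until a coordinate reaches ±1
or the whole displacement, of length at least 1/(4√n), has been made. The former happens at most n
times. The latter gains p/(32n²) of energy each time, hence happens at most 32n² times
(`progress_step`, `progress_le`). So 64n² rounds suffice to freeze half of the coordinates. If p
would exceed n, the all-ones vector already satisfies the bound.

For the running time, the algorithm is written in a small array language with a verified compiler to
the real RAM. Matrices are inverted by principal pivoting, which never meets a zero pivot on a
positive definite matrix. A round costs O(n³ + n²m³). -/

set_option linter.unusedSectionVars false

namespace MatrixDiscrepancy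

open Matrix Finset

/-! ### Spectral calculus for real symmetric matrices -/

section Spectral

variable {ν : Type*} [Fintype ν] [DecidableEq ν]

theorem posSemidef_of_dotProduct {M : Matrix ν ν ℝ} (hM : M.IsSymm)
    (h : ∀ v : ν → ℝ, 0 ≤ v ⬝ᵥ M *ᵥ v) : M.PosSemidef :=
  PosSemidef.of_dotProduct_mulVec_nonneg (by simpa [IsHermitian] using hM.eq) (by simpa using h)

theorem posDef_of_dotProduct {M : Matrix ν ν ℝ} (hM : M.IsSymm)
    (h : ∀ v : ν → ℝ, v ≠ 0 → 0 < v ⬝ᵥ M *ᵥ v) : M.PosDef :=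
  PosDef.of_dotProduct_mulVec_pos (by simpa [IsHermitian] using hM.eq) (by simpa using h)

theorem dotProduct_nonneg_of_posSemidef {M : Matrix ν ν ℝ} (hM : M.PosSemidef) (v : ν → ℝ) :
    0 ≤ v ⬝ᵥ M *ᵥ v := by
  simpa using hM.dotProduct_mulVec_nonneg v

theorem dotProduct_pos_of_posDef {M : Matrix ν ν ℝ} (hM : M.PosDef) {v : ν → ℝ} (hv : v ≠ 0) :
    0 < v ⬝ᵥ M *ᵥ v := by
  simpa using hM.dotProduct_mulVec_pos hv

theorem isSymm_of_posSemidef {M : Matrix ν ν ℝ} (hM : M.PosSemidef) : M.IsSymm := by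
  have := hM.isHermitian.eq
  rwa [conjTranspose_eq_transpose_of_trivial] at this

theorem isSymm_of_posDef {M : Matrix ν ν ℝ} (hM : M.PosDef) : M.IsSymm :=
  isSymm_of_posSemidef hM.posSemidef

theorem dotProduct_self_pos {v : ν → ℝ} (hv : v ≠ 0) : 0 < v ⬝ᵥ v := by
  have := Matrix.dotProduct_star_self_pos_iff.2 hv
  simpa using this

theorem dotProduct_self_nonneg (v : ν → ℝ) : 0 ≤ v ⬝ᵥ v := by
  exact sum_nonneg fun i _ => mul_self_nonneg (v i)

/-- The symmetric matrix with the columns of `U` as eigenvectors and with eigenvalues `d`. -/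
def conjDiag (U : Matrix ν ν ℝ) (d : ν → ℝ) : Matrix ν ν ℝ := U * diagonal d * Uᵀ

variable {U : Matrix ν ν ℝ}

theorem mul_transpose_of_transpose_mul (hU : Uᵀ * U = 1) : U * Uᵀ = 1 :=
  mul_eq_one_comm.1 hU

theorem conjDiag_mul (hU : Uᵀ * U = 1) (d e : ν → ℝ) :
    conjDiag U d * conjDiag U e = conjDiag U (fun i => d i * e i) := by
  unfold conjDiag
  calc U * diagonal d * Uᵀ * (U * diagonal e * Uᵀ)
      = U * diagonal d * (Uᵀ * U) * diagonal e * Uᵀ := by simp only [Matrix.mul_assoc]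
    _ = _ := by rw [hU, Matrix.mul_one, Matrix.mul_assoc U, diagonal_mul_diagonal]

theorem conjDiag_one (hU : Uᵀ * U = 1) : conjDiag U (fun _ => 1) = 1 := by
  simp [conjDiag, mul_transpose_of_transpose_mul hU]

theorem conjDiag_pow (hU : Uᵀ * U = 1) (d : ν → ℝ) (k : ℕ) :
    conjDiag U d ^ k = conjDiag U (fun i => d i ^ k) := by
  induction k with
  | zero => simp [conjDiag_one hU]
  | succ k ih => rw [pow_succ, ih, conjDiag_mul hU]; simp only [pow_succ]

theorem conjDiag_add (d e : ν → ℝ) :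
    conjDiag U d + conjDiag U e = conjDiag U (fun i => d i + e i) := by
  simp [conjDiag, ← diagonal_add, Matrix.mul_add, Matrix.add_mul]

theorem conjDiag_sub (d e : ν → ℝ) :
    conjDiag U d - conjDiag U e = conjDiag U (fun i => d i - e i) := by
  simp [conjDiag, ← diagonal_sub, Matrix.mul_sub, Matrix.sub_mul]

theorem conjDiag_smul (c : ℝ) (d : ν → ℝ) :
    c • conjDiag U d = conjDiag U (fun i => c * d i) := by
  have : diagonal (fun i => c * d i) = c • diagonal d := by
    rw [← diagonal_smul]; rfl
  simp [conjDiag, this]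

theorem conjDiag_inv (hU : Uᵀ * U = 1) {d : ν → ℝ} (hd : ∀ i, d i ≠ 0) :
    (conjDiag U d)⁻¹ = conjDiag U (fun i => (d i)⁻¹) := by
  apply inv_eq_right_inv
  rw [conjDiag_mul hU, ← conjDiag_one hU]
  congr 1
  funext i
  exact mul_inv_cancel₀ (hd i)

theorem conjDiag_isSymm (d : ν → ℝ) : (conjDiag U d).IsSymm := by
  simp [IsSymm, conjDiag, Matrix.mul_assoc]

theorem trace_conjDiag_mul (d : ν → ℝ) (B : Matrix ν ν ℝ) :
    (conjDiag U d * B).trace = ∑ i, d i * (Uᵀ * B * U) i i := by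
  rw [conjDiag, Matrix.mul_assoc, Matrix.trace_mul_comm, ← Matrix.mul_assoc,
    Matrix.trace_mul_comm, trace]
  simp [diagonal_mul]

theorem trace_conjDiag (hU : Uᵀ * U = 1) (d : ν → ℝ) : (conjDiag U d).trace = ∑ i, d i := by
  have := trace_conjDiag_mul (U := U) d 1
  simpa [hU] using this

theorem transpose_mulVec_dotProduct (hU : Uᵀ * U = 1) (v : ν → ℝ) :
    (Uᵀ *ᵥ v) ⬝ᵥ (Uᵀ *ᵥ v) = v ⬝ᵥ v := by
  rw [dotProduct_mulVec, vecMul_transpose, mulVec_mulVec,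
    mul_transpose_of_transpose_mul hU, one_mulVec]

theorem dotProduct_conjDiag (d : ν → ℝ) (v : ν → ℝ) :
    v ⬝ᵥ conjDiag U d *ᵥ v = ∑ i, d i * (Uᵀ *ᵥ v) i ^ 2 := by
  rw [conjDiag, ← mulVec_mulVec, ← mulVec_mulVec, dotProduct_mulVec, ← mulVec_transpose,
    dotProduct]
  exact sum_congr rfl fun i _ => by rw [mulVec_diagonal]; ring

theorem conjDiag_posSemidef {d : ν → ℝ} (hd : ∀ i, 0 ≤ d i) : (conjDiag U d).PosSemidef :=
  posSemidef_of_dotProduct (conjDiag_isSymm d) fun v => by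
    rw [dotProduct_conjDiag]
    exact sum_nonneg fun i _ => mul_nonneg (hd i) (sq_nonneg _)

theorem conjDiag_posDef (hU : Uᵀ * U = 1) {d : ν → ℝ} (hd : ∀ i, 0 < d i) :
    (conjDiag U d).PosDef :=
  posDef_of_dotProduct (conjDiag_isSymm d) fun v hv => by
    rw [dotProduct_conjDiag]
    have h0 := transpose_mulVec_dotProduct hU v
    have h1 := dotProduct_self_pos hv
    rw [← h0, dotProduct] at h1
    obtain ⟨i, hi, hi'⟩ := exists_lt_of_sum_lt (f := fun _ => (0 : ℝ)) (by simpa using h1)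
    refine sum_pos' (fun i _ => mul_nonneg (hd i).le (sq_nonneg _)) ⟨i, hi, ?_⟩
    exact mul_pos (hd i) (by simpa [sq] using hi')

theorem mulVec_col_conjDiag (hU : Uᵀ * U = 1) (d : ν → ℝ) (i : ν) :
    conjDiag U d *ᵥ U.col i = d i • U.col i := by
  have h : conjDiag U d * U = U * diagonal d := by
    rw [conjDiag, Matrix.mul_assoc, hU, Matrix.mul_one]
  have h1 : conjDiag U d *ᵥ U.col i = (conjDiag U d * U).col i := by
    ext j; simp [mulVec, dotProduct, Matrix.mul_apply, col]
  rw [h1, h]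
  ext j
  simp [col, mul_diagonal, mul_comm]

theorem col_dotProduct_col (hU : Uᵀ * U = 1) (i : ν) : U.col i ⬝ᵥ U.col i = 1 := by
  have := congrFun (congrFun hU i) i
  simpa [Matrix.mul_apply, dotProduct, col] using this

theorem exists_conjDiag {M : Matrix ν ν ℝ} (hM : M.IsSymm) :
    ∃ (U : Matrix ν ν ℝ) (d : ν → ℝ), Uᵀ * U = 1 ∧ M = conjDiag U d := by
  have hH : M.IsHermitian := by simpa [IsHermitian] using hM.eq
  refine ⟨hH.eigenvectorUnitary, hH.eigenvalues, ?_, ?_⟩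
  · have := Unitary.coe_star_mul_self hH.eigenvectorUnitary
    simpa [star_eq_conjTranspose] using this
  · have := hH.spectral_theorem
    rw [Unitary.conjStarAlgAut_apply] at this
    simpa [conjDiag, star_eq_conjTranspose, Function.comp_def] using this

theorem eigenvalue_eq_dotProduct (hU : Uᵀ * U = 1) (d : ν → ℝ) (i : ν) :
    U.col i ⬝ᵥ conjDiag U d *ᵥ U.col i = d i := by
  rw [mulVec_col_conjDiag hU, dotProduct_smul, col_dotProduct_col hU, smul_eq_mul, mul_one]

theorem col_ne_zero (hU : Uᵀ * U = 1) (i : ν) : U.col i ≠ 0 := fun h => by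
  have := col_dotProduct_col hU i
  simp [h] at this

theorem pos_of_conjDiag_posDef (hU : Uᵀ * U = 1) {d : ν → ℝ} (h : (conjDiag U d).PosDef)
    (i : ν) : 0 < d i := by
  rw [← eigenvalue_eq_dotProduct hU d i]
  exact dotProduct_pos_of_posDef h (col_ne_zero hU i)

theorem nonneg_of_conjDiag_posSemidef (hU : Uᵀ * U = 1) {d : ν → ℝ}
    (h : (conjDiag U d).PosSemidef) (i : ν) : 0 ≤ d i := by
  rw [← eigenvalue_eq_dotProduct hU d i]
  exact dotProduct_nonneg_of_posSemidef h _

/-- The trace of a product of two positive semidefinite matrices is nonnegative. -/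
theorem trace_mul_nonneg {A B : Matrix ν ν ℝ} (hA : A.PosSemidef) (hB : B.PosSemidef) :
    0 ≤ (A * B).trace := by
  obtain ⟨U, d, hU, rfl⟩ := exists_conjDiag (isSymm_of_posSemidef hA)
  rw [trace_conjDiag_mul]
  refine sum_nonneg fun i _ => mul_nonneg (nonneg_of_conjDiag_posSemidef hU hA i) ?_
  have := hB.conjTranspose_mul_mul_same U
  simpa using this.diag_nonneg (i := i)

end Spectral

/-! ### The Lieb–Thirring inequality for exponents 2^k -/

section LiebThirring

variable {ν : Type*} [Fintype ν] [DecidableEq ν]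

theorem trace_mul_pow_comm (A B : Matrix ν ν ℝ) (k : ℕ) :
    ((A * B) ^ k).trace = ((B * A) ^ k).trace := by
  cases k with
  | zero => simp
  | succ k =>
    rw [pow_succ, ← Matrix.mul_assoc, mul_pow_mul, Matrix.trace_mul_comm, ← Matrix.mul_assoc,
      pow_succ' (B * A)]

/-- Expand the squared Frobenius norm of M - Mᵀ. -/
theorem trace_sq_le (M : Matrix ν ν ℝ) : (M * M).trace ≤ (M * Mᵀ).trace := by
  have h : 0 ≤ ((M - Mᵀ) * (M - Mᵀ)ᵀ).trace := by
    have := (posSemidef_self_mul_conjTranspose (M - Mᵀ)).trace_nonneg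
    simpa using this
  have h1 : (Mᵀ * Mᵀ).trace = (M * M).trace := by
    rw [← transpose_mul, trace_transpose]
  have h2 : (Mᵀ * M).trace = (M * Mᵀ).trace := Matrix.trace_mul_comm _ _
  rw [transpose_sub, transpose_transpose, Matrix.sub_mul, Matrix.mul_sub, Matrix.mul_sub,
    trace_sub, trace_sub, trace_sub, h1, h2] at h
  linarith

theorem trace_mul_le_of_isSymm {A B : Matrix ν ν ℝ} (hA : A.IsSymm) (hB : B.IsSymm) :
    2 * (A * B).trace ≤ (A * A).trace + (B * B).trace := by
  have h : 0 ≤ ((A - B) * (A - B)ᵀ).trace := by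
    have := (posSemidef_self_mul_conjTranspose (A - B)).trace_nonneg
    simpa using this
  have h2 : (B * A).trace = (A * B).trace := Matrix.trace_mul_comm _ _
  rw [transpose_sub, hA.eq, hB.eq, Matrix.sub_mul, Matrix.mul_sub, Matrix.mul_sub,
    trace_sub, trace_sub, trace_sub, h2] at h
  linarith

theorem isSymm_pow {A : Matrix ν ν ℝ} (hA : A.IsSymm) (k : ℕ) : (A ^ k).IsSymm := by
  rw [IsSymm, transpose_pow, hA.eq]

/-- The two statements support each other in the induction. For the first, apply the second to M =
AB; cyclicity turns ABBA into A²B², to which the first applies at the previous level. For the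
second, apply it to M²; cyclicity regroups MMMᵀMᵀ as (MᵀM)(MMᵀ), and the first splits the power.
What remains is an inner product of two symmetric matrices with equal Frobenius norms, bounded by
the arithmetic-geometric mean inequality. -/
theorem lieb_thirring_aux (k : ℕ) :
    (∀ A B : Matrix ν ν ℝ, A.IsSymm → B.IsSymm → A.PosSemidef → B.PosSemidef →
      ((A * B) ^ 2 ^ k).trace ≤ (A ^ 2 ^ k * B ^ 2 ^ k).trace) ∧
    (∀ M : Matrix ν ν ℝ, (M ^ 2 ^ (k + 1)).trace ≤ ((M * Mᵀ) ^ 2 ^ k).trace) := by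
  induction k with
  | zero => exact ⟨fun A B _ _ _ _ => by simp, fun M => by simpa [sq] using trace_sq_le M⟩
  | succ k ih =>
    obtain ⟨ihL, ihW⟩ := ih
    refine ⟨fun A B hA hB pA pB => ?_, fun M => ?_⟩
    · have hA2 : (A * A).PosSemidef := by simpa [sq] using pA.pow 2
      have hB2 : (B * B).PosSemidef := by simpa [sq] using pB.pow 2
      calc ((A * B) ^ 2 ^ (k + 1)).trace ≤ ((A * B * (A * B)ᵀ) ^ 2 ^ k).trace := ihW _
        _ = ((A * (B * B * A)) ^ 2 ^ k).trace := by
            rw [transpose_mul, hA.eq, hB.eq]; simp only [Matrix.mul_assoc]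
        _ = ((B * B * (A * A)) ^ 2 ^ k).trace := by
            rw [trace_mul_pow_comm]; simp only [Matrix.mul_assoc]
        _ = ((A * A * (B * B)) ^ 2 ^ k).trace := trace_mul_pow_comm _ _ _
        _ ≤ ((A * A) ^ 2 ^ k * (B * B) ^ 2 ^ k).trace :=
            ihL _ _ (isSymm_of_posSemidef hA2) (isSymm_of_posSemidef hB2) hA2 hB2
        _ = _ := by rw [← sq, ← sq, ← pow_mul, ← pow_mul, ← pow_succ']
    · have h1 : (Mᵀ * M).PosSemidef := by simpa using posSemidef_conjTranspose_mul_self M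
      have h2 : (M * Mᵀ).PosSemidef := by simpa using posSemidef_self_mul_conjTranspose M
      have s1 := isSymm_of_posSemidef h1
      have s2 := isSymm_of_posSemidef h2
      have h3 := trace_mul_le_of_isSymm (isSymm_pow s1 (2 ^ k)) (isSymm_pow s2 (2 ^ k))
      rw [← pow_add, ← pow_add, trace_mul_pow_comm Mᵀ M, ← two_mul,
        show 2 ^ k + 2 ^ k = 2 ^ (k + 1) by ring] at h3
      calc (M ^ 2 ^ (k + 1 + 1)).trace = ((M * M) ^ 2 ^ (k + 1)).trace := by
            rw [← sq, ← pow_mul, ← pow_succ']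
        _ ≤ ((M * M * (M * M)ᵀ) ^ 2 ^ k).trace := ihW _
        _ = ((M * (M * Mᵀ * Mᵀ)) ^ 2 ^ k).trace := by
            rw [transpose_mul]; simp only [Matrix.mul_assoc]
        _ = ((M * Mᵀ * (Mᵀ * M)) ^ 2 ^ k).trace := by
            rw [trace_mul_pow_comm]; simp only [Matrix.mul_assoc]
        _ = ((Mᵀ * M * (M * Mᵀ)) ^ 2 ^ k).trace := trace_mul_pow_comm _ _ _
        _ ≤ ((Mᵀ * M) ^ 2 ^ k * (M * Mᵀ) ^ 2 ^ k).trace := ihL _ _ s1 s2 h1 h2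
        _ ≤ _ := by linarith

/-- The Lieb–Thirring trace inequality for exponents that are powers of two. -/
theorem lieb_thirring {A B : Matrix ν ν ℝ} (hA : A.PosSemidef) (hB : B.PosSemidef) (k : ℕ) :
    ((A * B) ^ 2 ^ k).trace ≤ (A ^ 2 ^ k * B ^ 2 ^ k).trace :=
  (lieb_thirring_aux k).1 A B (isSymm_of_posSemidef hA) (isSymm_of_posSemidef hB) hA hB

end LiebThirring

end MatrixDiscrepancy

namespace MatrixDiscrepancy
open Matrix Finset

/-! ### Second-order expansion of the barrier -/

section Barrier

variable {ν : Type*} [Fintype ν] [DecidableEq ν]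

/-- Bernoulli gives (1 - z)^p ≥ 1 - pz, and 1/(1 - u) ≤ 1 + u + 2u² for |u| ≤ 1/2, used at u = pz.
-/
theorem inv_one_sub_pow_le {z : ℝ} {p : ℕ} (hp : 1 ≤ p) (hz : (p : ℝ) ^ 2 * z ^ 2 ≤ 1 / 4) :
    ((1 - z)⁻¹) ^ p ≤ 1 + p * z + 2 * p ^ 2 * z ^ 2 := by
  have hp' : (1 : ℝ) ≤ p := by exact_mod_cast hp
  have h1 : |(p : ℝ) * z| ≤ 1 / 2 := by
    apply abs_le_of_sq_le_sq _ (by norm_num)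
    nlinarith
  obtain ⟨h2, h3⟩ := abs_le.1 h1
  have hz1 : z ≤ 1 / 2 := by
    by_contra hcon
    nlinarith
  have h4 : 1 + (p : ℝ) * (-z) ≤ (1 + -z) ^ p := one_add_mul_le_pow (by linarith) p
  have h5 : 0 < 1 + (p : ℝ) * (-z) := by linarith
  rw [inv_pow, show (1 - z) = 1 + -z by ring]
  calc ((1 + -z) ^ p)⁻¹ ≤ (1 + (p : ℝ) * (-z))⁻¹ := inv_anti₀ h5 h4
    _ ≤ _ := by
      rw [inv_le_iff_one_le_mul₀ h5]
      nlinarith [sq_nonneg ((p : ℝ) * z)]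

/-- In the eigenbasis both sides are sums over i, j with the symmetric weights W i j ^ 2. After
symmetrizing in i and j, the difference of the coefficients is (rᵢ^(p+1) - rⱼ^(p+1))(rᵢ - rⱼ) ≥ 0.
-/
theorem trace_conjDiag_mul_mul_mul_le {U : Matrix ν ν ℝ} (hU : Uᵀ * U = 1) {r : ν → ℝ}
    (hr : ∀ i, 0 ≤ r i) {Y : Matrix ν ν ℝ} (hY : Y.IsSymm) (p : ℕ) :
    (conjDiag U r ^ (p + 1) * Y * conjDiag U r * Y).trace ≤
      (conjDiag U r ^ (p + 2) * (Y * Y)).trace := by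
  set W := Uᵀ * Y * U with hW
  have hWs : ∀ i j, W i j = W j i := fun i j => by
    have : Wᵀ = W := by simp [hW, hY.eq, Matrix.mul_assoc]
    exact congrFun (congrFun this j) i
  have e1 : (conjDiag U r ^ (p + 1) * Y * conjDiag U r * Y).trace =
      ∑ i, ∑ j, r i ^ (p + 1) * r j * W i j ^ 2 := by
    rw [conjDiag_pow hU, Matrix.mul_assoc, Matrix.mul_assoc, trace_conjDiag_mul]
    refine sum_congr rfl fun i _ => ?_
    have : Uᵀ * (Y * (conjDiag U r * Y)) * U = W * diagonal r * W := by
      simp only [hW, conjDiag, Matrix.mul_assoc]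
    rw [this, Matrix.mul_apply, mul_sum]
    refine sum_congr rfl fun j _ => ?_
    rw [mul_diagonal, hWs j i]; ring
  have e2 : (conjDiag U r ^ (p + 2) * (Y * Y)).trace =
      ∑ i, ∑ j, r i ^ (p + 2) * W i j ^ 2 := by
    rw [conjDiag_pow hU, trace_conjDiag_mul]
    refine sum_congr rfl fun i _ => ?_
    have : Uᵀ * (Y * Y) * U = W * W := by
      calc Uᵀ * (Y * Y) * U = Uᵀ * (Y * (U * Uᵀ) * Y) * U := by
            rw [mul_transpose_of_transpose_mul hU, Matrix.mul_one]
        _ = _ := by simp only [hW, Matrix.mul_assoc]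
    rw [this, Matrix.mul_apply, mul_sum]
    refine sum_congr rfl fun j _ => ?_
    rw [hWs j i]; ring
  have e1' : ∑ i, ∑ j, r i ^ (p + 1) * r j * W i j ^ 2 =
      ∑ i, ∑ j, r j ^ (p + 1) * r i * W i j ^ 2 := by
    rw [sum_comm]
    exact sum_congr rfl fun i _ => sum_congr rfl fun j _ => by rw [hWs]
  have e2' : ∑ i, ∑ j, r i ^ (p + 2) * W i j ^ 2 = ∑ i, ∑ j, r j ^ (p + 2) * W i j ^ 2 := by
    rw [sum_comm]
    exact sum_congr rfl fun i _ => sum_congr rfl fun j _ => by rw [hWs]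
  rw [e1, e2]
  have key : ∑ i, ∑ j, r i ^ (p + 1) * r j * W i j ^ 2 +
        ∑ i, ∑ j, r j ^ (p + 1) * r i * W i j ^ 2 ≤
      ∑ i, ∑ j, r i ^ (p + 2) * W i j ^ 2 + ∑ i, ∑ j, r j ^ (p + 2) * W i j ^ 2 := by
    simp only [← sum_add_distrib]
    refine sum_le_sum fun i _ => sum_le_sum fun j _ => ?_
    have : 0 ≤ (r i ^ (p + 1) - r j ^ (p + 1)) * (r i - r j) := by
      rcases le_total (r i) (r j) with h | h
      · exact mul_nonneg_of_nonpos_of_nonpos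
          (sub_nonpos.2 (pow_le_pow_left₀ (hr i) h _)) (sub_nonpos.2 h)
      · exact mul_nonneg (sub_nonneg.2 (pow_le_pow_left₀ (hr j) h _)) (sub_nonneg.2 h)
    have h2 := mul_nonneg this (sq_nonneg (W i j))
    have e : r i ^ (p + 2) = r i ^ (p + 1) * r i := pow_succ _ _
    have e' : r j ^ (p + 2) = r j ^ (p + 1) * r j := pow_succ _ _
    rw [e, e']
    nlinarith
  linarith

theorem mulVec_dotProduct_mulVec_of_isSymm {Y : Matrix ν ν ℝ} (hY : Y.IsSymm) (u w : ν → ℝ) :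
    (Y *ᵥ u) ⬝ᵥ w = u ⬝ᵥ Y *ᵥ w := by
  rw [dotProduct_mulVec, ← mulVec_transpose, hY.eq]

/-- With S = M^(-1/2) and Z = SYS one has (M - Y)⁻¹ = S(1 - Z)⁻¹S. By cyclicity the trace of its
p-th power is that of ((1 - Z)⁻¹R)^p with R = M⁻¹, and Lieb–Thirring separates the two factors. The
scalar expansion then applies to the eigenvalues of Z, which `h` confines to |z| ≤ 1/(2p). -/
theorem barrier_step {M Y : Matrix ν ν ℝ} (hM : M.PosDef) (hY : Y.IsSymm) (k : ℕ)
    (h : ∀ w : ν → ℝ, ((2 : ℝ) ^ k) ^ 2 * (((M⁻¹ * Y) *ᵥ w) ⬝ᵥ ((M⁻¹ * Y) *ᵥ w)) ≤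
      1 / 4 * (w ⬝ᵥ w)) :
    (M - Y).PosDef ∧ ((M - Y)⁻¹ ^ 2 ^ k).trace ≤
      (M⁻¹ ^ 2 ^ k).trace + 2 ^ k * (M⁻¹ ^ (2 ^ k + 1) * Y).trace +
        2 * ((2 : ℝ) ^ k) ^ 2 * (M⁻¹ ^ (2 ^ k + 2) * (Y * Y)).trace := by
  obtain ⟨U, d, hU, hMd⟩ := exists_conjDiag (isSymm_of_posDef hM)
  have hd : ∀ i, 0 < d i := pos_of_conjDiag_posDef hU (hMd ▸ hM)
  set R := M⁻¹ with hR
  have hRd : R = conjDiag U (fun i => (d i)⁻¹) := by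
    rw [hR, hMd, conjDiag_inv hU fun i => (hd i).ne']
  have hr : ∀ i, 0 < (d i)⁻¹ := fun i => inv_pos.2 (hd i)
  set S := conjDiag U (fun i => √(d i)⁻¹) with hS
  set T' := conjDiag U (fun i => √(d i)) with hT'
  have hSS : S * S = R := by
    rw [hS, conjDiag_mul hU, hRd]
    congr 1; funext i; exact Real.mul_self_sqrt (hr i).le
  have hTT : T' * T' = M := by
    rw [hT', conjDiag_mul hU, hMd]
    congr 1; funext i; exact Real.mul_self_sqrt (hd i).le
  have hST : S * T' = 1 := by
    rw [hS, hT', conjDiag_mul hU, ← conjDiag_one hU]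
    congr 1; funext i
    rw [Real.sqrt_inv, inv_mul_cancel₀ (Real.sqrt_pos.2 (hd i)).ne']
  have hTS : T' * S = 1 := mul_eq_one_comm.1 hST
  have hSsymm : Sᵀ = S := conjDiag_isSymm _
  have hTsymm : T'ᵀ = T' := conjDiag_isSymm _
  have hSR : S * R = R * S := by rw [← hSS]; simp only [Matrix.mul_assoc]
  set Z := S * Y * S with hZ
  have hZs : Z.IsSymm := by simp [IsSymm, hZ, hSsymm, hY.eq, Matrix.mul_assoc]
  obtain ⟨V, z, hV, hZd⟩ := exists_conjDiag hZs
  -- If v is an eigenvector of Z = SYS, then Sv is an eigenvector of RY = S²Y with the same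
  -- eigenvalue, so `h` can be tested on Sv.
  have hz : ∀ i, ((2 : ℝ) ^ k) ^ 2 * z i ^ 2 ≤ 1 / 4 := fun i => by
    have hw : S *ᵥ V.col i ≠ 0 := fun h0 => by
      apply col_ne_zero hV i
      have : T' *ᵥ (S *ᵥ V.col i) = 0 := by rw [h0, mulVec_zero]
      rwa [mulVec_mulVec, hTS, one_mulVec] at this
    have h1 : (R * Y) *ᵥ (S *ᵥ V.col i) = z i • (S *ᵥ V.col i) := by
      rw [mulVec_mulVec, ← hSS]
      have : S * S * Y * S = S * Z := by simp only [hZ, Matrix.mul_assoc]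
      rw [this, ← mulVec_mulVec, hZd, mulVec_col_conjDiag hV, mulVec_smul]
    have h2 := h (S *ᵥ V.col i)
    rw [h1, dotProduct_smul, smul_dotProduct, smul_eq_mul, smul_eq_mul] at h2
    have h3 := dotProduct_self_pos hw
    by_contra hcon
    push Not at hcon
    nlinarith
  have hz1 : ∀ i, z i ≤ 1 / 2 := fun i => by
    have h1 : (1 : ℝ) ≤ (2 : ℝ) ^ k := one_le_pow₀ (by norm_num)
    have := hz i
    by_contra hcon
    push Not at hcon
    have h4 : 1 / 4 < z i ^ 2 := by nlinarith
    have h5 : (1 : ℝ) ≤ ((2 : ℝ) ^ k) ^ 2 := one_le_pow₀ h1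
    nlinarith
  set T := conjDiag V (fun i => 1 - z i) with hT
  have hTZ : T = 1 - Z := by rw [hZd, ← conjDiag_one hV, conjDiag_sub]
  have hTp : ∀ i, 0 < 1 - z i := fun i => by have := hz1 i; linarith
  have hMY : M - Y = T' * T * T' := by
    rw [hTZ, Matrix.mul_sub, Matrix.sub_mul, Matrix.mul_one, hTT]
    congr 1
    calc Y = (T' * S) * Y * (S * T') := by rw [hTS, hST, Matrix.one_mul, Matrix.mul_one]
      _ = _ := by simp only [hZ, Matrix.mul_assoc]
  have hTpd : T.PosDef := conjDiag_posDef hV hTp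
  have hTi : T⁻¹ = conjDiag V (fun i => (1 - z i)⁻¹) := by
    rw [hT, conjDiag_inv hV fun i => (hTp i).ne']
  have hTiT : T * T⁻¹ = 1 := by
    rw [hTi, hT, conjDiag_mul hV, ← conjDiag_one hV]
    congr 1; funext i; exact mul_inv_cancel₀ (hTp i).ne'
  have hinv : (M - Y)⁻¹ = S * (T⁻¹ * S) := by
    apply inv_eq_right_inv
    rw [hMY]
    calc T' * T * T' * (S * (T⁻¹ * S)) = T' * (T * ((T' * S) * T⁻¹)) * S := by
          simp only [Matrix.mul_assoc]
      _ = 1 := by rw [hTS, Matrix.one_mul, hTiT, Matrix.mul_one, hTS]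
  refine ⟨?_, ?_⟩
  · rw [hMY]
    refine posDef_of_dotProduct ?_ fun v hv => ?_
    · simp [IsSymm, hTsymm, (isSymm_of_posDef hTpd).eq, Matrix.mul_assoc]
    · have hw : T' *ᵥ v ≠ 0 := fun h0 => by
        apply hv
        have : S *ᵥ (T' *ᵥ v) = 0 := by rw [h0, mulVec_zero]
        rwa [mulVec_mulVec, hST, one_mulVec] at this
      have := dotProduct_pos_of_posDef hTpd hw
      rwa [mulVec_dotProduct_mulVec_of_isSymm hTsymm, mulVec_mulVec, mulVec_mulVec] at this
  · set p := 2 ^ k with hp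
    have hp1 : 1 ≤ p := Nat.one_le_two_pow
    have hpc : ((p : ℕ) : ℝ) = (2 : ℝ) ^ k := by simp [hp]
    rw [← hpc] at hz ⊢
    have hRpsd : R.PosSemidef := hM.inv.posSemidef
    have hTipsd : T⁻¹.PosSemidef := hTpd.inv.posSemidef
    have a1 : ((M - Y)⁻¹ ^ p).trace ≤ (T⁻¹ ^ p * R ^ p).trace := by
      rw [hinv, trace_mul_pow_comm, Matrix.mul_assoc, hSS]
      exact lieb_thirring hTipsd hRpsd k
    -- The scalar inequality on the spectrum of Z becomes an operator inequality, which may be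
    -- paired with the positive semidefinite R^p under the trace.
    have a2 : (1 + (p : ℝ) • Z + (2 * (p : ℝ) ^ 2) • (Z * Z) - T⁻¹ ^ p).PosSemidef := by
      rw [hZd, conjDiag_mul hV, hTi, conjDiag_pow hV, ← conjDiag_one hV, conjDiag_smul,
        conjDiag_smul, conjDiag_add, conjDiag_add, conjDiag_sub]
      refine conjDiag_posSemidef fun i => ?_
      have := inv_one_sub_pow_le hp1 (hz i)
      rw [sub_nonneg]
      nlinarith
    have a3 := trace_mul_nonneg a2 (hRpsd.pow p)
    rw [Matrix.sub_mul, Matrix.add_mul, Matrix.add_mul, trace_sub, trace_add, trace_add,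
      Matrix.one_mul, Matrix.smul_mul, Matrix.smul_mul, trace_smul, trace_smul, smul_eq_mul,
      smul_eq_mul] at a3
    have hSRp : S * R ^ p = R ^ p * S := by
      have : Commute S R := hSR
      exact this.pow_right p
    have b1 : (Z * R ^ p).trace = (R ^ (p + 1) * Y).trace := by
      have : Z * R ^ p = S * (Y * (R ^ p * S)) := by
        rw [hZ, Matrix.mul_assoc, hSRp]; simp only [Matrix.mul_assoc]
      rw [this, Matrix.trace_mul_comm, ← hSRp]
      have : Y * (S * R ^ p) * S = Y * R ^ (p + 1) := by
        rw [Matrix.mul_assoc, Matrix.mul_assoc, ← hSRp, ← Matrix.mul_assoc S S, hSS,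
          pow_succ' R p]
      rw [this, Matrix.trace_mul_comm]
    have b2 : (Z * Z * R ^ p).trace = (R ^ (p + 1) * Y * R * Y).trace := by
      have : Z * Z * R ^ p = S * (Y * (S * S) * Y * (R ^ p * S)) := by
        rw [← hSRp]; simp only [hZ, Matrix.mul_assoc]
      rw [this, Matrix.trace_mul_comm, hSS, ← hSRp]
      have : Y * R * Y * (S * R ^ p) * S = (Y * R * Y) * R ^ (p + 1) := by
        rw [Matrix.mul_assoc _ _ S, Matrix.mul_assoc S, ← hSRp, ← Matrix.mul_assoc S S, hSS,
          pow_succ' R p]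
      rw [this, Matrix.trace_mul_comm]; simp only [Matrix.mul_assoc]
    have b3 : (R ^ (p + 1) * Y * R * Y).trace ≤ (R ^ (p + 2) * (Y * Y)).trace := by
      rw [hRd]
      exact trace_conjDiag_mul_mul_mul_le hU (fun i => (hr i).le) hY p
    rw [b1, b2] at a3
    have hp0 : (0 : ℝ) ≤ 2 * (p : ℝ) ^ 2 := by positivity
    have := mul_le_mul_of_nonneg_left b3 hp0
    linarith

theorem dotProduct_mulVec_le_trace {B : Matrix ν ν ℝ} (hB : B.PosSemidef) (w : ν → ℝ) :
    w ⬝ᵥ B *ᵥ w ≤ B.trace * (w ⬝ᵥ w) := by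
  obtain ⟨U, d, hU, hBd⟩ := exists_conjDiag (isSymm_of_posSemidef hB)
  have hd : ∀ i, 0 ≤ d i := nonneg_of_conjDiag_posSemidef hU (hBd ▸ hB)
  rw [hBd, dotProduct_conjDiag, trace_conjDiag hU, ← transpose_mulVec_dotProduct hU w, dotProduct,
    mul_sum]
  refine sum_le_sum fun i _ => ?_
  rw [sq]
  exact mul_le_mul_of_nonneg_right (single_le_sum (fun j _ => hd j) (mem_univ i))
    (mul_self_nonneg _)

/-- Each eigenvalue r of R satisfies r² ≤ θ² + θ^(-p) r^(p+2), by the cases r ≤ θ and r ≥ θ. The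
first term is controlled by the norm of Y, the second by the trace of YR^(p+2)Y. This verifies the
smallness hypothesis of `barrier_step` although R itself may have large eigenvalues. -/
theorem norm_mul_mulVec_le {R Y : Matrix ν ν ℝ} (hR : R.PosSemidef) (hY : Y.IsSymm) {c θ : ℝ}
    (hθ : 0 < θ) (p : ℕ) (hYc : ∀ w : ν → ℝ, (Y *ᵥ w) ⬝ᵥ (Y *ᵥ w) ≤ c * (w ⬝ᵥ w))
    (w : ν → ℝ) :
    ((R * Y) *ᵥ w) ⬝ᵥ ((R * Y) *ᵥ w) ≤
      (θ ^ 2 * c + (θ ^ p)⁻¹ * (R ^ (p + 2) * (Y * Y)).trace) * (w ⬝ᵥ w) := by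
  obtain ⟨U, r, hU, hRd⟩ := exists_conjDiag (isSymm_of_posSemidef hR)
  have hr : ∀ i, 0 ≤ r i := nonneg_of_conjDiag_posSemidef hU (hRd ▸ hR)
  set v := Y *ᵥ w with hv
  have h1 : ((R * Y) *ᵥ w) ⬝ᵥ ((R * Y) *ᵥ w) = v ⬝ᵥ (R ^ 2) *ᵥ v := by
    rw [← mulVec_mulVec, ← hv, mulVec_dotProduct_mulVec_of_isSymm (isSymm_of_posSemidef hR),
      mulVec_mulVec, sq]
  have h2 : v ⬝ᵥ (R ^ 2) *ᵥ v ≤ θ ^ 2 * (v ⬝ᵥ v) + (θ ^ p)⁻¹ * (v ⬝ᵥ (R ^ (p + 2)) *ᵥ v) := by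
    rw [hRd, conjDiag_pow hU, conjDiag_pow hU, dotProduct_conjDiag, dotProduct_conjDiag,
      ← transpose_mulVec_dotProduct hU v, dotProduct, mul_sum, mul_sum, ← sum_add_distrib]
    refine sum_le_sum fun i _ => ?_
    have hpos : 0 < θ ^ p := pow_pos hθ p
    have : r i ^ 2 ≤ θ ^ 2 + (θ ^ p)⁻¹ * r i ^ (p + 2) := by
      rcases le_total (r i) θ with hle | hle
      · have := pow_le_pow_left₀ (hr i) hle 2
        have : 0 ≤ (θ ^ p)⁻¹ * r i ^ (p + 2) :=
          mul_nonneg (inv_pos.2 hpos).le (pow_nonneg (hr i) _)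
        linarith
      · have h3 := pow_le_pow_left₀ hθ.le hle p
        have h4 : r i ^ 2 ≤ (θ ^ p)⁻¹ * r i ^ (p + 2) := by
          rw [inv_mul_eq_div, le_div_iff₀ hpos, pow_add, mul_comm]
          exact mul_le_mul_of_nonneg_right h3 (sq_nonneg _)
        nlinarith [sq_nonneg θ]
    have := mul_le_mul_of_nonneg_right this (sq_nonneg ((Uᵀ *ᵥ v) i))
    nlinarith
  have h3 : v ⬝ᵥ (R ^ (p + 2)) *ᵥ v ≤ (R ^ (p + 2) * (Y * Y)).trace * (w ⬝ᵥ w) := by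
    have hB : (Y * R ^ (p + 2) * Y).PosSemidef := by
      have := (hR.pow (p + 2)).conjTranspose_mul_mul_same Y
      simpa [hY.eq] using this
    have h4 := dotProduct_mulVec_le_trace hB w
    rw [Matrix.mul_assoc, Matrix.trace_mul_comm, Matrix.mul_assoc] at h4
    rwa [hv, mulVec_dotProduct_mulVec_of_isSymm hY, mulVec_mulVec, mulVec_mulVec,
      Matrix.mul_assoc Y]
  have h5 := hYc w
  have h6 : 0 ≤ (θ ^ p)⁻¹ := by positivity
  have h7 := mul_le_mul_of_nonneg_left h3 h6
  have h8 := mul_le_mul_of_nonneg_left h5 (sq_nonneg θ)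
  rw [h1]
  nlinarith

/-- Jensen's inequality for the convex function d ↦ d^(-p): the eigenvalues have mean b. -/
theorem card_mul_inv_pow_le_trace_inv_pow {M : Matrix ν ν ℝ} (hM : M.PosDef) {b : ℝ}
    (hb : 0 < b) (hMt : M.trace = Fintype.card ν * b) (p : ℕ) :
    Fintype.card ν * (b⁻¹) ^ p ≤ (M⁻¹ ^ p).trace := by
  obtain ⟨U, d, hU, hMd⟩ := exists_conjDiag (isSymm_of_posDef hM)
  have hd : ∀ i, 0 < d i := pos_of_conjDiag_posDef hU (hMd ▸ hM)
  have hs : ∑ i, d i = Fintype.card ν * b := by rw [← hMt, hMd, trace_conjDiag hU]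
  -- The left side is the tangent line at d = b; its linear part cancels in the sum over the
  -- eigenvalues.
  have key : ∀ i, (b⁻¹) ^ p * (1 + p * (1 - d i / b)) ≤ ((d i)⁻¹) ^ p := fun i => by
    have hdi := hd i
    have h1 : 1 + (p : ℝ) * (b / d i - 1) ≤ (1 + (b / d i - 1)) ^ p :=
      one_add_mul_le_pow (by have : 0 < b / d i := by positivity
                             linarith) p
    have h2 : 1 - d i / b ≤ b / d i - 1 := by
      have e : b / d i - 1 - (1 - d i / b) = (b - d i) ^ 2 / (b * d i) := by
        field_simp
      have : 0 ≤ (b - d i) ^ 2 / (b * d i) := by positivity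
      linarith
    have h3 : 1 + (p : ℝ) * (1 - d i / b) ≤ (b / d i) ^ p := by
      have := mul_le_mul_of_nonneg_left h2 (Nat.cast_nonneg (α := ℝ) p)
      calc _ ≤ 1 + (p : ℝ) * (b / d i - 1) := by linarith
        _ ≤ _ := by rwa [add_sub_cancel] at h1
    calc _ ≤ (b⁻¹) ^ p * (b / d i) ^ p := mul_le_mul_of_nonneg_left h3 (by positivity)
      _ = _ := by rw [← mul_pow]; congr 1; field_simp
  rw [hMd, conjDiag_inv hU fun i => (hd i).ne', conjDiag_pow hU, trace_conjDiag hU]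
  calc (Fintype.card ν : ℝ) * (b⁻¹) ^ p = ∑ i, (b⁻¹) ^ p * (1 + p * (1 - d i / b)) := by
        rw [← mul_sum, sum_add_distrib, ← mul_sum, sum_sub_distrib, ← sum_div, hs]
        simp only [sum_const, card_univ, nsmul_eq_mul, mul_one]
        rw [mul_div_assoc, div_self hb.ne']
        ring
    _ ≤ _ := sum_le_sum fun i _ => key i

end Barrier

end MatrixDiscrepancy

namespace MatrixDiscrepancy
open Matrix Finset

/-! ### Eigenvectors supported in single blocks -/

section BlockDiagonalization

/-- The blocks are diagonalized separately. The spectral theorem for the whole matrix would not do: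
when different blocks share an eigenvalue, its eigenvectors may mix the blocks. -/
theorem exists_conjDiag_blockDiagonal {ν κ β : Type*} [Fintype ν] [DecidableEq ν] [Fintype κ]
    [DecidableEq κ] [Fintype β] [DecidableEq β] (e : ν ≃ κ × β) {M : Matrix ν ν ℝ}
    (hM : M.IsSymm) (hb : ∀ i j, (e i).2 ≠ (e j).2 → M i j = 0) :
    ∃ (U : Matrix ν ν ℝ) (d : ν → ℝ), Uᵀ * U = 1 ∧ M = conjDiag U d ∧
      ∀ i j, (e i).2 ≠ (e j).2 → U i j = 0 := by
  have hs : ∀ b : β, (of fun k l => M (e.symm (k, b)) (e.symm (l, b))).IsSymm := fun b => by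
    ext k l
    exact congrFun (congrFun hM _) _
  choose V d hV hMV using fun b => exists_conjDiag (hs b)
  have hMe : M = (blockDiagonal fun b =>
      of fun k l => M (e.symm (k, b)) (e.symm (l, b))).submatrix e e := by
    ext i j
    rw [submatrix_apply, blockDiagonal_apply]
    split_ifs with h
    · simp only [of_apply]
      rw [Prod.mk.eta, h, Prod.mk.eta, e.symm_apply_apply, e.symm_apply_apply]
    · exact hb i j h
  refine ⟨(blockDiagonal V).submatrix e e, fun i => d (e i).2 (e i).1, ?_, ?_, ?_⟩
  · rw [transpose_submatrix, submatrix_mul_equiv, blockDiagonal_transpose, ← blockDiagonal_mul]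
    simp only [hV]
    have : (blockDiagonal fun _ : β => (1 : Matrix κ κ ℝ)) = 1 := blockDiagonal_one
    rw [this, submatrix_one_equiv]
  · have hd : diagonal (fun i => d (e i).2 (e i).1) =
        (blockDiagonal fun b => diagonal (d b)).submatrix e e := by
      rw [blockDiagonal_diagonal]
      exact (submatrix_diagonal_equiv (fun ik : κ × β => d ik.2 ik.1) e).symm
    conv_lhs => rw [hMe]
    rw [conjDiag, hd, transpose_submatrix, submatrix_mul_equiv, submatrix_mul_equiv,
      blockDiagonal_transpose, ← blockDiagonal_mul, ← blockDiagonal_mul]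
    congr 2
    funext b
    exact hMV b
  · intro i j hij
    rw [submatrix_apply, blockDiagonal_apply_ne _ _ _ hij]

theorem exists_conjDiag_of_div {N q : ℕ} (hqN : q ∣ N)
    {M : Matrix (Fin N) (Fin N) ℝ} (hM : M.IsSymm)
    (hb : ∀ i j : Fin N, (i : ℕ) / q ≠ (j : ℕ) / q → M i j = 0) :
    ∃ (U : Matrix (Fin N) (Fin N) ℝ) (d : Fin N → ℝ), Uᵀ * U = 1 ∧ M = conjDiag U d ∧
      ∀ i j : Fin N, (i : ℕ) / q ≠ (j : ℕ) / q → U i j = 0 := by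
  obtain ⟨B, rfl⟩ := hqN
  let e : Fin (q * B) ≃ Fin q × Fin B :=
    ((finCongr (mul_comm q B)).trans finProdFinEquiv.symm).trans (Equiv.prodComm _ _)
  have he : ∀ i, ((e i).2 : ℕ) = (i : ℕ) / q := fun i => by
    simp [e, finProdFinEquiv, Fin.divNat]
  have he' : ∀ i j, (e i).2 ≠ (e j).2 ↔ (i : ℕ) / q ≠ (j : ℕ) / q := fun i j => by
    rw [← he, ← he, Ne, Ne, Fin.ext_iff]
  simpa only [he'] using exists_conjDiag_blockDiagonal e hM (by simpa only [he'] using hb)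

end BlockDiagonalization

/-! ### From a subspace of cheap directions to a column of an inverse -/

section SmallDirections

variable {ι ν : Type*} [Fintype ι] [DecidableEq ι] [Fintype ν] [DecidableEq ν]

/-- The kernel of finitely many linear forms that vanish off `act` contains many orthonormal
vectors supported in `act`. -/
theorem exists_orthonormal_in_kernel {γ : Type*} [Fintype γ] (act : Finset ι)
    (L : γ → ι → ℝ) : ∃ (d : ℕ) (f : Fin d → EuclideanSpace ℝ ι),
      act.card ≤ d + Fintype.card γ ∧ Orthonormal ℝ f ∧
      (∀ j, ∀ a ∉ act, f j a = 0) ∧ ∀ j c, L c ⬝ᵥ (f j : ι → ℝ) = 0 := by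
  classical
  let T : EuclideanSpace ℝ ι →ₗ[ℝ] (({a // a ∉ act} ⊕ γ) → ℝ) :=
    { toFun := fun f => Sum.elim (fun a => f a.1) (fun c => L c ⬝ᵥ (f : ι → ℝ))
      map_add' := fun f g => by
        funext c; cases c <;> simp [dotProduct_add]
      map_smul' := fun r f => by
        funext c; cases c <;> simp }
  let K := LinearMap.ker T
  let f := stdOrthonormalBasis ℝ K
  have hf : ∀ j, T (f j) = 0 := fun j => (f j).2
  refine ⟨Module.finrank ℝ K, fun j => (f j : EuclideanSpace ℝ ι), ?_, ?_, ?_, ?_⟩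
  · have h1 := LinearMap.finrank_range_add_finrank_ker T
    have h2 : Module.finrank ℝ (LinearMap.range T) ≤ Fintype.card ({a // a ∉ act} ⊕ γ) := by
      have := Submodule.finrank_le (LinearMap.range T)
      rwa [Module.finrank_fintype_fun_eq_card] at this
    have h3 : Fintype.card {a // a ∉ act} = Fintype.card ι - act.card := by
      rw [Fintype.card_subtype_compl]; simp
    have h4 : act.card ≤ Fintype.card ι := card_le_univ act
    rw [Fintype.card_sum, h3] at h2
    rw [finrank_euclideanSpace] at h1
    change _ ≤ Module.finrank ℝ (LinearMap.ker T) + _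
    omega
  · exact f.orthonormal.comp_linearIsometry K.subtypeₗᵢ
  · intro j a ha
    exact congrFun (hf j) (Sum.inl ⟨a, ha⟩)
  · intro j c
    exact congrFun (hf j) (Sum.inr c)

/-- Bessel's inequality for w cut off outside `act`, which does not change its products with the `f
j`. -/
theorem sum_dotProduct_sq_le {d : ℕ} {f : Fin d → EuclideanSpace ℝ ι} (hf : Orthonormal ℝ f)
    (act : Finset ι) (hact : ∀ j, ∀ a ∉ act, f j a = 0) (w : ι → ℝ) :
    ∑ j, (w ⬝ᵥ (f j : ι → ℝ)) ^ 2 ≤ ∑ a ∈ act, w a ^ 2 := by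
  classical
  let w' : EuclideanSpace ℝ ι := WithLp.toLp 2 fun a => if a ∈ act then w a else 0
  have h := hf.sum_inner_products_le w' (s := univ)
  have h1 : ∀ j, ‖inner ℝ (f j) w'‖ ^ 2 = (w ⬝ᵥ (f j : ι → ℝ)) ^ 2 := fun j => by
    rw [Real.norm_eq_abs, sq_abs]
    congr 1
    simp only [PiLp.inner_apply, dotProduct, w']
    refine sum_congr rfl fun a _ => ?_
    by_cases ha : a ∈ act
    · simp [ha]
    · simp [ha, hact j a ha]
  have h2 : ‖w'‖ ^ 2 = ∑ a ∈ act, w a ^ 2 := by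
    rw [EuclideanSpace.norm_sq_eq]
    simp [w', ite_pow, sum_ite_mem]
  simpa only [h1, h2] using h

end SmallDirections

end MatrixDiscrepancy

namespace MatrixDiscrepancy
open Matrix Finset

section SmallDirections

variable {ι ν : Type*} [Fintype ι] [DecidableEq ι] [Fintype ν] [DecidableEq ν]

/-- If the form G is small on average over many orthonormal directions, then G⁻¹ is large on them,
and Bessel transfers this to the diagonal entries of G⁻¹ over `act`. Their sum is at least (3d -
|act|)/(4τ); were all of them below 1/(4τ), then 3d ≤ 2|act|. -/
theorem exists_inv_diag_ge {G : Matrix ι ι ℝ} (hG : G.PosDef) {act : Finset ι} {τ : ℝ}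
    (hτ : 0 < τ) {d : ℕ} {f : Fin d → EuclideanSpace ℝ ι} (hf : Orthonormal ℝ f)
    (hact : ∀ j, ∀ a ∉ act, f j a = 0) (hd : 2 * act.card < 3 * d)
    (hsum : ∑ j, (f j : ι → ℝ) ⬝ᵥ G *ᵥ (f j : ι → ℝ) ≤ (d + act.card) * τ) :
    ∃ i ∈ act, 1 ≤ 4 * τ * G⁻¹ i i := by
  by_contra hcon
  push Not at hcon
  have hSs : (G⁻¹).IsSymm := isSymm_of_posDef hG.inv
  have hGS : G * G⁻¹ = 1 := mul_nonsing_inv _ ((isUnit_iff_isUnit_det _).1 hG.isUnit)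
  -- The bound 2s - s²(g·Gg) for g·G⁻¹g is best at s = 1/(g·Gg), and g·Gg averages about 2τ when d
  -- is close to |act|.
  set s := 1 / (2 * τ) with hs
  have h1 : ∀ j, 2 * s - s ^ 2 * ((f j : ι → ℝ) ⬝ᵥ G *ᵥ (f j : ι → ℝ)) ≤
      (f j : ι → ℝ) ⬝ᵥ G⁻¹ *ᵥ (f j : ι → ℝ) := fun j => by
    set g : ι → ℝ := (f j : ι → ℝ) with hg
    have hgg : g ⬝ᵥ g = 1 := by
      have : ‖f j‖ ^ 2 = 1 := by rw [hf.1 j, one_pow]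
      rw [EuclideanSpace.norm_sq_eq] at this
      rw [← this, dotProduct]
      exact sum_congr rfl fun a _ => by rw [Real.norm_eq_abs, sq_abs, sq]
    -- Completing the square: expanding G on G⁻¹g - sg gives the lower bound for g·G⁻¹g.
    have h2 := dotProduct_nonneg_of_posSemidef hG.posSemidef (G⁻¹ *ᵥ g - s • g)
    have e1 : G *ᵥ (G⁻¹ *ᵥ g - s • g) = g - s • (G *ᵥ g) := by
      rw [mulVec_sub, mulVec_mulVec, hGS, one_mulVec, mulVec_smul]
    have e2 : (G⁻¹ *ᵥ g) ⬝ᵥ (G *ᵥ g) = 1 := by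
      rw [mulVec_dotProduct_mulVec_of_isSymm hSs, mulVec_mulVec, mul_eq_one_comm.1 hGS,
        one_mulVec, hgg]
    rw [e1, sub_dotProduct, dotProduct_sub, dotProduct_sub, dotProduct_smul, smul_dotProduct,
      dotProduct_smul, smul_dotProduct, e2, hgg, dotProduct_comm (G⁻¹ *ᵥ g) g] at h2
    simp only [smul_eq_mul] at h2
    nlinarith
  have h2 : ∑ j, (f j : ι → ℝ) ⬝ᵥ G⁻¹ *ᵥ (f j : ι → ℝ) ≤ ∑ a ∈ act, G⁻¹ a a := by
    obtain ⟨V, e, hV, hSd⟩ := exists_conjDiag hSs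
    have he : ∀ i, 0 < e i := pos_of_conjDiag_posDef hV (hSd ▸ hG.inv)
    have e1 : ∀ a, G⁻¹ a a = ∑ i, e i * V a i ^ 2 := fun a => by
      rw [hSd, conjDiag, Matrix.mul_apply]
      exact sum_congr rfl fun i _ => by rw [mul_diagonal, transpose_apply]; ring
    simp only [e1, hSd, dotProduct_conjDiag]
    rw [sum_comm, sum_comm (s := act)]
    refine sum_le_sum fun i _ => ?_
    rw [← mul_sum, ← mul_sum]
    refine mul_le_mul_of_nonneg_left ?_ (he i).le
    exact sum_dotProduct_sq_le hf act hact (fun a => V a i)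
  have h3 : ∑ j : Fin d, (2 * s - s ^ 2 * ((f j : ι → ℝ) ⬝ᵥ G *ᵥ (f j : ι → ℝ))) ≤
      ∑ a ∈ act, G⁻¹ a a := (sum_le_sum fun j _ => h1 j).trans h2
  rw [sum_sub_distrib] at h3
  simp only [sum_const, card_univ, Fintype.card_fin, nsmul_eq_mul] at h3
  rw [← mul_sum] at h3
  have h4 : ∑ a ∈ act, 4 * τ * G⁻¹ a a ≤ act.card := by
    have : ∑ a ∈ act, 4 * τ * G⁻¹ a a ≤ ∑ a ∈ act, (1 : ℝ) :=
      sum_le_sum fun a ha => (hcon a ha).le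
    simpa using this
  rw [← mul_sum] at h4
  have h5 := mul_le_mul_of_nonneg_left hsum (sq_nonneg s)
  have h6 : τ * s = 1 / 2 := by rw [hs]; field_simp
  have hd' : 2 * (act.card : ℝ) < 3 * d := by exact_mod_cast hd
  have h7 : (d : ℝ) * (2 * s) - s ^ 2 * ((d + act.card) * τ) ≤ ∑ a ∈ act, G⁻¹ a a := by linarith
  have h8 := mul_le_mul_of_nonneg_left h7 (by positivity : (0 : ℝ) ≤ 4 * τ)
  have e8 : 4 * τ * ((d : ℝ) * (2 * s) - s ^ 2 * ((d + act.card) * τ)) =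
      8 * d * (τ * s) - 4 * (τ * s) ^ 2 * (d + act.card) := by ring
  rw [e8, h6] at h8
  linarith

end SmallDirections

/-! ### Directions with a small second-order term -/

section Directions

variable {n N : ℕ}

/-- The linear combination of the matrices `A i` with the coefficients `f i`. -/
def comb (A : Fin n → Matrix (Fin N) (Fin N) ℝ) (f : Fin n → ℝ) : Matrix (Fin N) (Fin N) ℝ :=
  ∑ i, f i • A i

variable {A : Fin n → Matrix (Fin N) (Fin N) ℝ}

theorem comb_isSymm (hA : ∀ i, (A i).IsSymm) (f : Fin n → ℝ) : (comb A f).IsSymm := by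
  simp only [comb, IsSymm, transpose_sum, transpose_smul]
  exact sum_congr rfl fun i _ => by rw [(hA i).eq]

theorem comb_mulVec (f : Fin n → ℝ) (w : Fin N → ℝ) (l : Fin N) :
    (comb A f *ᵥ w) l = (fun a => (A a *ᵥ w) l) ⬝ᵥ f := by
  simp only [comb, sum_mulVec, smul_mulVec, Finset.sum_apply, Pi.smul_apply, smul_eq_mul,
    dotProduct]
  exact sum_congr rfl fun i _ => mul_comm _ _

theorem trace_mul_comb_mul_comb (P : Matrix (Fin N) (Fin N) ℝ) (f g : Fin n → ℝ) :
    (P * (comb A f * comb A g)).trace =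
      ∑ a, ∑ b, f a * g b * (P * (A a * A b)).trace := by
  simp only [comb, Finset.sum_mul, Finset.mul_sum, trace_sum, Matrix.smul_mul, Matrix.mul_smul,
    trace_smul, smul_eq_mul]
  rw [sum_comm]
  refine sum_congr rfl fun a _ => sum_congr rfl fun b _ => by ring

/-- The second-order form of the barrier on the coordinates in `act`, plus `τ` times the identity. -/
def stepMatrix (A : Fin n → Matrix (Fin N) (Fin N) ℝ) (P : Matrix (Fin N) (Fin N) ℝ)
    (act : Finset (Fin n)) (τ : ℝ) : Matrix (Fin n) (Fin n) ℝ :=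
  of fun a b => (if a ∈ act then 1 else 0) * (if b ∈ act then 1 else 0) *
    (P * (A a * A b)).trace + if a = b then τ else 0

theorem dotProduct_stepMatrix (P : Matrix (Fin N) (Fin N) ℝ) (act : Finset (Fin n)) (τ : ℝ)
    (f : Fin n → ℝ) :
    f ⬝ᵥ stepMatrix A P act τ *ᵥ f =
      (P * (comb A (fun a => if a ∈ act then f a else 0) *
        comb A (fun a => if a ∈ act then f a else 0))).trace + τ * (f ⬝ᵥ f) := by
  rw [trace_mul_comb_mul_comb]
  simp only [dotProduct, mulVec, stepMatrix, of_apply, mul_sum, add_mul, mul_add,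
    sum_add_distrib]
  congr 1
  · refine sum_congr rfl fun a _ => sum_congr rfl fun b _ => ?_
    split_ifs <;> ring
  · refine sum_congr rfl fun a _ => ?_
    simp only [ite_mul, zero_mul, mul_ite, mul_zero, sum_ite_eq, mem_univ, if_true]
    ring

theorem dotProduct_stepMatrix_of_support (P : Matrix (Fin N) (Fin N) ℝ) {act : Finset (Fin n)}
    (τ : ℝ) {f : Fin n → ℝ} (hf : ∀ a ∉ act, f a = 0) :
    f ⬝ᵥ stepMatrix A P act τ *ᵥ f = (P * (comb A f * comb A f)).trace + τ * (f ⬝ᵥ f) := by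
  have : (fun a => if a ∈ act then f a else 0) = f := by
    funext a
    split_ifs with h
    · rfl
    · exact (hf a h).symm
  rw [dotProduct_stepMatrix, this]

theorem trace_mul_symm_sq_nonneg {P Y : Matrix (Fin N) (Fin N) ℝ} (hP : P.PosSemidef)
    (hY : Y.IsSymm) : 0 ≤ (P * (Y * Y)).trace := by
  have : (Y * Y).PosSemidef := by
    have := posSemidef_self_mul_conjTranspose Y
    simpa [hY.eq] using this
  exact trace_mul_nonneg hP this

theorem stepMatrix_posDef (hA : ∀ i, (A i).IsSymm) {P : Matrix (Fin N) (Fin N) ℝ}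
    (hP : P.PosSemidef) (act : Finset (Fin n)) {τ : ℝ} (hτ : 0 < τ) :
    (stepMatrix A P act τ).PosDef := by
  refine posDef_of_dotProduct ?_ fun f hf => ?_
  · have hPs := (isSymm_of_posSemidef hP).eq
    have h : ∀ a b, (P * (A a * A b)).trace = (P * (A b * A a)).trace := fun a b => by
      rw [← trace_transpose, transpose_mul, transpose_mul, hPs, (hA a).eq, (hA b).eq,
        Matrix.trace_mul_comm]
    ext a b
    simp only [transpose_apply, stepMatrix, of_apply, h b a, eq_comm (a := b) (b := a)]
    ring
  · rw [dotProduct_stepMatrix]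
    have h1 := trace_mul_symm_sq_nonneg hP
      (comb_isSymm hA (fun a => if a ∈ act then f a else 0))
    have h2 := mul_pos hτ (dotProduct_self_pos hf)
    linarith

/-- Once the block is known from the first index, the residue modulo q determines the second. -/
theorem card_blocks_le {q : ℕ} (hq : 0 < q) (H : Finset (Fin N)) :
    Fintype.card {c : Fin N × Fin N // c.1 ∈ H ∧ (c.1 : ℕ) / q = (c.2 : ℕ) / q} ≤
      H.card * q := by
  have := Fintype.card_le_of_injective
    (fun c : {c : Fin N × Fin N // c.1 ∈ H ∧ (c.1 : ℕ) / q = (c.2 : ℕ) / q} =>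
      ((⟨c.1.1, c.2.1⟩ : H), (⟨(c.1.2 : ℕ) % q, Nat.mod_lt _ hq⟩ : Fin q))) ?_
  · simpa using this
  · rintro ⟨⟨k, l⟩, h1, h2⟩ ⟨⟨k', l'⟩, h1', h2'⟩ h
    simp only [Prod.mk.injEq, Subtype.mk.injEq, Fin.mk.injEq] at h h2 h2'
    obtain ⟨rfl, h⟩ := h
    have : l = l' := by
      apply Fin.ext
      rw [← Nat.div_add_mod (l : ℕ) q, ← Nat.div_add_mod (l' : ℕ) q, h, ← h2, ← h2']
    simp [this]

/-- Directions f with (∑ fₐAₐ)u = 0 for every eigenvector u of R with eigenvalue above θ see only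
the factor r^(p+2) ≤ θ²r^p in the second-order form. The block structure keeps the number of linear
conditions below n/16, so more than two thirds of the active dimensions survive. -/
theorem exists_small_direction {q : ℕ} (hq : 0 < q) (hqN : q ∣ N) (hA : ∀ i, (A i).IsSymm)
    (hAb : ∀ a, ∀ i j : Fin N, (i : ℕ) / q ≠ (j : ℕ) / q → A a i j = 0)
    (hAn : ∀ a, ∀ w : Fin N → ℝ, (A a *ᵥ w) ⬝ᵥ (A a *ᵥ w) ≤ w ⬝ᵥ w)
    {M : Matrix (Fin N) (Fin N) ℝ} (hM : M.PosDef)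
    (hMb : ∀ i j : Fin N, (i : ℕ) / q ≠ (j : ℕ) / q → M i j = 0)
    {p : ℕ} {θ Φ : ℝ} (hθ : 0 < θ) (hΦ0 : 0 < Φ) (hΦ : (M⁻¹ ^ p).trace ≤ Φ)
    (hsmall : 16 * (q * Φ) ≤ n * θ ^ p) {act : Finset (Fin n)} (hact : n < 2 * act.card) :
    ∃ i ∈ act, 1 ≤ 4 * (θ ^ 2 * Φ) *
      (stepMatrix A (M⁻¹ ^ (p + 2)) act (θ ^ 2 * Φ))⁻¹ i i := by
  classical
  obtain ⟨U, m, hU, hMd, hUb⟩ := exists_conjDiag_of_div hqN (isSymm_of_posDef hM) hMb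
  have hm : ∀ i, 0 < m i := pos_of_conjDiag_posDef hU (hMd ▸ hM)
  set R := M⁻¹ with hR
  set r : Fin N → ℝ := fun i => (m i)⁻¹ with hr
  have hr0 : ∀ i, 0 < r i := fun i => inv_pos.2 (hm i)
  have hRd : R = conjDiag U r := by rw [hR, hMd, conjDiag_inv hU fun i => (hm i).ne']
  have hτ : 0 < θ ^ 2 * Φ := by positivity
  set H : Finset (Fin N) := univ.filter fun k => θ < r k with hH
  have htr : (R ^ p).trace = ∑ k, r k ^ p := by rw [hRd, conjDiag_pow hU, trace_conjDiag hU]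
  -- Markov's inequality for the eigenvalues of R^p.
  have hHc : (H.card : ℝ) * θ ^ p ≤ Φ := by
    calc (H.card : ℝ) * θ ^ p = ∑ k ∈ H, θ ^ p := by simp
      _ ≤ ∑ k ∈ H, r k ^ p := sum_le_sum fun k hk =>
          pow_le_pow_left₀ hθ.le (mem_filter.1 hk).2.le p
      _ ≤ ∑ k, r k ^ p := sum_le_sum_of_subset_of_nonneg (subset_univ _)
          fun k _ _ => (pow_pos (hr0 k) p).le
      _ ≤ Φ := htr ▸ hΦ
  have hHq : 16 * (H.card * q) ≤ n := by
    have hpos : 0 < θ ^ p := pow_pos hθ p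
    have h1 : (16 * (H.card * q) : ℝ) * θ ^ p ≤ n * θ ^ p := by
      have := mul_le_mul_of_nonneg_left hHc (by positivity : (0 : ℝ) ≤ 16 * q)
      nlinarith
    exact_mod_cast le_of_mul_le_mul_right h1 hpos
  let w : Fin N → Fin N → Fin n → ℝ := fun k l a => (A a *ᵥ U.col k) l
  -- Both the eigenvector and its images under the `A a` live in one block, so only q of the N
  -- conditions per eigenvector are nontrivial.
  have hw0 : ∀ k l : Fin N, (k : ℕ) / q ≠ (l : ℕ) / q → w k l = 0 := fun k l hkl => by
    funext a
    simp only [w, mulVec, dotProduct, Pi.zero_apply, col]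
    refine sum_eq_zero fun j _ => ?_
    by_cases h : (l : ℕ) / q = (j : ℕ) / q
    · have : U j k = 0 := hUb j k (by rw [← h]; exact hkl.symm)
      simp [transpose_apply, this]
    · rw [hAb a l j h, zero_mul]
  obtain ⟨d, f, hd, hf, hfa, hfL⟩ := exists_orthonormal_in_kernel
    (γ := {c : Fin N × Fin N // c.1 ∈ H ∧ (c.1 : ℕ) / q = (c.2 : ℕ) / q}) act
    (fun c => w c.1.1 c.1.2)
  have hcard := card_blocks_le hq H
  have hfw : ∀ j, ∀ k ∈ H, ∀ l, w k l ⬝ᵥ (f j : Fin n → ℝ) = 0 := fun j k hk l => by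
    by_cases h : (k : ℕ) / q = (l : ℕ) / q
    · exact hfL j ⟨(k, l), hk, h⟩
    · rw [hw0 k l h, zero_dotProduct]
  -- The dimension count: d ≥ |act| - |H|q, while 16|H|q ≤ n < 2|act|, hence d > 7|act|/8.
  refine exists_inv_diag_ge (d := d) (f := f)
    (stepMatrix_posDef hA (hM.inv.posSemidef.pow _) act hτ) hτ hf hfa (by omega) ?_
  have hquad : ∀ g : Fin n → ℝ, (R ^ (p + 2) * (comb A g * comb A g)).trace =
      ∑ k, r k ^ (p + 2) * ∑ l, (w k l ⬝ᵥ g) ^ 2 := fun g => by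
    rw [hRd, conjDiag_pow hU, trace_conjDiag_mul]
    refine sum_congr rfl fun k _ => ?_
    congr 1
    have hs := (comb_isSymm hA g).eq
    have : Uᵀ * (comb A g * comb A g) * U = (comb A g * U)ᵀ * (comb A g * U) := by
      rw [transpose_mul, hs]; simp only [Matrix.mul_assoc]
    rw [this, Matrix.mul_apply]
    refine sum_congr rfl fun l _ => ?_
    have e : (comb A g * U) l k = w k l ⬝ᵥ g := (comb_mulVec g (U.col k) l)
    rw [transpose_apply, e, sq]
  have hterm : ∀ j, (f j : Fin n → ℝ) ⬝ᵥ stepMatrix A (R ^ (p + 2)) act (θ ^ 2 * Φ) *ᵥ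
      (f j : Fin n → ℝ) = ∑ k, r k ^ (p + 2) * ∑ l, (w k l ⬝ᵥ (f j : Fin n → ℝ)) ^ 2 +
        θ ^ 2 * Φ := fun j => by
    have hgg : (f j : Fin n → ℝ) ⬝ᵥ (f j : Fin n → ℝ) = 1 := by
      have : ‖f j‖ ^ 2 = 1 := by rw [hf.1 j, one_pow]
      rw [EuclideanSpace.norm_sq_eq] at this
      rw [← this, dotProduct]
      exact sum_congr rfl fun a _ => by rw [Real.norm_eq_abs, sq_abs, sq]
    rw [dotProduct_stepMatrix_of_support _ _ (hfa j), hquad, hgg, mul_one]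
  rw [← hR]
  simp only [hterm, sum_add_distrib, sum_const, card_univ, Fintype.card_fin, nsmul_eq_mul,
    add_mul]
  have hmain : ∑ j, ∑ k, r k ^ (p + 2) * ∑ l, (w k l ⬝ᵥ (f j : Fin n → ℝ)) ^ 2 ≤
      act.card * (θ ^ 2 * Φ) := by
    rw [sum_comm]
    calc ∑ k, ∑ j, r k ^ (p + 2) * ∑ l, (w k l ⬝ᵥ (f j : Fin n → ℝ)) ^ 2
        ≤ ∑ k, θ ^ 2 * act.card * r k ^ p := by
          refine sum_le_sum fun k _ => ?_
          by_cases hk : k ∈ H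
          · have h0 : ∑ j, r k ^ (p + 2) * ∑ l, (w k l ⬝ᵥ (f j : Fin n → ℝ)) ^ 2 = 0 :=
              sum_eq_zero fun j _ => by simp [hfw j k hk]
            rw [h0]
            have := (pow_pos (hr0 k) p).le
            positivity
          · have hle : r k ≤ θ := by simpa [hH] using hk
            rw [← mul_sum, sum_comm]
            -- Bessel in every row l; summing over l then gives the |act| squared norms of the
            -- vectors A a u, each at most 1.
            have h1 : ∑ l, ∑ j, (w k l ⬝ᵥ (f j : Fin n → ℝ)) ^ 2 ≤ act.card := by
              calc ∑ l, ∑ j, (w k l ⬝ᵥ (f j : Fin n → ℝ)) ^ 2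
                  ≤ ∑ l, ∑ a ∈ act, w k l a ^ 2 :=
                    sum_le_sum fun l _ => sum_dotProduct_sq_le hf act hfa (w k l)
                _ = ∑ a ∈ act, (A a *ᵥ U.col k) ⬝ᵥ (A a *ᵥ U.col k) := by
                    rw [sum_comm]
                    exact sum_congr rfl fun a _ => sum_congr rfl fun l _ => sq _
                _ ≤ ∑ a ∈ act, (1 : ℝ) := sum_le_sum fun a _ => by
                    rw [← col_dotProduct_col hU k]; exact hAn a _
                _ = act.card := by simp
            have h2 : r k ^ (p + 2) ≤ θ ^ 2 * r k ^ p := by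
              rw [pow_add, mul_comm]
              exact mul_le_mul_of_nonneg_right (pow_le_pow_left₀ (hr0 k).le hle 2)
                (pow_pos (hr0 k) p).le
            calc r k ^ (p + 2) * ∑ l, ∑ j, (w k l ⬝ᵥ (f j : Fin n → ℝ)) ^ 2
                ≤ (θ ^ 2 * r k ^ p) * act.card :=
                  mul_le_mul h2 h1 (sum_nonneg fun l _ => sum_nonneg fun j _ => sq_nonneg _)
                    (by have := (pow_pos (hr0 k) p).le; positivity)
              _ = _ := by ring
      _ = θ ^ 2 * act.card * (R ^ p).trace := by rw [htr, mul_sum]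
      _ ≤ θ ^ 2 * act.card * Φ := mul_le_mul_of_nonneg_left hΦ (by positivity)
      _ = _ := by ring
  linarith

end Directions

end MatrixDiscrepancy

namespace MatrixDiscrepancy
open Matrix Finset

/-! ### Potential, energy and progress of the local search -/

section Potential

variable {n N : ℕ}

/-- The standing assumptions on the traceless matrices, the exponent `2 ^ k` and the barrier `b`. -/
structure Setup (A : Fin n → Matrix (Fin N) (Fin N) ℝ) (q k : ℕ) (b : ℝ) : Prop where
  n_pos : 0 < n
  q_pos : 0 < q
  q_dvd : q ∣ N
  symm : ∀ i, (A i).IsSymm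
  block : ∀ a, ∀ i j : Fin N, (i : ℕ) / q ≠ (j : ℕ) / q → A a i j = 0
  contract : ∀ a, ∀ w : Fin N → ℝ, (A a *ᵥ w) ⬝ᵥ (A a *ᵥ w) ≤ w ⬝ᵥ w
  traceless : ∀ a, (A a).trace = 0
  b_pos : 0 < b
  b_sq : b ^ 2 = 576 * (n * 2 ^ k)
  exponent_le : 2 ^ k ≤ n
  exponent_ge : (16 * (q * N + n) : ℝ) ≤ 2 ^ (2 ^ k) * n

/-- The distance of the current signed sum to the barrier. -/
def slack (A : Fin n → Matrix (Fin N) (Fin N) ℝ) (b : ℝ) (x₀ x : Fin n → ℝ) :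
    Matrix (Fin N) (Fin N) ℝ :=
  b • 1 - comb A (x - x₀)

/-- The barrier potential. -/
noncomputable def potential (A : Fin n → Matrix (Fin N) (Fin N) ℝ) (q k : ℕ) (b : ℝ)
    (x₀ x : Fin n → ℝ) : ℝ :=
  ((slack A b x₀ x)⁻¹ ^ 2 ^ k).trace + n / q * (b⁻¹) ^ 2 ^ k

/-- The coordinates that are not yet `±1`. -/
noncomputable def active (x : Fin n → ℝ) : Finset (Fin n) :=
  univ.filter fun i => -1 < x i ∧ x i < 1

/-- The quantity that the local search increases. -/
noncomputable def energy (A : Fin n → Matrix (Fin N) (Fin N) ℝ) (q k : ℕ) (b : ℝ)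
    (x₀ x : Fin n → ℝ) : ℝ :=
  2 ^ k / n * (x ⬝ᵥ x) - Real.log (potential A q k b x₀ x)

/-- The invariant of the local search. -/
structure Invariant (A : Fin n → Matrix (Fin N) (Fin N) ℝ) (q k : ℕ) (b : ℝ)
    (x₀ x : Fin n → ℝ) : Prop where
  mem : ∀ i, -1 ≤ x i ∧ x i ≤ 1
  posDef : (slack A b x₀ x).PosDef
  energy_le : energy A q k b x₀ x₀ ≤ energy A q k b x₀ x

/-- The progress measure of the local search. -/
noncomputable def progress (A : Fin n → Matrix (Fin N) (Fin N) ℝ) (q k : ℕ) (b : ℝ)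
    (x₀ x : Fin n → ℝ) : ℝ :=
  32 * n / (2 ^ k / n) * (energy A q k b x₀ x - energy A q k b x₀ x₀) +
    (n - (active x).card)

variable {A : Fin n → Matrix (Fin N) (Fin N) ℝ} {q k : ℕ} {b : ℝ} {x₀ x : Fin n → ℝ}

theorem dotProduct_self_le {x : Fin n → ℝ} (hx : ∀ i, -1 ≤ x i ∧ x i ≤ 1) : x ⬝ᵥ x ≤ n := by
  have : x ⬝ᵥ x ≤ ∑ _i : Fin n, (1 : ℝ) := sum_le_sum fun i _ => by
    nlinarith [hx i]
  simpa using this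

theorem comb_add (f g : Fin n → ℝ) : comb A (f + g) = comb A f + comb A g := by
  simp [comb, add_smul, sum_add_distrib]

theorem comb_smul (s : ℝ) (f : Fin n → ℝ) : comb A (s • f) = s • comb A f := by
  simp [comb, Finset.smul_sum, smul_smul]

theorem comb_zero : comb A (0 : Fin n → ℝ) = 0 := by simp [comb]

theorem slack_add (z : Fin n → ℝ) : slack A b x₀ (x + z) = slack A b x₀ x - comb A z := by
  rw [slack, slack, add_sub_right_comm, comb_add, sub_sub]

/-- Cauchy–Schwarz over a in each row. -/
theorem comb_contract (hA : ∀ a, ∀ w : Fin N → ℝ, (A a *ᵥ w) ⬝ᵥ (A a *ᵥ w) ≤ w ⬝ᵥ w)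
    (z : Fin n → ℝ) (w : Fin N → ℝ) :
    (comb A z *ᵥ w) ⬝ᵥ (comb A z *ᵥ w) ≤ (n * (z ⬝ᵥ z)) * (w ⬝ᵥ w) := by
  calc (comb A z *ᵥ w) ⬝ᵥ (comb A z *ᵥ w) = ∑ l, ((comb A z *ᵥ w) l) ^ 2 :=
        sum_congr rfl fun l _ => (sq _).symm
    _ ≤ ∑ l, (∑ a, (A a *ᵥ w) l ^ 2) * (z ⬝ᵥ z) := sum_le_sum fun l _ => by
        rw [comb_mulVec, dotProduct]
        have := sum_mul_sq_le_sq_mul_sq univ (fun a => (A a *ᵥ w) l) z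
        simpa [dotProduct, sq] using this
    _ = (∑ a, (A a *ᵥ w) ⬝ᵥ (A a *ᵥ w)) * (z ⬝ᵥ z) := by
        rw [← sum_mul, sum_comm]
        congr 1
        exact sum_congr rfl fun a _ => sum_congr rfl fun l _ => sq _
    _ ≤ (∑ _a : Fin n, w ⬝ᵥ w) * (z ⬝ᵥ z) :=
        mul_le_mul_of_nonneg_right (sum_le_sum fun a _ => hA a w) (dotProduct_self_nonneg z)
    _ = _ := by simp; ring

variable (h : Setup A q k b)
include h

theorem slack_block (x : Fin n → ℝ) (i j : Fin N) (hij : (i : ℕ) / q ≠ (j : ℕ) / q) :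
    slack A b x₀ x i j = 0 := by
  have hne : i ≠ j := fun e => hij (by rw [e])
  simp [slack, comb, Matrix.sum_apply, Matrix.one_apply_ne hne, h.block _ i j hij]

theorem slack_trace (x : Fin n → ℝ) : (slack A b x₀ x).trace = Fintype.card (Fin N) * b := by
  simp [slack, comb, trace_sum, h.traceless, mul_comm]

/-- The offset n/q · b^(-p) ensures strict positivity even for N = 0, where the trace vanishes; the
logarithm in the energy needs it. -/
theorem potential_pos (hx : (slack A b x₀ x).PosDef) : 0 < potential A q k b x₀ x := by
  have h1 := (hx.inv.posSemidef.pow (2 ^ k)).trace_nonneg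
  have h2 : (0 : ℝ) < n := by exact_mod_cast h.n_pos
  have h3 : (0 : ℝ) < q := by exact_mod_cast h.q_pos
  have h4 := h.b_pos
  have : 0 < n / q * (b⁻¹) ^ 2 ^ k := by positivity
  unfold potential
  linarith

theorem potential_self : potential A q k b x₀ x₀ = (N + n / q) * (b⁻¹) ^ 2 ^ k := by
  have h0 : slack A b x₀ x₀ = b • 1 := by simp [slack, comb_zero]
  have hb := h.b_pos.ne'
  have h1 : (b • (1 : Matrix (Fin N) (Fin N) ℝ))⁻¹ = b⁻¹ • 1 := by
    apply inv_eq_right_inv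
    simp [smul_smul, hb]
  rw [potential, h0, h1, smul_pow, one_pow, trace_smul, trace_one, Fintype.card_fin, smul_eq_mul]
  ring

/-- Tracelessness keeps the mean eigenvalue of the slack at b, so Jensen applies. This caps the
energy and hence the number of steps. -/
theorem potential_self_le (hx : (slack A b x₀ x).PosDef) :
    potential A q k b x₀ x₀ ≤ potential A q k b x₀ x := by
  have := card_mul_inv_pow_le_trace_inv_pow hx h.b_pos (slack_trace h x) (2 ^ k)
  rw [Fintype.card_fin] at this
  rw [potential_self h, potential]
  linarith

theorem slack_self_posDef : (slack A b x₀ x₀).PosDef := by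
  have h0 : slack A b x₀ x₀ = b • 1 := by simp [slack, comb_zero]
  rw [h0]
  exact PosDef.one.smul h.b_pos

theorem Invariant.self (hx₀ : ∀ i, -1 ≤ x₀ i ∧ x₀ i ≤ 1) : Invariant A q k b x₀ x₀ :=
  ⟨hx₀, slack_self_posDef h, le_rfl⟩

theorem rate_pos : (0 : ℝ) < 2 ^ k / n := by
  have h2 : (0 : ℝ) < n := by exact_mod_cast h.n_pos
  positivity

theorem progress_self_nonneg : 0 ≤ progress A q k b x₀ x₀ := by
  have : ((active x₀).card : ℝ) ≤ n := by
    have := card_le_univ (active x₀)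
    rw [Fintype.card_fin] at this
    exact_mod_cast this
  rw [progress, sub_self, mul_zero, zero_add]
  linarith

/-- The potential has not fallen below its start, so the energy gain is at most p/n · |x|² ≤ p,
which is 32n² in units of p/(32n²). Frozen coordinates contribute at most n. -/
theorem progress_le (hx : Invariant A q k b x₀ x) : progress A q k b x₀ x ≤ 32 * n ^ 2 + n := by
  have hn : (0 : ℝ) < n := by exact_mod_cast h.n_pos
  have h1 := rate_pos h
  have h2 : Real.log (potential A q k b x₀ x₀) ≤ Real.log (potential A q k b x₀ x) :=
    Real.log_le_log (potential_pos h (slack_self_posDef h)) (potential_self_le h hx.posDef)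
  have h3 : energy A q k b x₀ x - energy A q k b x₀ x₀ ≤ 2 ^ k / n * n := by
    have h4 := mul_le_mul_of_nonneg_left (dotProduct_self_le hx.mem) h1.le
    have h5 := mul_nonneg h1.le (dotProduct_self_nonneg x₀)
    unfold energy
    linarith
  have h6 : 32 * n / (2 ^ k / n) * (energy A q k b x₀ x - energy A q k b x₀ x₀) ≤
      32 * n / (2 ^ k / n) * (2 ^ k / n * n) :=
    mul_le_mul_of_nonneg_left h3 (by positivity)
  have h7 : 32 * (n : ℝ) / (2 ^ k / n) * (2 ^ k / n * n) = 32 * n ^ 2 := by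
    field_simp
  have h8 : (0 : ℝ) ≤ (active x).card := Nat.cast_nonneg _
  unfold progress
  linarith

/-- The invariant bounds the growth of the potential by e^p ≤ 3^p, and the choice of the exponent
gives 16(qN + n) ≤ 2^p n. The constant 6 is 2 · 3. -/
theorem small_potential (hx : Invariant A q k b x₀ x) :
    16 * (q * potential A q k b x₀ x) ≤ n * (6 / b) ^ 2 ^ k := by
  have hn : (0 : ℝ) < n := by exact_mod_cast h.n_pos
  have hq : (0 : ℝ) < q := by exact_mod_cast h.q_pos
  have hb := h.b_pos
  have h1 := rate_pos h
  have hp := potential_pos h hx.posDef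
  have hp0 := potential_pos h (slack_self_posDef h (x₀ := x₀))
  have h2 : Real.log (potential A q k b x₀ x) ≤ Real.log (potential A q k b x₀ x₀) + 2 ^ k := by
    have h3 := hx.energy_le
    have h4 := mul_le_mul_of_nonneg_left (dotProduct_self_le hx.mem) h1.le
    have h5 := mul_nonneg h1.le (dotProduct_self_nonneg x₀)
    have h6 : (2 : ℝ) ^ k / n * n = 2 ^ k := by field_simp
    unfold energy at h3
    linarith
  have h3 : potential A q k b x₀ x ≤ potential A q k b x₀ x₀ * 3 ^ 2 ^ k := by
    have h4 : potential A q k b x₀ x ≤ potential A q k b x₀ x₀ * Real.exp (2 ^ k) := by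
      rw [← Real.log_le_log_iff hp (by positivity), Real.log_mul hp0.ne' (Real.exp_pos _).ne',
        Real.log_exp]
      exact h2
    have h5 : Real.exp (2 ^ k) ≤ 3 ^ 2 ^ k := by
      have e : ((2 : ℝ) ^ k) = ((2 ^ k : ℕ) : ℝ) * 1 := by simp
      rw [e, Real.exp_nat_mul]
      exact pow_le_pow_left₀ (Real.exp_pos _).le Real.exp_one_lt_three.le _
    exact h4.trans (mul_le_mul_of_nonneg_left h5 hp0.le)
  rw [potential_self h] at h3
  have h4 := h.exponent_ge
  have e1 : (n : ℝ) * (6 / b) ^ 2 ^ k = (2 ^ 2 ^ k * n) * ((b⁻¹) ^ 2 ^ k * 3 ^ 2 ^ k) := by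
    rw [show (6 : ℝ) / b = 2 * (b⁻¹ * 3) by ring, mul_pow, mul_pow]; ring
  rw [e1]
  calc 16 * (q * potential A q k b x₀ x)
      ≤ 16 * (q * ((N + n / q) * (b⁻¹) ^ 2 ^ k * 3 ^ 2 ^ k)) := by gcongr
    _ = (16 * (q * N + n)) * ((b⁻¹) ^ 2 ^ k * 3 ^ 2 ^ k) := by field_simp
    _ ≤ _ := mul_le_mul_of_nonneg_right h4 (by positivity)

/-- A displacement with small second-order term and nonpositive first-order term increases the
energy. -/
theorem energy_step (hx : Invariant A q k b x₀ x)
    {z : Fin n → ℝ} (hz : z ⬝ᵥ z ≤ 1 / n)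
    (hQ : ((slack A b x₀ x)⁻¹ ^ (2 ^ k + 2) * (comb A z * comb A z)).trace ≤
      3 * ((6 / b) ^ 2 * potential A q k b x₀ x) * (z ⬝ᵥ z))
    (hlin : ((slack A b x₀ x)⁻¹ ^ (2 ^ k + 1) * comb A z).trace ≤
      2 / n * potential A q k b x₀ x * (x ⬝ᵥ z)) :
    (slack A b x₀ (x + z)).PosDef ∧
      energy A q k b x₀ x + 2 ^ k / n * (z ⬝ᵥ z) / 2 ≤ energy A q k b x₀ (x + z) := by
  have hn : (0 : ℝ) < n := by exact_mod_cast h.n_pos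
  have hq : (1 : ℝ) ≤ q := by exact_mod_cast h.q_pos
  have hb := h.b_pos
  have hpn : ((2 : ℝ) ^ k) ≤ n := by exact_mod_cast h.exponent_le
  have hrate := rate_pos h
  set Φ := potential A q k b x₀ x with hΦdef
  have hΦ : 0 < Φ := potential_pos h hx.posDef
  have hsm := small_potential h hx
  rw [← hΦdef] at hsm
  set M := slack A b x₀ x with hM
  set Y := comb A z with hY
  have hYs : Y.IsSymm := comb_isSymm h.symm z
  have hzz := dotProduct_self_nonneg z
  set θ := 6 / b with hθ
  have hθ0 : 0 < θ := by positivity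
  -- The reason for b² = 576np: 36/576 = 1/16.
  have hθ2 : θ ^ 2 = 1 / (16 * (n * 2 ^ k)) := by
    rw [hθ, div_pow, h.b_sq]; field_simp; norm_num
  have hΦθ : (θ ^ 2 ^ k)⁻¹ * Φ ≤ n / 16 := by
    rw [inv_mul_le_iff₀ (by positivity)]
    have : Φ ≤ q * Φ := le_mul_of_one_le_left hΦ.le hq
    linarith
  -- Eigenvalues of R up to θ contribute θ²n|z|², the larger ones 3θ²(n/16)|z|²; multiplied by p²
  -- the sum is at most 19/256 < 1/4, because n|z|² ≤ 1 and p ≤ n.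
  have hstep := barrier_step hx.posDef hYs k fun w => by
    have h1 := norm_mul_mulVec_le hx.posDef.inv.posSemidef hYs hθ0 (2 ^ k)
      (comb_contract h.contract z) w
    have hc : ((2 : ℝ) ^ k) ^ 2 * (θ ^ 2 * (n * (z ⬝ᵥ z)) + (θ ^ 2 ^ k)⁻¹ *
        (M⁻¹ ^ (2 ^ k + 2) * (Y * Y)).trace) ≤ 1 / 4 := by
      have h2 : (θ ^ 2 ^ k)⁻¹ * (M⁻¹ ^ (2 ^ k + 2) * (Y * Y)).trace ≤
          3 * θ ^ 2 * (n / 16) * (z ⬝ᵥ z) := by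
        calc _ ≤ (θ ^ 2 ^ k)⁻¹ * (3 * (θ ^ 2 * Φ) * (z ⬝ᵥ z)) :=
              mul_le_mul_of_nonneg_left hQ (by positivity)
          _ = 3 * θ ^ 2 * ((θ ^ 2 ^ k)⁻¹ * Φ) * (z ⬝ᵥ z) := by ring
          _ ≤ _ := by gcongr
      have h3 : (n : ℝ) * (z ⬝ᵥ z) ≤ 1 := by
        have := mul_le_mul_of_nonneg_left hz hn.le
        rwa [mul_one_div_cancel hn.ne'] at this
      calc _ ≤ ((2 : ℝ) ^ k) ^ 2 * (θ ^ 2 * (n * (z ⬝ᵥ z)) +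
            3 * θ ^ 2 * (n / 16) * (z ⬝ᵥ z)) := by gcongr
        _ = (2 : ℝ) ^ k / n * ((19 / 256) * (n * (z ⬝ᵥ z))) := by
            rw [hθ2]; field_simp; ring
        _ ≤ 1 * ((19 / 256) * 1) := by
            gcongr
            exact (div_le_one hn).2 hpn
        _ ≤ 1 / 4 := by norm_num
    calc _ ≤ ((2 : ℝ) ^ k) ^ 2 * ((θ ^ 2 * (n * (z ⬝ᵥ z)) + (θ ^ 2 ^ k)⁻¹ *
          (M⁻¹ ^ (2 ^ k + 2) * (Y * Y)).trace) * (w ⬝ᵥ w)) := by gcongr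
      _ ≤ _ := by
          rw [← mul_assoc]
          exact mul_le_mul_of_nonneg_right hc (dotProduct_self_nonneg w)
  obtain ⟨hpd, hle⟩ := hstep
  rw [← hM, ← slack_add] at hpd
  refine ⟨hpd, ?_⟩
  have hΦ' : 0 < potential A q k b x₀ (x + z) := potential_pos h hpd
  set κ := (2 : ℝ) ^ k / n with hκ
  -- The term 2κ(x·z) equals the linear part of the change of κ|x|² and cancels in the energy. The
  -- second-order loss 2p² · 3θ² = (6/16)κ is below κ/2, so half of κ|z|² remains as gain.
  have hbound : potential A q k b x₀ (x + z) ≤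
      Φ * Real.exp (2 * κ * (x ⬝ᵥ z) + κ / 2 * (z ⬝ᵥ z)) := by
    have h1 : potential A q k b x₀ (x + z) ≤ Φ + 2 ^ k * (M⁻¹ ^ (2 ^ k + 1) * Y).trace +
        2 * ((2 : ℝ) ^ k) ^ 2 * (M⁻¹ ^ (2 ^ k + 2) * (Y * Y)).trace := by
      rw [hΦdef, potential, potential, slack_add, ← hM]
      linarith
    have h2 : (2 : ℝ) ^ k * (M⁻¹ ^ (2 ^ k + 1) * Y).trace ≤ Φ * (2 * κ * (x ⬝ᵥ z)) := by
      calc _ ≤ (2 : ℝ) ^ k * (2 / n * Φ * (x ⬝ᵥ z)) :=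
            mul_le_mul_of_nonneg_left hlin (by positivity)
        _ = _ := by rw [hκ]; ring
    have h3 : 2 * ((2 : ℝ) ^ k) ^ 2 * (M⁻¹ ^ (2 ^ k + 2) * (Y * Y)).trace ≤
        Φ * (κ / 2 * (z ⬝ᵥ z)) := by
      calc _ ≤ 2 * ((2 : ℝ) ^ k) ^ 2 * (3 * (θ ^ 2 * Φ) * (z ⬝ᵥ z)) :=
            mul_le_mul_of_nonneg_left hQ (by positivity)
        _ = Φ * (κ * (6 / 16) * (z ⬝ᵥ z)) := by rw [hθ2, hκ]; field_simp; ring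
        _ ≤ _ := by
            refine mul_le_mul_of_nonneg_left (mul_le_mul_of_nonneg_right ?_ hzz) hΦ.le
            linarith
    calc _ ≤ Φ * (2 * κ * (x ⬝ᵥ z) + κ / 2 * (z ⬝ᵥ z) + 1) := by linarith
      _ ≤ _ := mul_le_mul_of_nonneg_left (Real.add_one_le_exp _) hΦ.le
  have hlog : Real.log (potential A q k b x₀ (x + z)) ≤
      Real.log Φ + (2 * κ * (x ⬝ᵥ z) + κ / 2 * (z ⬝ᵥ z)) := by
    have := Real.log_le_log hΦ' hbound
    rwa [Real.log_mul hΦ.ne' (Real.exp_pos _).ne', Real.log_exp] at this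
  have hxx : (x + z) ⬝ᵥ (x + z) = x ⬝ᵥ x + 2 * (x ⬝ᵥ z) + z ⬝ᵥ z := by
    rw [add_dotProduct, dotProduct_add, dotProduct_add, dotProduct_comm z x]; ring
  rw [energy, energy, ← hκ, hxx, ← hΦdef]
  linarith

/-- The column y of G⁻¹ solves Gy = eᵢ, so the form G takes the value yᵢ at y. Together with yᵢ ≥
1/(4τ) this bounds the second-order term by 3τ|y|² and puts τ|y| between 1/4 and 1. The displacement
±τy/√n is therefore neither too long for the expansion nor too short for progress. -/
theorem progress_step (hx : Invariant A q k b x₀ x)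
    {i : Fin n} (hi : i ∈ active x) {τ : ℝ} (hτ : τ = (6 / b) ^ 2 * potential A q k b x₀ x)
    {S : Matrix (Fin n) (Fin n) ℝ}
    (hS : S = (stepMatrix A ((slack A b x₀ x)⁻¹ ^ (2 ^ k + 2)) (active x) τ)⁻¹)
    (hSi : 1 ≤ 4 * τ * S i i) {z : Fin n → ℝ} {δ : ℝ} (hδ : δ ^ 2 = 1 / n)
    (hz : z = fun a => δ * τ * S a i)
    (hlin : ((slack A b x₀ x)⁻¹ ^ (2 ^ k + 1) * comb A z).trace ≤
      2 / n * potential A q k b x₀ x * (x ⬝ᵥ z))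
    {s : ℝ} (hs0 : 0 ≤ s) (hs1 : s ≤ 1) (hmem : ∀ a, -1 ≤ x a + s * z a ∧ x a + s * z a ≤ 1)
    (hfrozen : s = 1 ∨ ∃ a, z a ≠ 0 ∧ (x a + s * z a = 1 ∨ x a + s * z a = -1)) :
    Invariant A q k b x₀ (x + s • z) ∧
      progress A q k b x₀ x + 1 ≤ progress A q k b x₀ (x + s • z) := by
  have hn : (0 : ℝ) < n := by exact_mod_cast h.n_pos
  have hb := h.b_pos
  have hΦ : 0 < potential A q k b x₀ x := potential_pos h hx.posDef
  have hτ0 : 0 < τ := by rw [hτ]; positivity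
  set P := (slack A b x₀ x)⁻¹ ^ (2 ^ k + 2) with hP
  have hPp : P.PosSemidef := hx.posDef.inv.posSemidef.pow _
  set G := stepMatrix A P (active x) τ with hG
  have hGp : G.PosDef := stepMatrix_posDef h.symm hPp _ hτ0
  have hGS : G * S = 1 := by
    rw [hS]; exact mul_nonsing_inv _ ((isUnit_iff_isUnit_det _).1 hGp.isUnit)
  set y : Fin n → ℝ := fun a => S a i with hy
  have hGy : G *ᵥ y = Pi.single i 1 := by
    have : y = S.col i := rfl
    rw [this, ← mulVec_single_one, mulVec_mulVec, hGS, one_mulVec]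
  -- Outside the active set the equation Gy = eᵢ reads τ y a = 0, so frozen coordinates never move.
  have hysupp : ∀ a ∉ active x, y a = 0 := fun a ha => by
    have h1 := congrFun hGy a
    have hai : a ≠ i := fun e => ha (e ▸ hi)
    rw [Pi.single_eq_of_ne hai] at h1
    simp only [hG, mulVec, dotProduct, stepMatrix, of_apply, ha, if_false, zero_mul, zero_add,
      ite_mul, sum_ite_eq, mem_univ, if_true] at h1
    exact (mul_eq_zero.1 h1).resolve_left hτ0.ne'
  have hquad : (P * (comb A y * comb A y)).trace + τ * (y ⬝ᵥ y) = y i := by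
    rw [← dotProduct_stepMatrix_of_support P τ hysupp, ← hG, hGy, dotProduct_single_one]
  have hyi : 1 ≤ 4 * τ * y i := hSi
  have hQ0 := trace_mul_symm_sq_nonneg hPp (comb_isSymm h.symm y)
  have hyy : y i ^ 2 ≤ y ⬝ᵥ y := by
    rw [sq]
    exact single_le_sum (f := fun a => y a * y a) (fun a _ => mul_self_nonneg _) (mem_univ i)
  have hyi0 : 0 < y i := by
    by_contra hcon
    push Not at hcon
    nlinarith
  -- From 1 ≤ 4τyᵢ follows yᵢ ≤ 4τyᵢ² ≤ 4τ|y|², and one τ|y|² of the value yᵢ belongs to the ridge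
  -- term.
  have hQy : (P * (comb A y * comb A y)).trace ≤ 3 * τ * (y ⬝ᵥ y) := by
    have : y i ≤ 4 * τ * (y ⬝ᵥ y) := by
      calc y i ≤ 4 * τ * y i * y i := le_mul_of_one_le_left hyi0.le hyi
        _ = 4 * τ * y i ^ 2 := by ring
        _ ≤ _ := mul_le_mul_of_nonneg_left hyy (by positivity)
    linarith
  have hyup : τ ^ 2 * (y ⬝ᵥ y) ≤ 1 := by
    have h1 : τ * (y ⬝ᵥ y) ≤ y i := by linarith
    have h2 : τ * y i ≤ 1 := by
      have h3 : τ * (y i * y i) ≤ y i :=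
        (mul_le_mul_of_nonneg_left (by rwa [← sq]) hτ0.le).trans h1
      by_contra hcon
      push Not at hcon
      nlinarith
    nlinarith
  have hylow : 1 / 16 ≤ τ ^ 2 * (y ⬝ᵥ y) := by
    have h1 : 1 / 16 ≤ τ ^ 2 * y i ^ 2 := by nlinarith
    have h2 := mul_le_mul_of_nonneg_left hyy (sq_nonneg τ)
    linarith
  have hzy : z = (δ * τ) • y := by rw [hz]; rfl
  have hzz : z ⬝ᵥ z = 1 / n * (τ ^ 2 * (y ⬝ᵥ y)) := by
    rw [hzy, dotProduct_smul, smul_dotProduct, ← hδ, smul_eq_mul, smul_eq_mul]; ring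
  have hssz : (s • z) ⬝ᵥ (s • z) = s ^ 2 * (z ⬝ᵥ z) := by
    rw [dotProduct_smul, smul_dotProduct, smul_eq_mul, smul_eq_mul]; ring
  have hs2 : s ^ 2 ≤ 1 := pow_le_one₀ hs0 hs1
  have hstep := energy_step h hx (z := s • z) (by
      rw [hssz, hzz]
      have : s ^ 2 * (1 / n * (τ ^ 2 * (y ⬝ᵥ y))) ≤ 1 * (1 / n * 1) := by
        have hyn := dotProduct_self_nonneg y
        gcongr
      linarith)
    (by
      rw [← hP, hssz, hzz, hzy, smul_smul, comb_smul, Matrix.smul_mul, Matrix.mul_smul,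
        Matrix.mul_smul, Matrix.mul_smul, trace_smul, trace_smul, smul_eq_mul, smul_eq_mul, ← hτ,
        ← hδ]
      have := mul_le_mul_of_nonneg_left hQy (sq_nonneg (s * (δ * τ)))
      nlinarith)
    (by
      rw [comb_smul, Matrix.mul_smul, trace_smul, dotProduct_smul, smul_eq_mul, smul_eq_mul]
      have := mul_le_mul_of_nonneg_left hlin hs0
      linarith)
  obtain ⟨hpd, hen⟩ := hstep
  have hrate := rate_pos h
  have hszn := dotProduct_self_nonneg (s • z)
  have hen' : energy A q k b x₀ x ≤ energy A q k b x₀ (x + s • z) := by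
    have := mul_nonneg hrate.le hszn
    linarith
  refine ⟨⟨fun a => by simpa using hmem a, hpd, hx.energy_le.trans hen'⟩, ?_⟩
  have hsub : active (x + s • z) ⊆ active x := fun a ha => by
    by_contra hcon
    have : (x + s • z) a = x a := by simp [hzy, hysupp a hcon]
    simp only [active, mem_filter, mem_univ, true_and, this] at ha hcon
    exact hcon ha
  have hcoef : 0 ≤ 32 * n / ((2 : ℝ) ^ k / n) := by positivity
  have hcard : ((active (x + s • z)).card : ℝ) ≤ (active x).card := by
    exact_mod_cast card_le_card hsub
  rcases hfrozen with hs | ⟨a, hza, hfr⟩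
  -- A full step gains at least (p/n)(1/(16n))/2 = p/(32n²) of energy, which is one unit of
  -- progress. The other case freezes a coordinate.
  · have h1 : 1 / n * (1 / 16) ≤ (s • z) ⬝ᵥ (s • z) := by
      rw [hssz, hs, one_pow, one_mul, hzz]
      gcongr
    have h2 : 32 * n / ((2 : ℝ) ^ k / n) * ((2 : ℝ) ^ k / n * (1 / n * (1 / 16)) / 2) = 1 := by
      field_simp; norm_num
    have h3 : 1 ≤ 32 * n / ((2 : ℝ) ^ k / n) *
        (energy A q k b x₀ (x + s • z) - energy A q k b x₀ x) := by
      rw [← h2]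
      refine mul_le_mul_of_nonneg_left ?_ hcoef
      have := mul_le_mul_of_nonneg_left h1 hrate.le
      linarith
    unfold progress
    linarith
  · have ha : a ∈ active x := by
      by_contra hcon
      exact hza (by simp [hzy, hysupp a hcon])
    have hlt : ((active (x + s • z)).card : ℝ) + 1 ≤ (active x).card := by
      have : (active (x + s • z)).card < (active x).card := by
        refine card_lt_card ⟨hsub, fun hcon => ?_⟩
        have h1 := hcon ha
        simp only [active, mem_filter, mem_univ, true_and, Pi.add_apply, Pi.smul_apply,
          smul_eq_mul] at h1
        rcases hfr with h2 | h2 <;> rw [h2] at h1 <;> linarith [h1.1, h1.2]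
      exact_mod_cast this
    have h3 := mul_le_mul_of_nonneg_left (sub_nonneg.2 hen') hcoef
    unfold progress
    linarith

end Potential

end MatrixDiscrepancy

/-! ### A small array language and its compiler to the real RAM -/

namespace ArrayLang
open RealRAM Finset

/-- Expressions over index registers and arrays; `sum k N e` is the sum of `e` over the values
`0, …, N - 1` of the index register `k`, `cond` compares its first two arguments, and `shift r a b e` is
`e` with the index register `r` set to `a - b`. -/
inductive Expr where
  | ofIdx (r : ℕ)
  | const (c : ℕ)
  | read (a i j k : ℕ)
  | add (e f : Expr)
  | sub (e f : Expr)
  | mul (e f : Expr)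
  | div (e f : Expr)
  | sqrt (e : Expr)
  | cond (e f g h : Expr)
  | sum (k N : ℕ) (e : Expr)
  | shift (r a b : ℕ) (e : Expr)

namespace Expr

open Classical in
/-- The value of an expression. -/
noncomputable def eval : Expr → (ℕ → ℕ) → (ℕ → ℕ → ℕ → ℕ → ℝ) → ℝ
  | ofIdx r, σ, _ => σ r
  | const c, _, _ => c
  | read a i j k, σ, α => α a (σ i) (σ j) (σ k)
  | add e f, σ, α => e.eval σ α + f.eval σ α
  | sub e f, σ, α => e.eval σ α - f.eval σ α
  | mul e f, σ, α => e.eval σ α * f.eval σ α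
  | div e f, σ, α => e.eval σ α / f.eval σ α
  | sqrt e, σ, α => Real.sqrt (e.eval σ α)
  | cond e f g h, σ, α => if e.eval σ α < f.eval σ α then g.eval σ α else h.eval σ α
  | sum k N e, σ, α => ∑ v ∈ range (σ N), e.eval (Function.update σ k v) α
  | shift r a b e, σ, α => e.eval (Function.update σ r (σ a - σ b)) α

/-- The program that computes the expression into the real register `d`, using the real registers
from `d` on. The index register `3` holds `1`. -/
def compile : Expr → ℕ → Prog
  | ofIdx r, d => .instr (.ofIdx d r)
  | const c, d => .seq (.instr (.idxConst 3 c))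
      (.seq (.instr (.ofIdx d 3)) (.instr (.idxConst 3 1)))
  | read a i j k, d => .instr (.load d a i j k)
  | add e f, d => .seq (e.compile d) (.seq (f.compile (d + 1)) (.instr (.add d d (d + 1))))
  | sub e f, d => .seq (e.compile d) (.seq (f.compile (d + 1)) (.instr (.sub d d (d + 1))))
  | mul e f, d => .seq (e.compile d) (.seq (f.compile (d + 1)) (.instr (.mul d d (d + 1))))
  | div e f, d => .seq (e.compile d) (.seq (f.compile (d + 1)) (.instr (.div d d (d + 1))))
  | sqrt e, d => .seq (e.compile d) (.instr (.sqrt d d))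
  | cond e f g h, d => .seq (e.compile d) (.seq (f.compile (d + 1))
      (.ite (.regLt d (d + 1)) (g.compile d) (h.compile d)))
  | sum k N e, d => .seq (.instr (.sub d d d)) (.seq
      (.while (.idxLt k N) (.seq (e.compile (d + 1))
        (.seq (.instr (.add d d (d + 1))) (.instr (.idxAdd k k 3)))))
      (.instr (.idxConst k 0)))
  | shift r a b e, d => .seq (.instr (.idxSub r a b))
      (.seq (e.compile d) (.instr (.idxConst r 0)))

/-- A bound for the running time, given bounds for the index registers. -/
def cost : Expr → (ℕ → ℕ) → ℕ
  | ofIdx _, _ => 1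
  | const _, _ => 3
  | read _ _ _ _, _ => 1
  | add e f, B => e.cost B + f.cost B + 1
  | sub e f, B => e.cost B + f.cost B + 1
  | mul e f, B => e.cost B + f.cost B + 1
  | div e f, B => e.cost B + f.cost B + 1
  | sqrt e, B => e.cost B + 1
  | cond e f g h, B => e.cost B + f.cost B + g.cost B + h.cost B + 1
  | sum k N e, B => B N * (e.cost (Function.update B k (B N)) + 3) + 3
  | shift r a _ e, B => e.cost (Function.update B r (B a)) + 2

/-- Bound index registers are not among the registers `L` in use. -/
def wf : Expr → List ℕ → Bool
  | ofIdx _, _ => true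
  | const _, _ => true
  | read _ _ _ _, _ => true
  | add e f, L => e.wf L && f.wf L
  | sub e f, L => e.wf L && f.wf L
  | mul e f, L => e.wf L && f.wf L
  | div e f, L => e.wf L && f.wf L
  | sqrt e, L => e.wf L
  | cond e f g h, L => e.wf L && f.wf L && g.wf L && h.wf L
  | sum k N e, L => !L.contains k && !(N == k) && e.wf (k :: L)
  | shift r _ _ e, L => !L.contains r && e.wf (r :: L)

/-- The expression does not read the array `a`. -/
def avoids (a : ℕ) : Expr → Bool
  | ofIdx _ => true
  | const _ => true
  | read a' _ _ _ => !(a' == a)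
  | add e f => e.avoids a && f.avoids a
  | sub e f => e.avoids a && f.avoids a
  | mul e f => e.avoids a && f.avoids a
  | div e f => e.avoids a && f.avoids a
  | sqrt e => e.avoids a
  | cond e f g h => e.avoids a && f.avoids a && g.avoids a && h.avoids a
  | sum _ _ e => e.avoids a
  | shift _ _ _ e => e.avoids a

theorem eval_congr {a : ℕ} {e : Expr} (he : e.avoids a = true) (σ : ℕ → ℕ)
    {α β : ℕ → ℕ → ℕ → ℕ → ℝ} (h : ∀ a', a' ≠ a → α a' = β a') : e.eval σ α = e.eval σ β := by
  induction e generalizing σ with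
  | ofIdx r => rfl
  | const c => rfl
  | read a' i j k =>
    have : a' ≠ a := by simpa [avoids] using he
    simp only [eval, h a' this]
  | sqrt e ih => simp only [eval, ih he]
  | add e f ih1 ih2 | sub e f ih1 ih2 | mul e f ih1 ih2 | div e f ih1 ih2 =>
    simp only [avoids, Bool.and_eq_true] at he
    simp only [eval, ih1 he.1, ih2 he.2]
  | cond e f g h ih1 ih2 ih3 ih4 =>
    simp only [avoids, Bool.and_eq_true] at he
    simp only [eval, ih1 he.1.1.1, ih2 he.1.1.2, ih3 he.1.2, ih4 he.2]
  | sum k N e ih => simp only [eval, ih he]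
  | shift r a b e ih => simp only [eval, ih he]

end Expr

/-- The registers outside of `L` are `0`, the register `3` is `1`, and `B` bounds all registers. -/
structure Ready (L : List ℕ) (B σ : ℕ → ℕ) : Prop where
  zero : ∀ r, r ∉ L → σ r = 0
  three_mem : 3 ∈ L
  three : σ 3 = 1
  le : ∀ r, σ r ≤ B r

theorem Ready.update {L : List ℕ} {B σ : ℕ → ℕ} (h : Ready L B σ) {k v c : ℕ} (hk : k ∉ L)
    (hv : v ≤ c) : Ready (k :: L) (Function.update B k c) (Function.update σ k v) where
  zero r hr := by
    rw [List.mem_cons, not_or] at hr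
    rw [Function.update_of_ne hr.1, h.zero r hr.2]
  three_mem := List.mem_cons_of_mem _ h.three_mem
  three := by
    have : 3 ≠ k := fun e => hk (e ▸ h.three_mem)
    rw [Function.update_of_ne this, h.three]
  le r := by
    by_cases hr : r = k
    · subst hr; simpa using hv
    · rw [Function.update_of_ne hr, Function.update_of_ne hr]; exact h.le r

theorem Ready.update_zero {L : List ℕ} {B σ : ℕ → ℕ} (h : Ready L B σ) {k v : ℕ} (hk : k ∉ L) :
    Function.update (Function.update σ k v) k 0 = σ := by
  rw [Function.update_idem, ← h.zero k hk, Function.update_eq_self]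

theorem exec_while {P : Prog} {k N n c : ℕ} (I : ℕ → State → Prop)
    (hI : ∀ v s, I v s → s.idx k = v ∧ s.idx N = n)
    (hstep : ∀ v s, v < n → I v s → ∃ s' t, Exec P s s' t ∧ t ≤ c ∧ I (v + 1) s') {s : State}
    (hs : I 0 s) : ∃ s' t, Exec (.while (.idxLt k N) P) s s' t ∧ t ≤ n * (c + 1) + 1 ∧ I n s' := by
  have key : ∀ r v s, v + r = n → I v s →
      ∃ s' t, Exec (.while (.idxLt k N) P) s s' t ∧ t ≤ r * (c + 1) + 1 ∧ I n s' := by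
    intro r
    induction r with
    | zero =>
      intro v s hv hvs
      have hvn : v = n := by omega
      subst hvn
      refine ⟨s, 1, .while_false ?_, by omega, hvs⟩
      simp only [Test.Holds, (hI v s hvs).1, (hI v s hvs).2, lt_irrefl, not_false_iff]
    | succ r ih =>
      intro v s hv hvs
      obtain ⟨s₁, t₁, he₁, ht₁, hi₁⟩ := hstep v s (by omega) hvs
      obtain ⟨s₂, t₂, he₂, ht₂, hi₂⟩ := ih (v + 1) s₁ (by omega) hi₁
      refine ⟨s₂, t₁ + t₂ + 1, .while_true ?_ he₁ he₂, ?_, hi₂⟩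
      · simp only [Test.Holds, (hI v s hvs).1, (hI v s hvs).2]; omega
      · rw [add_mul]; omega
  exact key n 0 s (by omega) hs

/-- Real registers from `d` on are scratch space, and the preserved ones below hold pending
operands. A bound index register is free, hence 0, on entry and is reset to 0 on exit; this lets
loops start without initialization and restores the index registers exactly. -/
theorem Expr.exec_compile (e : Expr) : ∀ (L : List ℕ) (B : ℕ → ℕ) (d : ℕ) (s : State),
    e.wf L = true → Ready L B s.idx →
    ∃ s' t, Exec (e.compile d) s s' t ∧ t ≤ e.cost B ∧ s'.idx = s.idx ∧ s'.arr = s.arr ∧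
      s'.reg d = e.eval s.idx s.arr ∧ ∀ r, r < d → s'.reg r = s.reg r := by
  induction e with
  | ofIdx r =>
    intro L B d s _ _
    refine ⟨_, _, .instr _ _, le_rfl, rfl, rfl, ?_, fun r hr => ?_⟩
    · simp [Instr.exec, eval]
    · simp [Instr.exec, hr.ne]
  | const c =>
    intro L B d s _ hs
    refine ⟨_, _, .seq (.instr _ _) (.seq (.instr _ _) (.instr _ _)), le_rfl, ?_, rfl, ?_,
      fun r hr => ?_⟩
    · simp only [Instr.exec, Function.update_idem]
      rw [← hs.three, Function.update_eq_self]
    · simp [Instr.exec, eval]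
    · simp [Instr.exec, hr.ne]
  | read a i j k =>
    intro L B d s _ _
    refine ⟨_, _, .instr _ _, le_rfl, rfl, rfl, ?_, fun r hr => ?_⟩
    · simp [Instr.exec, eval]
    · simp [Instr.exec, hr.ne]
  | sqrt e ih =>
    intro L B d s hwf hs
    obtain ⟨s₁, t₁, he, ht, hi, ha, hv, hr⟩ := ih L B d s hwf hs
    refine ⟨_, _, .seq he (.instr _ _), by simp only [cost]; omega, hi, ha, ?_, fun r hrd => ?_⟩
    · simp [Instr.exec, eval, hv]
    · simp [Instr.exec, hrd.ne, hr r hrd]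
  | add e f ih1 ih2 | sub e f ih1 ih2 | mul e f ih1 ih2 | div e f ih1 ih2 =>
    intro L B d s hwf hs
    simp only [wf, Bool.and_eq_true] at hwf
    obtain ⟨s₁, t₁, he, ht, hi, ha, hv, hr⟩ := ih1 L B d s hwf.1 hs
    obtain ⟨s₂, t₂, he₂, ht₂, hi₂, ha₂, hv₂, hr₂⟩ :=
      ih2 L B (d + 1) s₁ hwf.2 (by rw [hi]; exact hs)
    refine ⟨_, _, .seq he (.seq he₂ (.instr _ _)), by simp only [cost]; omega, hi₂.trans hi,
      ha₂.trans ha, ?_, fun r hrd => ?_⟩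
    · simp [Instr.exec, eval, hv₂, hr₂ d (by omega), hv, hi, ha]
    · simp [Instr.exec, hrd.ne, hr₂ r (by omega), hr r hrd]
  | cond e f g h ih1 ih2 ih3 ih4 =>
    intro L B d s hwf hs
    simp only [wf, Bool.and_eq_true] at hwf
    obtain ⟨s₁, t₁, he, ht, hi, ha, hv, hr⟩ := ih1 L B d s hwf.1.1.1 hs
    obtain ⟨s₂, t₂, he₂, ht₂, hi₂, ha₂, hv₂, hr₂⟩ :=
      ih2 L B (d + 1) s₁ hwf.1.1.2 (by rw [hi]; exact hs)
    have hv' : s₂.reg d = e.eval s.idx s.arr := by rw [hr₂ d (by omega), hv]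
    rw [hi, ha] at hv₂
    by_cases hc : e.eval s.idx s.arr < f.eval s.idx s.arr
    · obtain ⟨s₃, t₃, he₃, ht₃, hi₃, ha₃, hv₃, hr₃⟩ :=
        ih3 L B d s₂ hwf.1.2 (by rw [hi₂, hi]; exact hs)
      refine ⟨_, _, .seq he (.seq he₂ (.ite_true ?_ he₃)), by simp only [cost]; omega,
        by rw [hi₃, hi₂, hi], by rw [ha₃, ha₂, ha], ?_, fun r hrd => ?_⟩
      · simpa only [Test.Holds, hv', hv₂] using hc
      · rw [hv₃, eval, if_pos hc, hi₂, hi, ha₂, ha]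
      · rw [hr₃ r hrd, hr₂ r (by omega), hr r hrd]
    · obtain ⟨s₃, t₃, he₃, ht₃, hi₃, ha₃, hv₃, hr₃⟩ :=
        ih4 L B d s₂ hwf.2 (by rw [hi₂, hi]; exact hs)
      refine ⟨_, _, .seq he (.seq he₂ (.ite_false ?_ he₃)), by simp only [cost]; omega,
        by rw [hi₃, hi₂, hi], by rw [ha₃, ha₂, ha], ?_, fun r hrd => ?_⟩
      · simpa only [Test.Holds, hv', hv₂] using hc
      · rw [hv₃, eval, if_neg hc, hi₂, hi, ha₂, ha]
      · rw [hr₃ r hrd, hr₂ r (by omega), hr r hrd]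
  | sum k N e ih =>
    intro L B d s hwf hs
    simp only [wf, Bool.and_eq_true, Bool.not_eq_true', List.contains_eq_mem,
      decide_eq_false_iff_not, beq_eq_false_iff_ne] at hwf
    obtain ⟨⟨hk, hN⟩, hwf⟩ := hwf
    let I : ℕ → State → Prop := fun v s' => s'.idx = Function.update s.idx k v ∧ s'.arr = s.arr ∧
      s'.reg d = ∑ u ∈ range v, e.eval (Function.update s.idx k u) s.arr ∧
      ∀ r, r < d → s'.reg r = s.reg r
    obtain ⟨s₁, t₁, he₁, ht₁, hi₁⟩ := exec_while (k := k) (N := N) (n := s.idx N)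
      (c := e.cost (Function.update B k (B N)) + 2)
      (P := .seq (e.compile (d + 1)) (.seq (.instr (.add d d (d + 1))) (.instr (.idxAdd k k 3))))
      I (fun v s' h => by
        obtain ⟨h1, -⟩ := h
        simp [h1, Function.update_of_ne hN])
      (fun v s' hv h => by
        obtain ⟨h1, h2, h3, h4⟩ := h
        have hready : Ready (k :: L) (Function.update B k (B N)) s'.idx := by
          rw [h1]; exact hs.update hk (hv.le.trans (hs.le N))
        obtain ⟨s₂, t₂, he₂, ht₂, hi₂, ha₂, hv₂, hr₂⟩ := ih _ _ (d + 1) s' hwf hready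
        refine ⟨_, _, .seq he₂ (.seq (.instr _ _) (.instr _ _)), by omega, ?_, ?_, ?_, ?_⟩
        · simp only [Instr.exec, hi₂]
          rw [hready.three, h1]
          simp
        · simp [Instr.exec, ha₂, h2]
        · simp [Instr.exec, hr₂ d (by omega), hv₂, h3, h1, h2, sum_range_succ]
        · intro r hrd
          simp [Instr.exec, hrd.ne, hr₂ r (by omega), h4 r hrd])
      (s := (Instr.sub d d d).exec s) (by
        refine ⟨?_, rfl, ?_, fun r hrd => ?_⟩
        · simp only [Instr.exec]
          rw [← hs.zero k hk, Function.update_eq_self]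
        · simp [Instr.exec]
        · simp [Instr.exec, hrd.ne])
    obtain ⟨h1, h2, h3, h4⟩ := hi₁
    refine ⟨_, _, .seq (.instr _ _) (.seq he₁ (.instr _ _)), ?_, ?_, h2, h3, h4⟩
    · have : s.idx N * (e.cost (Function.update B k (B N)) + 2 + 1) ≤
          B N * (e.cost (Function.update B k (B N)) + 3) := Nat.mul_le_mul_right _ (hs.le N)
      simp only [cost]; omega
    · simp only [Instr.exec, h1]
      exact hs.update_zero hk
  | shift r a b e ih =>
    intro L B d s hwf hs
    simp only [wf, Bool.and_eq_true, Bool.not_eq_true', List.contains_eq_mem,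
      decide_eq_false_iff_not] at hwf
    obtain ⟨hk, hwf⟩ := hwf
    obtain ⟨s₁, t₁, he, ht, hi, ha, hv, hr⟩ := ih (r :: L) (Function.update B r (B a)) d
      ((Instr.idxSub r a b).exec s) hwf
      (hs.update hk ((Nat.sub_le _ _).trans (hs.le a)))
    refine ⟨_, _, .seq (.instr _ _) (.seq he (.instr _ _)), by simp only [cost]; omega, ?_, ha,
      hv, hr⟩
    simp only [Instr.exec, hi]
    exact hs.update_zero hk

/-- Statements: assignment to an array entry, composition, and counting loops. -/
inductive Stmt where
  | set (a i j k : ℕ) (e : Expr)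
  | seq (S T : Stmt)
  | loop (k N : ℕ) (S : Stmt)

namespace Stmt

/-- The effect of a statement on the arrays. -/
noncomputable def den : Stmt → (ℕ → ℕ) → (ℕ → ℕ → ℕ → ℕ → ℝ) → ℕ → ℕ → ℕ → ℕ → ℝ
  | set a i j k e, σ, α => fun a' i' j' k' =>
      if a' = a ∧ i' = σ i ∧ j' = σ j ∧ k' = σ k then e.eval σ α else α a' i' j' k'
  | seq S T, σ, α => T.den σ (S.den σ α)
  | .loop k N S, σ, α => Nat.rec α (fun v β => S.den (Function.update σ k v) β) (σ N)

/-- The program of a statement. -/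
def compile : Stmt → Prog
  | set a i j k e => .seq (e.compile 0) (.instr (.store a i j k 0))
  | seq S T => .seq S.compile T.compile
  | .loop k N S => .seq (.while (.idxLt k N) (.seq S.compile (.instr (.idxAdd k k 3))))
      (.instr (.idxConst k 0))

/-- A bound for the running time, given bounds for the index registers. -/
def cost : Stmt → (ℕ → ℕ) → ℕ
  | set _ _ _ _ e, B => e.cost B + 1
  | seq S T, B => S.cost B + T.cost B
  | .loop k N S, B => B N * (S.cost (Function.update B k (B N)) + 2) + 2

/-- Bound index registers are not among the registers `L` in use. -/
def wf : Stmt → List ℕ → Bool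
  | set _ _ _ _ e, L => e.wf L
  | seq S T, L => S.wf L && T.wf L
  | .loop k N S, L => !L.contains k && !(N == k) && S.wf (k :: L)

/-- The statement does not write to the array `a`. -/
def keeps (a : ℕ) : Stmt → Bool
  | set a' _ _ _ _ => !(a == a')
  | seq S T => S.keeps a && T.keeps a
  | .loop _ _ S => S.keeps a

theorem den_of_keeps {a : ℕ} {S : Stmt} (hS : S.keeps a = true) (σ : ℕ → ℕ)
    (α : ℕ → ℕ → ℕ → ℕ → ℝ) : S.den σ α a = α a := by
  induction S generalizing σ α with
  | set a' i j k e =>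
    have : a ≠ a' := by simpa [keeps] using hS
    funext i j k
    simp [den, this]
  | seq S T ih1 ih2 =>
    simp only [keeps, Bool.and_eq_true] at hS
    rw [den, ih2 hS.2, ih1 hS.1]
  | loop k N S ih =>
    rw [den]
    induction σ N with
    | zero => rfl
    | succ v ihv => rw [← ihv]; exact ih hS _ _

theorem exec_compile (S : Stmt) : ∀ (L : List ℕ) (B : ℕ → ℕ) (s : State),
    S.wf L = true → Ready L B s.idx →
    ∃ s' t, Exec S.compile s s' t ∧ t ≤ S.cost B ∧ s'.idx = s.idx ∧
      s'.arr = S.den s.idx s.arr := by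
  induction S with
  | set a i j k e =>
    intro L B s hwf hs
    obtain ⟨s₁, t₁, he, ht, hi, ha, hv, -⟩ := e.exec_compile L B 0 s hwf hs
    refine ⟨_, _, .seq he (.instr _ _), by simp only [cost]; omega, hi, ?_⟩
    simp only [Instr.exec, den, hi, ha, hv]
  | seq S T ih1 ih2 =>
    intro L B s hwf hs
    simp only [wf, Bool.and_eq_true] at hwf
    obtain ⟨s₁, t₁, he, ht, hi, ha⟩ := ih1 L B s hwf.1 hs
    obtain ⟨s₂, t₂, he₂, ht₂, hi₂, ha₂⟩ := ih2 L B s₁ hwf.2 (by rw [hi]; exact hs)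
    refine ⟨_, _, .seq he he₂, by simp only [cost]; omega, hi₂.trans hi, ?_⟩
    rw [ha₂, hi, ha, den]
  | loop k N S ih =>
    intro L B s hwf hs
    simp only [wf, Bool.and_eq_true, Bool.not_eq_true', List.contains_eq_mem,
      decide_eq_false_iff_not, beq_eq_false_iff_ne] at hwf
    obtain ⟨⟨hk, hN⟩, hwf⟩ := hwf
    let f : ℕ → ℕ → ℕ → ℕ → ℕ → ℝ := fun n =>
      Nat.rec s.arr (fun v β => S.den (Function.update s.idx k v) β) n
    let I : ℕ → State → Prop := fun v s' => s'.idx = Function.update s.idx k v ∧ s'.arr = f v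
    obtain ⟨s₁, t₁, he₁, ht₁, hi₁⟩ := exec_while (k := k) (N := N) (n := s.idx N)
      (c := S.cost (Function.update B k (B N)) + 1)
      (P := .seq S.compile (.instr (.idxAdd k k 3))) I (fun v s' h => by
        obtain ⟨h1, -⟩ := h
        simp [h1, Function.update_of_ne hN])
      (fun v s' hv h => by
        obtain ⟨h1, h2⟩ := h
        have hready : Ready (k :: L) (Function.update B k (B N)) s'.idx := by
          rw [h1]; exact hs.update hk (hv.le.trans (hs.le N))
        obtain ⟨s₂, t₂, he₂, ht₂, hi₂, ha₂⟩ := ih _ _ s' hwf hready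
        refine ⟨_, _, .seq he₂ (.instr _ _), by omega, ?_, ?_⟩
        · simp only [Instr.exec, hi₂]
          rw [hready.three, h1]
          simp
        · simp only [Instr.exec, ha₂, h1, h2]
          rfl)
      (s := s) (by
        refine ⟨?_, rfl⟩
        rw [← hs.zero k hk, Function.update_eq_self])
    obtain ⟨h1, h2⟩ := hi₁
    refine ⟨_, _, .seq he₁ (.instr _ _), ?_, ?_, h2⟩
    · have : s.idx N * (S.cost (Function.update B k (B N)) + 1 + 1) ≤
          B N * (S.cost (Function.update B k (B N)) + 2) := Nat.mul_le_mul_right _ (hs.le N)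
      simp only [cost]; omega
    · simp only [Instr.exec, h1]
      exact hs.update_zero hk

/-- The written value depends only on the position and on arrays other than `a`, which the loop
leaves alone. The rounds thus neither interfere nor disagree, and only the union of the written
positions matters. -/
theorem rec_eq_of_writes {a : ℕ} {α : ℕ → ℕ → ℕ → ℕ → ℝ}
    {f : ℕ → (ℕ → ℕ → ℕ → ℕ → ℝ) → ℕ → ℕ → ℕ → ℕ → ℝ} {W : ℕ → ℕ → ℕ → ℕ → Prop}
    [∀ v i j k, Decidable (W v i j k)] {V : ℕ → ℕ → ℕ → ℝ}
    (hf : ∀ v β, (∀ a', a' ≠ a → β a' = α a') →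
      f v β = fun a' i j k => if a' = a ∧ W v i j k then V i j k else β a' i j k) (n : ℕ)
    {W' : ℕ → ℕ → ℕ → Prop} [∀ i j k, Decidable (W' i j k)]
    (hW : ∀ i j k, (∃ v < n, W v i j k) ↔ W' i j k) :
    (Nat.rec α (fun v β => f v β) n : ℕ → ℕ → ℕ → ℕ → ℝ) =
      fun a' i j k => if a' = a ∧ W' i j k then V i j k else α a' i j k := by
  classical
  induction n generalizing W' with
  | zero =>
    funext a' i j k
    have : ¬ W' i j k := by rw [← hW]; simp
    simp [this]
  | succ n ih =>
    change f n (Nat.rec α (fun v β => f v β) n) = _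
    rw [ih (W' := fun i j k => ∃ v < n, W v i j k) fun _ _ _ => Iff.rfl]
    rw [hf]
    · funext a' i j k
      by_cases ha : a' = a
      · by_cases hWn : W n i j k
        · have : W' i j k := (hW i j k).1 ⟨n, by omega, hWn⟩
          simp only [ha, hWn, this, and_self, if_true]
        · have : (∃ v < n, W v i j k) ↔ W' i j k := by
            rw [← hW]
            exact ⟨fun ⟨v, hv, h⟩ => ⟨v, by omega, h⟩, fun ⟨v, hv, h⟩ => ⟨v, by
                have : v ≠ n := fun e => hWn (e ▸ h)
                omega, h⟩⟩
          simp only [ha, hWn, this, true_and, if_false]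
      · simp only [ha, false_and, if_false]
    · intro a' ha'
      funext i j k
      simp only [ha', false_and, if_false]

/-- Simultaneous assignment of `e` to the entries of the array `a` with subscripts below `Ni, Nj, Nk`;
in `e` the subscripts are the index registers `10, 11, 12`. -/
def par (a Ni Nj Nk : ℕ) (e : Expr) : Stmt :=
  .loop 10 Ni (.loop 11 Nj (.loop 12 Nk (set a 10 11 12 e)))

/-- Since `e` does not read the array being written, the three nested loops act as one simultaneous
assignment. The bounds on `Nj` and `Nk` keep the inner limits clear of the loop counters. -/
theorem den_par {a Ni Nj Nk : ℕ} {e : Expr} (he : e.avoids a = true) (hj : Nj < 10)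
    (hk : Nk < 10) (σ : ℕ → ℕ) (α : ℕ → ℕ → ℕ → ℕ → ℝ) :
    (par a Ni Nj Nk e).den σ α = fun a' i j k =>
      if a' = a ∧ i < σ Ni ∧ j < σ Nj ∧ k < σ Nk then
        e.eval (Function.update (Function.update (Function.update σ 10 i) 11 j) 12 k) α
      else α a' i j k := by
  classical
  let V : ℕ → ℕ → ℕ → ℝ := fun i j k =>
    e.eval (Function.update (Function.update (Function.update σ 10 i) 11 j) 12 k) α
  have h1 : ∀ i j β, (∀ a', a' ≠ a → β a' = α a') →
      (Stmt.loop 12 Nk (set a 10 11 12 e)).den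
        (Function.update (Function.update σ 10 i) 11 j) β = fun a' i' j' k' =>
      if a' = a ∧ (i' = i ∧ j' = j ∧ k' < σ Nk) then V i' j' k' else β a' i' j' k' := by
    intro i j β hβ
    rw [den]
    have hNk : Function.update (Function.update σ 10 i) 11 j Nk = σ Nk := by
      rw [Function.update_of_ne (by omega), Function.update_of_ne (by omega)]
    rw [hNk]
    refine (rec_eq_of_writes (a := a) (V := V) (W := fun v i' j' k' => i' = i ∧ j' = j ∧ k' = v)
      ?_ _ (W' := fun i' j' k' => i' = i ∧ j' = j ∧ k' < σ Nk) fun i' j' k' =>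
        ⟨fun ⟨v, hv, h1, h2, h3⟩ => ⟨h1, h2, h3 ▸ hv⟩,
          fun ⟨h1, h2, h3⟩ => ⟨k', h3, h1, h2, rfl⟩⟩).trans ?_
    · intro v γ hγ
      funext a' i' j' k'
      have e1 : Function.update (Function.update (Function.update σ 10 i) 11 j) 12 v 10 = i := by
        simp
      have e2 : Function.update (Function.update (Function.update σ 10 i) 11 j) 12 v 11 = j := by
        simp
      have e3 : Function.update (Function.update (Function.update σ 10 i) 11 j) 12 v 12 = v := by
        simp
      simp only [den, e1, e2, e3]
      by_cases h : a' = a ∧ i' = i ∧ j' = j ∧ k' = v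
      · rw [if_pos h, if_pos h]
        obtain ⟨-, rfl, rfl, rfl⟩ := h
        exact Expr.eval_congr he _ fun a'' ha'' => by rw [hγ a'' ha'', hβ a'' ha'']
      · rw [if_neg h, if_neg h]
    · rfl
  have h2 : ∀ i β, (∀ a', a' ≠ a → β a' = α a') →
      (Stmt.loop 11 Nj (Stmt.loop 12 Nk (set a 10 11 12 e))).den (Function.update σ 10 i) β =
        fun a' i' j' k' => if a' = a ∧ (i' = i ∧ j' < σ Nj ∧ k' < σ Nk) then V i' j' k'
          else β a' i' j' k' := by
    intro i β hβ
    rw [den]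
    have hNj : Function.update σ 10 i Nj = σ Nj := by rw [Function.update_of_ne (by omega)]
    rw [hNj]
    refine rec_eq_of_writes (a := a) (V := V)
      (W := fun v i' j' k' => i' = i ∧ j' = v ∧ k' < σ Nk) ?_ _
      (W' := fun i' j' k' => i' = i ∧ j' < σ Nj ∧ k' < σ Nk) (fun i' j' k' =>
        ⟨fun ⟨v, hv, h1, h2, h3⟩ => ⟨h1, h2 ▸ hv, h3⟩,
          fun ⟨h1, h2, h3⟩ => ⟨j', h2, h1, rfl, h3⟩⟩) |>.trans ?_
    · intro v γ hγ
      exact h1 i v γ fun a' ha' => by rw [hγ a' ha', hβ a' ha']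
    · funext a' i' j' k'
      by_cases h : a' = a
      · rfl
      · rfl
  rw [par, den]
  exact rec_eq_of_writes (a := a) (V := V) (W := fun v i' j' k' => i' = v ∧ j' < σ Nj ∧ k' < σ Nk)
    (fun v γ hγ => h2 v γ hγ) _ (W' := fun i' j' k' => i' < σ Ni ∧ j' < σ Nj ∧ k' < σ Nk)
    (fun i' j' k' => ⟨fun ⟨v, hv, h1, h2, h3⟩ => ⟨h1 ▸ hv, h2, h3⟩,
      fun ⟨h1, h2, h3⟩ => ⟨i', h1, rfl, h2, h3⟩⟩)

end Stmt

end ArrayLang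

namespace MatrixDiscrepancy
open Matrix Finset

/-! ### Matrix inversion by principal pivoting -/

section Sweep

variable {ν : Type*} [Fintype ν] [DecidableEq ν]

/-- The principal pivot transform: it exchanges the roles of the `k`-th input and output. -/
noncomputable def sweep (M : Matrix ν ν ℝ) (k : ν) : Matrix ν ν ℝ :=
  of fun i j =>
    if i = k then (if j = k then 1 / M k k else 0 - M k j / M k k)
    else (if j = k then M i k / M k k else M i j - M i k * M k j / M k k)

/-- `M` arises from `A` by exchanging the inputs and outputs in `T`. -/
def IsSwept (A : Matrix ν ν ℝ) (T : Finset ν) (M : Matrix ν ν ℝ) : Prop :=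
  ∀ x : ν → ℝ, M *ᵥ (fun i => if i ∈ T then (A *ᵥ x) i else x i) =
    fun i => if i ∈ T then x i else (A *ᵥ x) i

/-- The mixed vector determines x: off T directly, on T through `M`. Hence some x ≠ 0 has mixed
vector e_k, and then M k k = (Ax)_k. In x·Ax every term with i ≠ k vanishes, because either (Ax)_i
or x_i is 0, while x_k = 1; so the pivot is x·Ax > 0. -/
theorem IsSwept.pivot_pos {A M : Matrix ν ν ℝ} (hA : A.PosDef) {T : Finset ν}
    (h : IsSwept A T M) {k : ν} (hk : k ∉ T) : 0 < M k k := by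
  let F : (ν → ℝ) →ₗ[ℝ] (ν → ℝ) :=
    { toFun := fun x i => if i ∈ T then (A *ᵥ x) i else x i
      map_add' := fun x y => by
        funext i
        simp only [mulVec_add, Pi.add_apply]
        split_ifs <;> rfl
      map_smul' := fun c x => by
        funext i
        simp only [mulVec_smul, Pi.smul_apply, RingHom.id_apply]
        split_ifs <;> rfl }
  have hinj : Function.Injective F := by
    rw [← LinearMap.ker_eq_bot, LinearMap.ker_eq_bot']
    intro x hx
    have h1 := h x
    have h2 : (fun i => if i ∈ T then (A *ᵥ x) i else x i) = 0 := hx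
    rw [h2, mulVec_zero] at h1
    funext i
    by_cases hi : i ∈ T
    · have := congrFun h1 i
      simpa [hi] using this.symm
    · have := congrFun h2 i
      simpa [hi] using this
  obtain ⟨x, hx⟩ := (LinearMap.injective_iff_surjective.1 hinj) (Pi.single k 1)
  have hx' : (fun i => if i ∈ T then (A *ᵥ x) i else x i) = Pi.single k 1 := hx
  have h1 := congrFun (h x) k
  rw [hx', mulVec_single_one, if_neg hk] at h1
  have h2 : x ⬝ᵥ A *ᵥ x = (A *ᵥ x) k := by
    rw [dotProduct, sum_eq_single k]
    · have := congrFun hx' k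
      simp only [hk, if_false, Pi.single_eq_same] at this
      rw [this, one_mul]
    · intro i _ hi
      have := congrFun hx' i
      rw [Pi.single_eq_of_ne hi] at this
      by_cases hiT : i ∈ T
      · simp only [hiT, if_true] at this; rw [this, mul_zero]
      · simp only [hiT, if_false] at this; rw [this, zero_mul]
    · simp
  have hx0 : x ≠ 0 := fun h0 => by
    have := congrFun hx' k
    simp [hk, h0] at this
  have h3 := dotProduct_pos_of_posDef hA hx0
  rw [h2, ← h1] at h3
  exact h3

/-- Solve the k-th equation for x_k and substitute it into the others. -/
theorem IsSwept.insert {A M : Matrix ν ν ℝ} {T : Finset ν} (h : IsSwept A T M) {k : ν}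
    (hk : k ∉ T) (hd : M k k ≠ 0) : IsSwept A (insert k T) (sweep M k) := by
  intro x
  set u : ν → ℝ := fun i => if i ∈ T then (A *ᵥ x) i else x i with hu
  have hw := h x
  have hrow : ∀ i, M i k * x k + ∑ j ∈ univ.erase k, M i j * u j =
      if i ∈ T then x i else (A *ᵥ x) i := fun i => by
    have h1 := congrFun hw i
    rw [mulVec, dotProduct, ← add_sum_erase univ _ (mem_univ k)] at h1
    rw [← h1, hu]
    simp only [hk, if_false]
  have hk1 := hrow k
  rw [if_neg hk] at hk1
  have hu' : ∀ j ∈ univ.erase k, (if j ∈ Insert.insert k T then (A *ᵥ x) j else x j) = u j :=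
    fun j hj => by simp [hu, (mem_erase.1 hj).1]
  funext i
  rw [mulVec, dotProduct, ← add_sum_erase univ _ (mem_univ k)]
  have hks : (if k ∈ Insert.insert k T then (A *ᵥ x) k else x k) = (A *ᵥ x) k := by simp
  rw [hks]
  by_cases hi : i = k
  · subst hi
    have e : ∑ j ∈ univ.erase i, sweep M i i j *
        (if j ∈ Insert.insert i T then (A *ᵥ x) j else x j) =
        -(∑ j ∈ univ.erase i, M i j * u j) / M i i := by
      rw [neg_div, sum_div, ← sum_neg_distrib]
      refine sum_congr rfl fun j hj => ?_
      rw [hu' j hj]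
      simp [sweep, (mem_erase.1 hj).1]
      ring
    rw [e, ← hk1]
    simp [sweep]
    field_simp
    ring
  · have e : ∑ j ∈ univ.erase k, sweep M k i j *
        (if j ∈ Insert.insert k T then (A *ᵥ x) j else x j) =
        ∑ j ∈ univ.erase k, M i j * u j - M i k / M k k * ∑ j ∈ univ.erase k, M k j * u j := by
      rw [mul_sum, ← sum_sub_distrib]
      refine sum_congr rfl fun j hj => ?_
      rw [hu' j hj]
      simp [sweep, (mem_erase.1 hj).1, hi]
      ring
    have h2 := hrow i
    have h3 : (if i ∈ Insert.insert k T then x i else (A *ᵥ x) i) =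
        if i ∈ T then x i else (A *ᵥ x) i := by simp [hi]
    rw [e, h3, ← h2, ← hk1]
    simp [sweep, hi]
    field_simp
    ring

theorem isSwept_empty (A : Matrix ν ν ℝ) : IsSwept A ∅ A := fun x => by simp

theorem IsSwept.eq_inv {A M : Matrix ν ν ℝ} (h : IsSwept A univ M) : M = A⁻¹ := by
  symm
  apply inv_eq_left_inv
  ext i j
  have := congrFun (h (Pi.single j 1)) i
  simp only [mem_univ, if_true] at this
  rw [mulVec_mulVec, mulVec_single_one] at this
  rw [Matrix.one_apply, ← Pi.single_apply]
  exact this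

end Sweep

end MatrixDiscrepancy

/-! ### Array programs for inverses and powers -/

namespace ArrayLang
open Matrix Finset MatrixDiscrepancy

/-- The matrix stored in a two-dimensional array. -/
def mat (N : ℕ) (f : ℕ → ℕ → ℕ → ℝ) : Matrix (Fin N) (Fin N) ℝ := of fun i j => f i j 0

/-- The vector stored in a one-dimensional array. -/
def vec (n : ℕ) (f : ℕ → ℕ → ℕ → ℝ) : Fin n → ℝ := fun i => f i 0 0

/-- The contents of the index registers: `n`, `m`, `q`, `1`, `2m`, `64n`, `0`. -/
structure Regs (n m q : ℕ) (σ : ℕ → ℕ) : Prop where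
  r0 : σ 0 = n
  r1 : σ 1 = m
  r2 : σ 2 = q
  r3 : σ 3 = 1
  r4 : σ 4 = m + m
  r5 : σ 5 = 64 * n
  r6 : σ 6 = 0

theorem Regs.update {n m q : ℕ} {σ : ℕ → ℕ} (h : Regs n m q σ) {r : ℕ} (hr : 7 ≤ r) (v : ℕ) :
    Regs n m q (Function.update σ r v) := by
  obtain ⟨h0, h1, h2, h3, h4, h5, h6⟩ := h
  constructor <;> rw [Function.update_of_ne (by omega)] <;> assumption

namespace Stmt

theorem den_par_self {a Ni Nj Nk : ℕ} {e : Expr} (he : e.avoids a = true) (hj : Nj < 10)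
    (hk : Nk < 10) {σ : ℕ → ℕ} {α : ℕ → ℕ → ℕ → ℕ → ℝ} {i j k : ℕ} (hi' : i < σ Ni)
    (hj' : j < σ Nj) (hk' : k < σ Nk) : (par a Ni Nj Nk e).den σ α a i j k =
      e.eval (Function.update (Function.update (Function.update σ 10 i) 11 j) 12 k) α := by
  rw [den_par he hj hk]
  exact if_pos ⟨rfl, hi', hj', hk'⟩

theorem den_par_of_ne {a a' Ni Nj Nk : ℕ} {e : Expr} (h : a' ≠ a) (σ : ℕ → ℕ)
    (α : ℕ → ℕ → ℕ → ℕ → ℝ) : (par a Ni Nj Nk e).den σ α a' = α a' :=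
  den_of_keeps (by simpa [par, keeps] using h) σ α

end Stmt

namespace Expr

/-- `e` if the two index registers are equal, and `f` otherwise. -/
def ifEq (r s : ℕ) (e f : Expr) : Expr :=
  cond (ofIdx r) (ofIdx s) f (cond (ofIdx s) (ofIdx r) f e)

theorem eval_ifEq (r s : ℕ) (e f : Expr) (σ : ℕ → ℕ) (α : ℕ → ℕ → ℕ → ℕ → ℝ) :
    (ifEq r s e f).eval σ α = if σ r = σ s then e.eval σ α else f.eval σ α := by
  simp only [ifEq, eval, Nat.cast_lt]
  rcases lt_trichotomy (σ r) (σ s) with h | h | h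
  · simp [h, h.ne]
  · simp [h]
  · simp [h, h.ne', h.not_gt]

/-- The scalar stored in the array `a`. -/
def rd0 (a : ℕ) : Expr := read a 6 6 6

/-- The entry of the one-dimensional array `a` at the index register `i`. -/
def rd1 (a i : ℕ) : Expr := read a i 6 6

/-- The entry of the two-dimensional array `a` at the index registers `i`, `j`. -/
def rd2 (a i j : ℕ) : Expr := read a i j 6

/-- The entries of the matrix in the array `a` after a sweep on the index in register `20`. -/
def sweepEntry (a : ℕ) : Expr :=
  ifEq 10 20
    (ifEq 11 20 (div (const 1) (rd2 a 20 20)) (sub (const 0) (div (rd2 a 20 11) (rd2 a 20 20))))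
    (ifEq 11 20 (div (rd2 a 10 20) (rd2 a 20 20))
      (sub (rd2 a 10 11) (div (mul (rd2 a 10 20) (rd2 a 20 11)) (rd2 a 20 20))))

end Expr

open ArrayLang.Expr ArrayLang.Stmt

/-- Inversion of the matrix in the array `a`, with the auxiliary array `t`; the size is in register
`N`. -/
def invert (a t N : ℕ) : Stmt :=
  .loop 20 N (.seq (par t N N 3 (sweepEntry a)) (par a N N 3 (rd2 t 10 11)))

theorem den_loop (k N : ℕ) (S : Stmt) (σ : ℕ → ℕ) (α : ℕ → ℕ → ℕ → ℕ → ℝ) :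
    (Stmt.loop k N S).den σ α =
      Nat.rec α (fun v β => S.den (Function.update σ k v) β) (σ N) := rfl

theorem den_seq (S T : Stmt) (σ : ℕ → ℕ) (α : ℕ → ℕ → ℕ → ℕ → ℝ) :
    (Stmt.seq S T).den σ α = T.den σ (S.den σ α) := rfl

variable {n m q : ℕ} {σ : ℕ → ℕ}

theorem mat_par (h : Regs n m q σ) {a r : ℕ} {e : Expr} (he : e.avoids a = true) (hr : r < 10)
    (α : ℕ → ℕ → ℕ → ℕ → ℝ) : mat (σ r) ((par a r r 3 e).den σ α a) = of fun i j : Fin (σ r) =>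
      e.eval (Function.update (Function.update (Function.update σ 10 i) 11 j) 12 0) α := by
  ext i j
  rw [mat, of_apply, of_apply, den_par_self he hr (by norm_num) i.2 j.2 (by rw [h.r3]; norm_num)]

theorem vec_par (h : Regs n m q σ) {a : ℕ} {e : Expr} (he : e.avoids a = true)
    (α : ℕ → ℕ → ℕ → ℕ → ℝ) : vec n ((par a 0 3 3 e).den σ α a) = fun i : Fin n =>
      e.eval (Function.update (Function.update (Function.update σ 10 i) 11 0) 12 0) α := by
  funext i
  rw [vec, den_par_self he (by norm_num) (by norm_num) (by rw [h.r0]; exact i.2)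
    (by rw [h.r3]; norm_num) (by rw [h.r3]; norm_num)]

theorem scal_par (h : Regs n m q σ) {a : ℕ} {e : Expr} (he : e.avoids a = true)
    (α : ℕ → ℕ → ℕ → ℕ → ℝ) : (par a 3 3 3 e).den σ α a 0 0 0 =
      e.eval (Function.update (Function.update (Function.update σ 10 0) 11 0) 12 0) α :=
  den_par_self he (by norm_num) (by norm_num) (by rw [h.r3]; norm_num) (by rw [h.r3]; norm_num)
    (by rw [h.r3]; norm_num)

/-- After v rounds the array holds the matrix swept on the indices below v. Positive definiteness
makes every pivot nonzero, so no row exchanges are needed; array `t` buffers the new entries, which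
depend on old ones. -/
theorem mat_invert (h : Regs n m q σ) {a t r : ℕ} (hat : a ≠ t) (hr : r < 10)
    (α : ℕ → ℕ → ℕ → ℕ → ℝ) (hM : (mat (σ r) (α a)).PosDef) :
    mat (σ r) ((invert a t r).den σ α a) = (mat (σ r) (α a))⁻¹ := by
  set f : ℕ → ℕ → ℕ → ℕ → ℕ → ℝ := fun v => Nat.rec α (fun v β =>
    (Stmt.seq (par t r r 3 (sweepEntry a)) (par a r r 3 (rd2 t 10 11))).den
      (Function.update σ 20 v) β) v with hf
  have hbody : ∀ v (hv : v < σ r), mat (σ r) (f (v + 1) a) = sweep (mat (σ r) (f v a)) ⟨v, hv⟩ := by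
    intro v hv
    have hR := h.update (r := 20) (by norm_num) v
    have hr20 : Function.update σ 20 v r = σ r := Function.update_of_ne (by omega) _ _
    have e1 : f (v + 1) = (par a r r 3 (rd2 t 10 11)).den (Function.update σ 20 v)
      ((par t r r 3 (sweepEntry a)).den (Function.update σ 20 v) (f v)) := rfl
    have h1 := mat_par hR (a := a) (r := r) (e := rd2 t 10 11) (by simp [avoids, rd2, hat.symm]) hr
      ((par t r r 3 (sweepEntry a)).den (Function.update σ 20 v) (f v))
    have h2 := mat_par hR (a := t) (r := r) (e := sweepEntry a)
      (by simp [avoids, sweepEntry, ifEq, rd2, hat]) hr (f v)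
    rw [hr20] at h1 h2
    rw [e1, h1]
    have h3 : (of fun i j : Fin (σ r) => (rd2 t 10 11).eval (Function.update (Function.update
        (Function.update (Function.update σ 20 v) 10 i) 11 j) 12 0)
        ((par t r r 3 (sweepEntry a)).den (Function.update σ 20 v) (f v))) =
        mat (σ r) ((par t r r 3 (sweepEntry a)).den (Function.update σ 20 v) (f v) t) := by
      ext i j
      simp [rd2, eval, mat, h.r6]
    rw [h3, h2]
    ext i j
    simp only [of_apply, sweepEntry, eval_ifEq]
    simp [eval, rd2, h.r6, sweep, mat, Fin.ext_iff]
  have key : ∀ v (hv : v ≤ σ r), IsSwept (mat (σ r) (α a))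
      (univ.filter fun i : Fin (σ r) => (i : ℕ) < v) (mat (σ r) (f v a)) := by
    intro v
    induction v with
    | zero =>
      intro _
      have : (univ.filter fun i : Fin (σ r) => (i : ℕ) < 0) = ∅ := by simp
      rw [this]
      exact isSwept_empty _
    | succ v ih =>
      intro hv
      have h1 := ih (by omega)
      have hk : (⟨v, by omega⟩ : Fin (σ r)) ∉ univ.filter fun i : Fin (σ r) => (i : ℕ) < v := by
        simp
      have h2 := h1.insert hk (h1.pivot_pos hM hk).ne'
      rw [hbody v (by omega)]
      have : (univ.filter fun i : Fin (σ r) => (i : ℕ) < v + 1) =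
          insert ⟨v, by omega⟩ (univ.filter fun i : Fin (σ r) => (i : ℕ) < v) := by
        ext i
        simp only [mem_filter, mem_univ, true_and, mem_insert, Fin.ext_iff]
        omega
      rw [this]
      exact h2
  have hfin := key (σ r) le_rfl
  have : (univ.filter fun i : Fin (σ r) => (i : ℕ) < σ r) = univ := by
    ext i; simp
  rw [this] at hfin
  exact hfin.eq_inv

/-- The power of the matrix in the array `a` with the exponent in the array `5`, a power of two; the
arrays `t`, `28` and `29` are auxiliary. -/
def power (a t N : ℕ) : Stmt :=
  .seq (par 29 3 3 3 (const 1))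
    (.loop 20 0 (.seq
      (.seq (par t N N 3 (cond (rd0 29) (rd0 5) (sum 13 N (mul (rd2 a 10 13) (rd2 a 13 11)))
          (rd2 a 10 11)))
        (par a N N 3 (rd2 t 10 11)))
      (.seq (par 28 3 3 3 (cond (rd0 29) (rd0 5) (add (rd0 29) (rd0 29)) (rd0 29)))
        (par 29 3 3 3 (rd0 28)))))

/-- Array 29 tracks the exponent reached so far. The matrix is squared while that is below 2^k, and
the remaining rounds are idle; n rounds suffice because k ≤ n. -/
theorem mat_power (h : Regs n m q σ) {a t r : ℕ} (hat : a ≠ t) (ha5 : a ≠ 5) (ha28 : a ≠ 28)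
    (ha29 : a ≠ 29) (ht5 : t ≠ 5) (ht29 : t ≠ 29) (hr : r < 10)
    (α : ℕ → ℕ → ℕ → ℕ → ℝ) {k : ℕ} (hk : k ≤ n) (hp : α 5 0 0 0 = 2 ^ k) :
    mat (σ r) ((power a t r).den σ α a) = mat (σ r) (α a) ^ 2 ^ k := by
  set body : Stmt := .seq
      (.seq (par t r r 3 (cond (rd0 29) (rd0 5) (sum 13 r (mul (rd2 a 10 13) (rd2 a 13 11)))
          (rd2 a 10 11)))
        (par a r r 3 (rd2 t 10 11)))
      (.seq (par 28 3 3 3 (cond (rd0 29) (rd0 5) (add (rd0 29) (rd0 29)) (rd0 29)))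
        (par 29 3 3 3 (rd0 28))) with hbodydef
  set α' := (par 29 3 3 3 (const 1)).den σ α with hα'
  set f : ℕ → ℕ → ℕ → ℕ → ℕ → ℝ := fun v => Nat.rec α' (fun v β =>
    body.den (Function.update σ 20 v) β) v with hf
  have hα'5 : α' 5 = α 5 := den_par_of_ne (by norm_num) _ _
  have hα'a : α' a = α a := den_par_of_ne ha29 _ _
  have hα'29 : α' 29 0 0 0 = 1 := by
    rw [hα', scal_par h (by rfl)]; simp [eval]
  have key : ∀ v, f v 5 = α 5 ∧ f v 29 0 0 0 = 2 ^ min v k ∧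
      mat (σ r) (f v a) = mat (σ r) (α a) ^ 2 ^ min v k := by
    intro v
    induction v with
    | zero => exact ⟨hα'5, by simpa [hf] using hα'29, by simp [hf, hα'a]⟩
    | succ v ih =>
      obtain ⟨ih5, ih29, iha⟩ := ih
      have hR := h.update (r := 20) (by norm_num) v
      have hr20 : Function.update σ 20 v r = σ r := Function.update_of_ne (by omega) _ _
      set σ' := Function.update σ 20 v with hσ'
      set β := f v with hβ
      set β1 := (par t r r 3 (cond (rd0 29) (rd0 5)
        (sum 13 r (mul (rd2 a 10 13) (rd2 a 13 11))) (rd2 a 10 11))).den σ' β with hβ1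
      set β2 := (par a r r 3 (rd2 t 10 11)).den σ' β1 with hβ2
      set β3 := (par 28 3 3 3 (cond (rd0 29) (rd0 5) (add (rd0 29) (rd0 29)) (rd0 29))).den σ' β2
        with hβ3
      have hstep : f (v + 1) = (par 29 3 3 3 (rd0 28)).den σ' β3 := rfl
      have h3a : f (v + 1) a = β2 a := by
        rw [hstep, den_par_of_ne ha29, hβ3, den_par_of_ne ha28]
      have h25 : β2 5 = α 5 := by
        rw [hβ2, den_par_of_ne ha5.symm, hβ1, den_par_of_ne ht5.symm, ih5]
      have h229 : β2 29 = β 29 := by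
        rw [hβ2, den_par_of_ne ha29.symm, hβ1, den_par_of_ne ht29.symm]
      have hcond : ((2 : ℝ) ^ min v k < 2 ^ k) ↔ v < k := by
        rw [pow_lt_pow_iff_right₀ (by norm_num)]; omega
      refine ⟨?_, ?_, ?_⟩
      · rw [hstep, den_par_of_ne (by norm_num), hβ3, den_par_of_ne (by norm_num), h25]
      · rw [hstep, scal_par hR (by rfl)]
        have : (rd0 28).eval (Function.update (Function.update (Function.update σ' 10 0) 11 0) 12 0)
            β3 = β3 28 0 0 0 := by simp [rd0, eval, hR.r6]
        rw [this, hβ3, scal_par hR (by rfl)]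
        simp only [rd0, eval, Function.update_apply, hR.r6, h25, h229]
        simp only [Nat.reduceEqDiff, if_false, ih29, hp, hcond]
        by_cases hvk : v < k
        · rw [if_pos hvk, min_eq_left hvk.le, min_eq_left (by omega), pow_succ]; ring
        · rw [if_neg hvk, min_eq_right (by omega), min_eq_right (by omega)]
      · rw [h3a, hβ2]
        have e1 := mat_par hR (a := a) (r := r) (e := rd2 t 10 11)
          (by simp [avoids, rd2, hat.symm]) hr β1
        have e2 := mat_par hR (a := t) (r := r) (e := cond (rd0 29) (rd0 5)
          (sum 13 r (mul (rd2 a 10 13) (rd2 a 13 11))) (rd2 a 10 11))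
          (by simp [avoids, rd0, rd2, hat, ht5.symm, ht29.symm]) hr β
        rw [hr20] at e1 e2
        rw [e1]
        have e3 : (of fun i j : Fin (σ r) => (rd2 t 10 11).eval (Function.update (Function.update
            (Function.update σ' 10 i) 11 j) 12 0) β1) = mat (σ r) (β1 t) := by
          ext i j
          simp [rd2, eval, mat, hR.r6]
        rw [e3, hβ1, e2]
        have hrne : r ≠ 10 ∧ r ≠ 11 ∧ r ≠ 12 := by omega
        by_cases hvk : v < k
        · rw [min_eq_left (by omega)]
          rw [min_eq_left hvk.le] at iha ih29
          rw [pow_succ, mul_two, pow_add, ← iha]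
          ext i j
          simp only [of_apply, rd0, rd2, eval, Function.update_apply, hR.r6, ih5]
          simp only [Nat.reduceEqDiff, if_false, if_true, ih29, hp, hrne.1, hrne.2.1, hrne.2.2]
          rw [if_pos (pow_lt_pow_right₀ (by norm_num) hvk), Matrix.mul_apply, hr20]
          rw [← Fin.sum_univ_eq_sum_range (fun x => β a i x 0 * β a x j 0)]
          exact sum_congr rfl fun l _ => by simp [mat]
        · rw [min_eq_right (by omega)]
          rw [min_eq_right (by omega)] at iha ih29
          rw [← iha]
          ext i j
          simp [rd0, rd2, eval, hR.r6, ih5, hp, ih29, mat]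
  have hfin := (key n).2.2
  rw [min_eq_right hk] at hfin
  have : (power a t r).den σ α = f n := by
    rw [power, den_seq, den_loop, h.r0]
  rw [this, hfin]

end ArrayLang

/-! ### One round of the search: potential, step matrix, choice of a column -/

namespace ArrayLang
open Matrix Finset MatrixDiscrepancy
open ArrayLang.Expr ArrayLang.Stmt

variable {n m q : ℕ} {σ : ℕ → ℕ}

theorem mat_par_size (h : Regs n m q σ) {a r N : ℕ} (hN : σ r = N) {e : Expr}
    (he : e.avoids a = true) (hr : r < 10) (α : ℕ → ℕ → ℕ → ℕ → ℝ) :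
    mat N ((par a r r 3 e).den σ α a) = of fun i j : Fin N =>
      e.eval (Function.update (Function.update (Function.update σ 10 i) 11 j) 12 0) α := by
  subst hN
  exact mat_par h he hr α

theorem mat_invert_size (h : Regs n m q σ) {a t r N : ℕ} (hN : σ r = N) (hat : a ≠ t)
    (hr : r < 10) {α : ℕ → ℕ → ℕ → ℕ → ℝ} (hM : (mat N (α a)).PosDef) :
    mat N ((invert a t r).den σ α a) = (mat N (α a))⁻¹ := by
  subst hN
  exact mat_invert h hat hr α hM

theorem mat_power_size (h : Regs n m q σ) {a t r N : ℕ} (hN : σ r = N) (hat : a ≠ t) (ha5 : a ≠ 5)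
    (ha28 : a ≠ 28) (ha29 : a ≠ 29) (ht5 : t ≠ 5) (ht29 : t ≠ 29) (hr : r < 10)
    {α : ℕ → ℕ → ℕ → ℕ → ℝ} {k : ℕ} (hk : k ≤ n) (hp : α 5 0 0 0 = 2 ^ k) :
    mat N ((power a t r).den σ α a) = mat N (α a) ^ 2 ^ k := by
  subst hN
  exact mat_power h hat ha5 ha28 ha29 ht5 ht29 hr α hk hp

/-- Multiplication of the matrices in the arrays `a` and `b`. -/
def mulMat (c a b : ℕ) : Stmt := par c 4 4 3 (sum 13 4 (mul (rd2 a 10 13) (rd2 b 13 11)))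

theorem mat_mulMat (h : Regs n m q σ) {c a b : ℕ} (hca : a ≠ c) (hcb : b ≠ c)
    (α : ℕ → ℕ → ℕ → ℕ → ℝ) : mat (m + m) ((mulMat c a b).den σ α c) =
      mat (m + m) (α a) * mat (m + m) (α b) := by
  rw [mulMat, mat_par_size h h.r4 (by simp [avoids, rd2, hca, hcb]) (by norm_num)]
  ext i j
  simp [eval, rd2, h.r6, h.r4, mat, Matrix.mul_apply, Finset.sum_range]

/-- The constant data of the local search in the arrays. -/
structure Data (A : Fin n → Matrix (Fin (m + m)) (Fin (m + m)) ℝ) (q k : ℕ) (b : ℝ)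
    (x₀ : Fin n → ℝ) (α : ℕ → ℕ → ℕ → ℕ → ℝ) : Prop where
  start : vec n (α 1) = x₀
  matrices : ∀ (a : Fin n) (i j : Fin (m + m)), α 3 a i j = A a i j
  exponent : α 5 0 0 0 = 2 ^ k
  barrier : α 9 0 0 0 = b
  offset : α 10 0 0 0 = n / q * (b⁻¹) ^ 2 ^ k

theorem Data.congr {A : Fin n → Matrix (Fin (m + m)) (Fin (m + m)) ℝ} {k : ℕ} {b : ℝ}
    {x₀ : Fin n → ℝ} {α β : ℕ → ℕ → ℕ → ℕ → ℝ} (hα : Data A q k b x₀ α) (h1 : β 1 = α 1)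
    (h3 : β 3 = α 3) (h5 : β 5 = α 5) (h9 : β 9 = α 9) (h10 : β 10 = α 10) :
    Data A q k b x₀ β :=
  ⟨h1 ▸ hα.start, h3 ▸ hα.matrices, h5 ▸ hα.exponent, h9 ▸ hα.barrier, h10 ▸ hα.offset⟩

variable {A : Fin n → Matrix (Fin (m + m)) (Fin (m + m)) ℝ} {k : ℕ} {b : ℝ} {x₀ x : Fin n → ℝ}
  {α : ℕ → ℕ → ℕ → ℕ → ℝ}

theorem Data.of_keeps (hα : Data A q k b x₀ α) {S : Stmt}
    (hS : (S.keeps 1 && S.keeps 3 && S.keeps 5 && S.keeps 9 && S.keeps 10) = true) :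
    Data A q k b x₀ (S.den σ α) := by
  simp only [Bool.and_eq_true] at hS
  exact hα.congr (den_of_keeps hS.1.1.1.1 _ _) (den_of_keeps hS.1.1.1.2 _ _)
    (den_of_keeps hS.1.1.2 _ _) (den_of_keeps hS.1.2 _ _) (den_of_keeps hS.2 _ _)

/-- The slack matrix, in array `11`. -/
def slackStmt : Stmt :=
  par 11 4 4 3 (sub (ifEq 10 11 (rd0 9) (const 0))
    (sum 13 0 (mul (sub (rd1 4 13) (rd1 1 13)) (read 3 13 10 11))))

theorem mat_slackStmt (h : Regs n m q σ) (hα : Data A q k b x₀ α) :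
    mat (m + m) (slackStmt.den σ α 11) = slack A b x₀ (vec n (α 4)) := by
  rw [slackStmt, mat_par_size h h.r4 (by rfl) (by norm_num)]
  ext i j
  simp only [of_apply, eval, eval_ifEq, rd0, rd1]
  simp only [slack, comb, Matrix.sub_apply, Matrix.smul_apply, Matrix.one_apply,
    Matrix.sum_apply, smul_eq_mul, mul_ite, mul_one, mul_zero, Pi.sub_apply]
  simp only [Function.update_apply, Nat.reduceEqDiff, if_true, if_false, h.r0, h.r6, hα.barrier,
    Finset.sum_range, hα.matrices, Nat.cast_zero, Fin.ext_iff]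
  congr 1
  exact sum_congr rfl fun a _ => by rw [← hα.start]; rfl

/-- The inverse slack matrix, its powers and the potential. -/
def potentialStmt : Stmt :=
  .seq slackStmt (.seq (invert 11 12 4) (.seq (par 13 4 4 3 (rd2 11 10 11))
    (.seq (power 13 12 4) (.seq (par 14 3 3 3 (add (sum 13 4 (rd2 13 13 13)) (rd0 10)))
      (.seq (mulMat 15 13 11) (mulMat 16 15 11))))))

theorem potentialStmt_spec (h : Regs n m q σ) (hα : Data A q k b x₀ α) (hx : vec n (α 4) = x)
    (hk : k ≤ n) (hpd : (slack A b x₀ x).PosDef) {γ : ℕ → ℕ → ℕ → ℕ → ℝ}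
    (hγ : γ = potentialStmt.den σ α) :
    γ 14 0 0 0 = potential A q k b x₀ x ∧
    mat (m + m) (γ 15) = (slack A b x₀ x)⁻¹ ^ (2 ^ k + 1) ∧
    mat (m + m) (γ 16) = (slack A b x₀ x)⁻¹ ^ (2 ^ k + 2) := by
  set α1 := slackStmt.den σ α with hα1
  set α2 := (invert 11 12 4).den σ α1 with hα2
  set α3 := (par 13 4 4 3 (rd2 11 10 11)).den σ α2 with hα3
  set α4 := (power 13 12 4).den σ α3 with hα4
  set α5 := (par 14 3 3 3 (add (sum 13 4 (rd2 13 13 13)) (rd0 10))).den σ α4 with hα5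
  set α6 := (mulMat 15 13 11).den σ α5 with hα6
  have e7 : γ = (mulMat 16 15 11).den σ α6 := hγ
  have m1 : mat (m + m) (α1 11) = slack A b x₀ x := by rw [hα1, mat_slackStmt h hα, hx]
  have m2 : mat (m + m) (α2 11) = (slack A b x₀ x)⁻¹ := by
    rw [hα2, mat_invert_size h h.r4 (by norm_num) (by norm_num) (by rw [m1]; exact hpd), m1]
  have m3 : mat (m + m) (α3 13) = (slack A b x₀ x)⁻¹ := by
    rw [hα3, mat_par_size h h.r4 (by rfl) (by norm_num), ← m2]
    ext i j
    simp [eval, rd2, h.r6, mat]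
  have d3 : Data A q k b x₀ α3 := ((hα.of_keeps (σ := σ) (S := slackStmt) rfl).of_keeps (σ := σ)
    (S := invert 11 12 4) rfl).of_keeps (σ := σ) rfl
  have m4 : mat (m + m) (α4 13) = (slack A b x₀ x)⁻¹ ^ 2 ^ k := by
    rw [hα4, mat_power_size h h.r4 (by norm_num) (by norm_num) (by norm_num) (by norm_num)
      (by norm_num) (by norm_num) (by norm_num) hk d3.exponent, m3]
  have d4 : Data A q k b x₀ α4 := d3.of_keeps rfl
  have f4 : α4 11 = α2 11 := by
    rw [hα4, den_of_keeps (by rfl), hα3, den_of_keeps (by rfl)]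
  have f5 : α5 11 = α2 11 := by rw [hα5, den_of_keeps (by rfl), f4]
  have f5' : α5 13 = α4 13 := by rw [hα5, den_of_keeps (by rfl)]
  have m5 : α5 14 0 0 0 = potential A q k b x₀ x := by
    rw [hα5, scal_par h (by rfl), potential, ← m4, trace]
    simp [eval, rd2, rd0, h.r6, h.r4, mat, Finset.sum_range, d4.offset]
  have m6 : mat (m + m) (α6 15) = (slack A b x₀ x)⁻¹ ^ (2 ^ k + 1) := by
    rw [hα6, mat_mulMat h (by norm_num) (by norm_num), f5, f5', m4, m2, pow_succ]
  have f6 : α6 11 = α2 11 := by rw [hα6, den_of_keeps (by rfl), f5]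
  refine ⟨?_, ?_, ?_⟩
  · rw [e7, den_of_keeps (by rfl), hα6, den_of_keeps (by rfl), m5]
  · rw [e7, den_of_keeps (by rfl), m6]
  · rw [e7, mat_mulMat h (by norm_num) (by norm_num), m6, f6, m2, ← pow_succ]

/-- The mask of the active coordinates, the threshold, and the inverse of the step matrix. -/
def directionsStmt : Stmt :=
  .seq (par 17 0 4 4 (sum 13 4 (mul (rd2 16 11 13) (read 3 10 13 12))))
    (.seq (par 18 0 3 3 (cond (sub (const 0) (const 1)) (rd1 4 10)
        (cond (rd1 4 10) (const 1) (const 1) (const 0)) (const 0)))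
      (.seq (par 19 3 3 3 (div (mul (const 36) (rd0 14)) (mul (rd0 9) (rd0 9))))
        (.seq (par 20 0 0 3 (add (mul (mul (rd1 18 10) (rd1 18 11))
            (sum 13 4 (sum 14 4 (mul (read 17 10 13 14) (read 3 11 14 13)))))
            (ifEq 10 11 (rd0 19) (const 0))))
          (invert 20 12 0))))

/-- The products P A_a are stored once in array 17, so each of the n² traces costs only O(m²). The
threshold 36Φ/b² is (6/b)²Φ. -/
theorem directionsStmt_spec (h : Regs n m q σ) (hα : Data A q k b x₀ α) (hx : vec n (α 4) = x)
    {Φ : ℝ} (hΦ : α 14 0 0 0 = Φ) (hτ : 0 < (6 / b) ^ 2 * Φ) (hA : ∀ i, (A i).IsSymm)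
    {P : Matrix (Fin (m + m)) (Fin (m + m)) ℝ} (hP : mat (m + m) (α 16) = P)
    (hPp : P.PosSemidef) {γ : ℕ → ℕ → ℕ → ℕ → ℝ} (hγ : γ = directionsStmt.den σ α) :
    (∀ i : Fin n, γ 18 i 0 0 = if i ∈ active x then 1 else 0) ∧
    γ 19 0 0 0 = (6 / b) ^ 2 * Φ ∧
    mat n (γ 20) = (stepMatrix A P (active x) ((6 / b) ^ 2 * Φ))⁻¹ := by
  set α1 := (par 17 0 4 4 (sum 13 4 (mul (rd2 16 11 13) (read 3 10 13 12)))).den σ α with hα1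
  set α2 := (par 18 0 3 3 (cond (sub (const 0) (const 1)) (rd1 4 10)
        (cond (rd1 4 10) (const 1) (const 1) (const 0)) (const 0))).den σ α1 with hα2
  set α3 := (par 19 3 3 3 (div (mul (const 36) (rd0 14)) (mul (rd0 9) (rd0 9)))).den σ α2
    with hα3
  set α4 := (par 20 0 0 3 (add (mul (mul (rd1 18 10) (rd1 18 11))
            (sum 13 4 (sum 14 4 (mul (read 17 10 13 14) (read 3 11 14 13)))))
            (ifEq 10 11 (rd0 19) (const 0)))).den σ α3 with hα4
  have e5 : γ = (invert 20 12 0).den σ α4 := hγ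
  have m1 : ∀ (a : Fin n) (i j : Fin (m + m)), α1 17 a i j = (P * A a) i j := fun a i j => by
    rw [hα1, den_par_self (by rfl) (by norm_num) (by norm_num) (by rw [h.r0]; exact a.2)
      (by rw [h.r4]; exact i.2) (by rw [h.r4]; exact j.2), Matrix.mul_apply, ← hP]
    simp only [eval, rd2, Function.update_apply, Nat.reduceEqDiff, if_true, if_false, h.r6, h.r4,
      Finset.sum_range, hα.matrices]
    rfl
  have f14 : α1 4 = α 4 := by rw [hα1, den_of_keeps (by rfl)]
  have m2 : ∀ i : Fin n, α2 18 i 0 0 = if i ∈ active x then 1 else 0 := fun i => by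
    have := congrFun (vec_par h (a := 18) (e := cond (sub (const 0) (const 1)) (rd1 4 10)
        (cond (rd1 4 10) (const 1) (const 1) (const 0)) (const 0)) (by rfl) α1) i
    rw [hα2]
    refine this.trans ?_
    have hxi : α 4 i 0 0 = x i := by rw [← hx]; rfl
    simp only [eval, rd1, Function.update_apply, Nat.reduceEqDiff, if_true, if_false, h.r6, f14,
      hxi, active, mem_filter, mem_univ, true_and]
    norm_num
    by_cases h1 : -1 < x i <;> by_cases h2 : x i < 1 <;> simp [h1, h2]
  have d2 : Data A q k b x₀ α2 := (hα.of_keeps (σ := σ)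
    (S := par 17 0 4 4 (sum 13 4 (mul (rd2 16 11 13) (read 3 10 13 12)))) rfl).of_keeps rfl
  have f214 : α2 14 = α 14 := by
    rw [hα2, den_of_keeps (by rfl), hα1, den_of_keeps (by rfl)]
  have m3 : α3 19 0 0 0 = (6 / b) ^ 2 * Φ := by
    rw [hα3, scal_par h (by rfl)]
    simp [eval, rd0, h.r6, f214, hΦ, d2.barrier]
    ring
  have d3 : Data A q k b x₀ α3 := d2.of_keeps rfl
  have f318 : α3 18 = α2 18 := by rw [hα3, den_of_keeps (by rfl)]
  have f317 : α3 17 = α1 17 := by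
    rw [hα3, den_of_keeps (by rfl), hα2, den_of_keeps (by rfl)]
  have m4 : mat n (α4 20) = stepMatrix A P (active x) ((6 / b) ^ 2 * Φ) := by
    rw [hα4, mat_par_size h h.r0 (by rfl) (by norm_num)]
    ext a c
    simp only [of_apply, eval, eval_ifEq, rd1, rd0, stepMatrix, Function.update_apply,
      Nat.reduceEqDiff, if_true, if_false, h.r6, h.r4, f318, f317, m3]
    rw [m2, m2]
    congr 2
    · rw [← Matrix.mul_assoc, trace, Finset.sum_range]
      refine sum_congr rfl fun i _ => ?_
      rw [diag_apply, Matrix.mul_apply, Finset.sum_range]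
      exact sum_congr rfl fun j _ => by rw [m1, d3.matrices]
    · simp [Fin.ext_iff]
    · exact Nat.cast_zero
  refine ⟨fun i => ?_, ?_, ?_⟩
  · rw [e5, den_of_keeps (by rfl), hα4, den_of_keeps (by rfl), f318, m2]
  · rw [e5, den_of_keeps (by rfl), hα4, den_of_keeps (by rfl), m3]
  · rw [e5, mat_invert_size h h.r0 (by norm_num) (by norm_num)
      (by rw [m4]; exact stepMatrix_posDef hA hPp _ hτ), m4]

/-- The choice of a column of the inverse step matrix: the first admissible one. -/
def chooseStmt : Stmt :=
  .seq (par 21 0 3 3 (cond (mul (mul (mul (const 4) (rd0 19)) (rd2 20 10 10)) (rd1 18 10))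
      (const 1) (const 0) (const 1)))
    (.seq (par 22 0 3 3 (cond (sum 13 10 (rd1 21 13)) (const 1) (rd1 21 10) (const 0)))
      (par 23 0 3 3 (cond (ofIdx 0) (mul (const 2) (sum 13 0 (rd1 18 13)))
        (mul (mul (div (const 1) (sqrt (ofIdx 0))) (rd0 19))
          (sum 13 0 (mul (rd1 22 13) (rd2 20 10 13)))) (const 0))))

/-- No real can be converted to an index, so the column is extracted by multiplying with the
indicator of the first admissible index. Once at most half of the coordinates are active the
displacement is 0, which makes later rounds idle. -/
theorem chooseStmt_spec (h : Regs n m q σ) {act : Finset (Fin n)} {τ : ℝ}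
    {S : Matrix (Fin n) (Fin n) ℝ} (hmask : ∀ i : Fin n, α 18 i 0 0 = if i ∈ act then 1 else 0)
    (hτ : α 19 0 0 0 = τ) (hS : mat n (α 20) = S) {γ : ℕ → ℕ → ℕ → ℕ → ℝ}
    (hγ : γ = chooseStmt.den σ α) :
    (¬ n < 2 * act.card → vec n (γ 23) = 0) ∧
    (n < 2 * act.card → (∃ i ∈ act, 1 ≤ 4 * τ * S i i) → ∃ i ∈ act, 1 ≤ 4 * τ * S i i ∧
      vec n (γ 23) = fun a => 1 / √(n : ℝ) * τ * S a i) := by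
  set α1 := (par 21 0 3 3 (cond (mul (mul (mul (const 4) (rd0 19)) (rd2 20 10 10)) (rd1 18 10))
      (const 1) (const 0) (const 1))).den σ α with hα1
  set α2 := (par 22 0 3 3 (cond (sum 13 10 (rd1 21 13)) (const 1) (rd1 21 10) (const 0))).den σ α1
    with hα2
  have e3 : γ = (par 23 0 3 3 (cond (ofIdx 0) (mul (const 2) (sum 13 0 (rd1 18 13)))
        (mul (mul (div (const 1) (sqrt (ofIdx 0))) (rd0 19))
          (sum 13 0 (mul (rd1 22 13) (rd2 20 10 13)))) (const 0))).den σ α2 := hγ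
  have hSe : ∀ i j : Fin n, α 20 i j 0 = S i j := fun i j => by rw [← hS]; rfl
  have m1 : ∀ i : Fin n, α1 21 i 0 0 = if i ∈ act ∧ 1 ≤ 4 * τ * S i i then 1 else 0 := fun i => by
    rw [hα1]
    refine (congrFun (vec_par h (a := 21) (by rfl) α) i).trans ?_
    simp only [eval, rd1, rd2, rd0, Function.update_apply, Nat.reduceEqDiff, if_true, if_false,
      h.r6, hτ, hSe, hmask]
    by_cases hi : i ∈ act
    · by_cases h2 : 1 ≤ 4 * τ * S i i
      · simp [hi, h2]
      · simp [hi, h2, not_le.1 h2]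
    · simp [hi]
  have m2 : ∀ i : Fin n, α2 22 i 0 0 =
      if (∑ u ∈ range i, α1 21 u 0 0) < 1 then α1 21 i 0 0 else 0 := fun i => by
    rw [hα2]
    refine (congrFun (vec_par h (a := 22) (by rfl) α1) i).trans ?_
    simp [eval, rd1, h.r6]
  have f1 : α2 18 = α 18 := by
    rw [hα2, den_of_keeps (by rfl), hα1, den_of_keeps (by rfl)]
  have f2 : α2 19 = α 19 := by
    rw [hα2, den_of_keeps (by rfl), hα1, den_of_keeps (by rfl)]
  have f3 : α2 20 = α 20 := by
    rw [hα2, den_of_keeps (by rfl), hα1, den_of_keeps (by rfl)]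
  have m3 : ∀ a : Fin n, vec n (γ 23) a = if n < 2 * act.card then
      1 / √(n : ℝ) * τ * ∑ i : Fin n, α2 22 i 0 0 * S a i else 0 := fun a => by
    rw [e3]
    refine (congrFun (vec_par h (a := 23) (by rfl) α2) a).trans ?_
    simp only [eval, rd1, rd2, rd0, Function.update_apply, Nat.reduceEqDiff, if_true, if_false,
      h.r6, h.r0, Finset.sum_range, f1, f2, f3, hτ, hSe, hmask]
    have : ((n : ℝ) < (2 : ℕ) * ∑ i : Fin n, if i ∈ act then (1 : ℝ) else 0) ↔
        n < 2 * act.card := by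
      rw [sum_ite_mem, univ_inter, sum_const, nsmul_eq_mul, mul_one]
      exact_mod_cast Iff.rfl
    simp only [this]
    simp
  refine ⟨fun hn => ?_, fun hn hex => ?_⟩
  · funext a
    rw [m3, if_neg hn]; rfl
  · classical
    have hne : (univ.filter fun i : Fin n => i ∈ act ∧ 1 ≤ 4 * τ * S i i).Nonempty := by
      obtain ⟨i, hi, hi'⟩ := hex
      exact ⟨i, by simp [hi, hi']⟩
    set i₀ := (univ.filter fun i : Fin n => i ∈ act ∧ 1 ≤ 4 * τ * S i i).min' hne with hi₀
    have hi₀m : i₀ ∈ act ∧ 1 ≤ 4 * τ * S i₀ i₀ := by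
      have := min'_mem _ hne
      simpa [← hi₀] using this
    have hmin : ∀ j : Fin n, j ∈ act ∧ 1 ≤ 4 * τ * S j j → i₀ ≤ j := fun j hj =>
      min'_le _ _ (by simpa using hj)
    refine ⟨i₀, hi₀m.1, hi₀m.2, ?_⟩
    have hc0 : ∀ u : ℕ, u < n → 0 ≤ α1 21 u 0 0 := fun u hu => by
      have := m1 ⟨u, hu⟩
      simp only at this
      rw [this]
      split_ifs <;> norm_num
    -- The sum of the admissibility flags before i is below 1 exactly when none of them is set.
    have hf : ∀ i : Fin n, α2 22 i 0 0 = if i = i₀ then 1 else 0 := fun i => by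
      rw [m2]
      rcases lt_trichotomy i i₀ with hlt | heq | hgt
      · have : α1 21 i 0 0 = 0 := by
          rw [m1, if_neg fun hc => absurd (hmin i hc) (not_le.2 hlt)]
        simp [this, hlt.ne]
      · rw [heq]
        have hs : ∑ u ∈ range (i₀ : ℕ), α1 21 u 0 0 = 0 := sum_eq_zero fun u hu => by
          have hun : u < n := (mem_range.1 hu).trans i₀.2
          have := m1 ⟨u, hun⟩
          simp only at this
          rw [this, if_neg fun hc => absurd (hmin _ hc) (not_le.2 (mem_range.1 hu))]
        rw [hs, m1, if_pos (by norm_num), if_pos hi₀m, if_pos rfl]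
      · have hs : 1 ≤ ∑ u ∈ range (i : ℕ), α1 21 u 0 0 := by
          have h1 : α1 21 i₀ 0 0 = 1 := by rw [m1, if_pos hi₀m]
          rw [← h1]
          exact single_le_sum (f := fun u => α1 21 u 0 0)
            (fun u hu => hc0 u ((mem_range.1 hu).trans i.2)) (mem_range.2 hgt)
        rw [if_neg (not_lt.2 hs), if_neg hgt.ne']
    funext a
    rw [m3, if_pos hn]
    simp [hf]

end ArrayLang

/-! ### One round of the search: sign, step length; the whole search -/

namespace ArrayLang
open Matrix Finset MatrixDiscrepancy
open ArrayLang.Expr ArrayLang.Stmt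

variable {n m q : ℕ} {σ : ℕ → ℕ} {A : Fin n → Matrix (Fin (m + m)) (Fin (m + m)) ℝ} {k : ℕ}
  {b : ℝ} {x₀ x : Fin n → ℝ} {α : ℕ → ℕ → ℕ → ℕ → ℝ}

/-- The choice of the sign of the displacement. -/
def signStmt : Stmt :=
  .seq (par 24 3 3 3 (sum 13 0 (mul (rd1 23 13)
      (sub (sum 14 4 (sum 15 4 (mul (rd2 15 14 15) (read 3 13 15 14))))
        (mul (mul (div (const 2) (ofIdx 0)) (rd0 14)) (rd1 4 13))))))
    (par 25 0 3 3 (cond (const 0) (rd0 24) (sub (const 0) (rd1 23 10)) (rd1 23 10)))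

/-- The difference of the two sides is linear in the displacement, so one of the two signs makes it
nonpositive. -/
theorem signStmt_spec (h : Regs n m q σ) (hα : Data A q k b x₀ α) (hx : vec n (α 4) = x)
    {Φ : ℝ} (hΦ : α 14 0 0 0 = Φ) {P : Matrix (Fin (m + m)) (Fin (m + m)) ℝ}
    (hP : mat (m + m) (α 15) = P) {y : Fin n → ℝ} (hy : vec n (α 23) = y)
    {γ : ℕ → ℕ → ℕ → ℕ → ℝ} (hγ : γ = signStmt.den σ α) :
    ∃ ε : ℝ, ε ^ 2 = 1 ∧ vec n (γ 25) = ε • y ∧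
      (P * comb A (ε • y)).trace ≤ 2 / n * Φ * (x ⬝ᵥ (ε • y)) := by
  set e1 := sum 13 0 (mul (rd1 23 13)
      (sub (sum 14 4 (sum 15 4 (mul (rd2 15 14 15) (read 3 13 15 14))))
        (mul (mul (div (const 2) (ofIdx 0)) (rd0 14)) (rd1 4 13)))) with he1
  set α1 := (par 24 3 3 3 e1).den σ α with hα1
  have e2 : γ = (par 25 0 3 3 (cond (const 0) (rd0 24) (sub (const 0) (rd1 23 10))
    (rd1 23 10))).den σ α1 := hγ
  have hxa : ∀ a : Fin n, α 4 a 0 0 = x a := fun a => by rw [← hx]; rfl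
  have hya : ∀ a : Fin n, α 23 a 0 0 = y a := fun a => by rw [← hy]; rfl
  have hPe : ∀ i j : Fin (m + m), α 15 i j 0 = P i j := fun i j => by rw [← hP]; rfl
  have m1 : α1 24 0 0 0 = (P * comb A y).trace - 2 / n * Φ * (x ⬝ᵥ y) := by
    rw [hα1, scal_par h (by rfl), he1]
    simp only [eval, rd0, rd1, rd2, Function.update_apply, Nat.reduceEqDiff, if_true, if_false,
      h.r6, h.r0, h.r4, Finset.sum_range, hΦ, hxa, hya, hPe, hα.matrices]
    have t1 : (P * comb A y).trace = ∑ a, y a * ∑ i, ∑ j, P i j * A a j i := by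
      simp only [comb, Matrix.mul_sum, trace_sum, Matrix.mul_smul, trace_smul, smul_eq_mul]
      exact sum_congr rfl fun a _ => by
        simp only [trace, diag_apply, Matrix.mul_apply]
    rw [t1, dotProduct, mul_sum, ← sum_sub_distrib]
    refine sum_congr rfl fun a _ => ?_
    push_cast
    ring
  have f1 : α1 23 = α 23 := by rw [hα1, den_of_keeps (by rfl)]
  have m2 : ∀ a : Fin n, vec n (γ 25) a = if 0 < α1 24 0 0 0 then -y a else y a := fun a => by
    rw [e2]
    refine (congrFun (vec_par h (a := 25) (by rfl) α1) a).trans ?_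
    simp only [eval, rd0, rd1, Function.update_apply, Nat.reduceEqDiff, if_true, if_false,
      h.r6, f1, hya]
    simp
  by_cases hc : 0 < α1 24 0 0 0
  · refine ⟨-1, by norm_num, ?_, ?_⟩
    · funext a
      rw [m2, if_pos hc]; simp
    · rw [m1] at hc
      rw [comb_smul, Matrix.mul_smul, trace_smul, dotProduct_smul, smul_eq_mul, smul_eq_mul]
      linarith
  · refine ⟨1, by norm_num, ?_, ?_⟩
    · funext a
      rw [m2, if_neg hc]; simp
    · rw [m1] at hc
      rw [one_smul]
      linarith

/-- The largest admissible step along the direction in array `25`. -/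
def moveStmt : Stmt :=
  .seq (par 26 0 3 3 (cond (const 0) (rd1 25 10) (div (sub (const 1) (rd1 4 10)) (rd1 25 10))
      (cond (rd1 25 10) (const 0)
        (div (sub (sub (const 0) (const 1)) (rd1 4 10)) (rd1 25 10)) (const 1))))
    (.seq (par 27 3 3 3 (const 1))
      (.seq (.loop 20 0 (.seq (par 28 3 3 3 (cond (rd1 26 20) (rd0 27) (rd1 26 20) (rd0 27)))
          (par 27 3 3 3 (rd0 28))))
        (.seq (par 28 0 3 3 (add (rd1 4 10) (mul (rd0 27) (rd1 25 10))))
          (par 4 0 3 3 (rd1 28 10)))))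

theorem min_loop (h : Regs n m q σ) (hα : α 27 0 0 0 = 1) {γ : ℕ → ℕ → ℕ → ℕ → ℝ}
    (hγ : γ = (Stmt.loop 20 0 (.seq (par 28 3 3 3 (cond (rd1 26 20) (rd0 27) (rd1 26 20) (rd0 27)))
      (par 27 3 3 3 (rd0 28)))).den σ α) :
    γ 27 0 0 0 ≤ 1 ∧ (∀ a : Fin n, γ 27 0 0 0 ≤ α 26 a 0 0) ∧
      (γ 27 0 0 0 = 1 ∨ ∃ a : Fin n, γ 27 0 0 0 = α 26 a 0 0) := by
  set f : ℕ → ℕ → ℕ → ℕ → ℕ → ℝ := fun v => Nat.rec α (fun v β =>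
    (Stmt.seq (par 28 3 3 3 (cond (rd1 26 20) (rd0 27) (rd1 26 20) (rd0 27)))
      (par 27 3 3 3 (rd0 28))).den (Function.update σ 20 v) β) v with hf
  have key : ∀ v, v ≤ n → f v 26 = α 26 ∧ f v 27 0 0 0 ≤ 1 ∧
      (∀ a < v, f v 27 0 0 0 ≤ α 26 a 0 0) ∧
      (f v 27 0 0 0 = 1 ∨ ∃ a < v, f v 27 0 0 0 = α 26 a 0 0) := by
    intro v
    induction v with
    | zero => exact fun _ => ⟨rfl, hα.le, by simp, .inl hα⟩
    | succ v ih =>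
      intro hv
      obtain ⟨h1, h2, h3, h4⟩ := ih (by omega)
      have hR := h.update (r := 20) (by norm_num) v
      have hs : f (v + 1) = (par 27 3 3 3 (rd0 28)).den (Function.update σ 20 v)
        ((par 28 3 3 3 (cond (rd1 26 20) (rd0 27) (rd1 26 20) (rd0 27))).den
          (Function.update σ 20 v) (f v)) := rfl
      have e26 : f (v + 1) 26 = α 26 := by
        rw [hs, den_of_keeps (by rfl), den_of_keeps (by rfl), h1]
      have e27 : f (v + 1) 27 0 0 0 = min (α 26 v 0 0) (f v 27 0 0 0) := by
        rw [hs, scal_par hR (by rfl)]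
        have : (rd0 28).eval (Function.update (Function.update (Function.update
            (Function.update σ 20 v) 10 0) 11 0) 12 0) = fun β => β 28 0 0 0 := by
          funext β; simp [rd0, eval, h.r6]
        rw [this]
        simp only
        rw [scal_par hR (by rfl)]
        simp only [eval, rd0, rd1, Function.update_apply, Nat.reduceEqDiff, if_true, if_false,
          h.r6, h1]
        rcases lt_or_ge (α 26 v 0 0) (f v 27 0 0 0) with hlt | hge
        · rw [if_pos hlt, min_eq_left hlt.le]
        · rw [if_neg (not_lt.2 hge), min_eq_right hge]
      refine ⟨e26, ?_, fun a ha => ?_, ?_⟩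
      · rw [e27]; exact (min_le_right _ _).trans h2
      · rw [e27]
        rcases Nat.lt_succ_iff_lt_or_eq.1 ha with ha' | rfl
        · exact (min_le_right _ _).trans (h3 a ha')
        · exact min_le_left _ _
      · rw [e27]
        rcases le_total (α 26 v 0 0) (f v 27 0 0 0) with hle | hle
        · exact .inr ⟨v, by omega, min_eq_left hle⟩
        · rw [min_eq_right hle]
          rcases h4 with h4 | ⟨a, ha, h4⟩
          · exact .inl h4
          · exact .inr ⟨a, by omega, h4⟩
  have hγf : γ = f n := by rw [hγ, den_loop, h.r0]
  obtain ⟨-, h2, h3, h4⟩ := key n le_rfl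
  rw [← hγf] at h2 h3 h4
  refine ⟨h2, fun a => h3 a a.2, h4.imp id ?_⟩
  rintro ⟨a, ha, h5⟩
  exact ⟨⟨a, ha⟩, h5⟩

/-- Array 26 holds, for each coordinate, the step at which it would hit the face of the cube it is
heading for, with the default 1 for coordinates that do not move. The minimum of these and 1 is the
step; if it is below 1, it is attained at a moving coordinate, which lands on ±1. -/
theorem moveStmt_spec (h : Regs n m q σ) (hx : vec n (α 4) = x)
    (hmem : ∀ a, -1 ≤ x a ∧ x a ≤ 1) {z : Fin n → ℝ} (hz : vec n (α 25) = z)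
    {γ : ℕ → ℕ → ℕ → ℕ → ℝ} (hγ : γ = moveStmt.den σ α) :
    ∃ s : ℝ, 0 ≤ s ∧ s ≤ 1 ∧ vec n (γ 4) = x + s • z ∧
      (∀ a, -1 ≤ x a + s * z a ∧ x a + s * z a ≤ 1) ∧
      (s = 1 ∨ ∃ a, z a ≠ 0 ∧ (x a + s * z a = 1 ∨ x a + s * z a = -1)) := by
  set e1 := cond (const 0) (rd1 25 10) (div (sub (const 1) (rd1 4 10)) (rd1 25 10))
      (cond (rd1 25 10) (const 0)
        (div (sub (sub (const 0) (const 1)) (rd1 4 10)) (rd1 25 10)) (const 1)) with he1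
  set α1 := (par 26 0 3 3 e1).den σ α with hα1
  set α2 := (par 27 3 3 3 (const 1)).den σ α1 with hα2
  set α3 := (Stmt.loop 20 0 (.seq (par 28 3 3 3 (cond (rd1 26 20) (rd0 27) (rd1 26 20) (rd0 27)))
      (par 27 3 3 3 (rd0 28)))).den σ α2 with hα3
  set α4 := (par 28 0 3 3 (add (rd1 4 10) (mul (rd0 27) (rd1 25 10)))).den σ α3 with hα4
  have e5 : γ = (par 4 0 3 3 (rd1 28 10)).den σ α4 := hγ
  have hxa : ∀ a : Fin n, α 4 a 0 0 = x a := fun a => by rw [← hx]; rfl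
  have hza : ∀ a : Fin n, α 25 a 0 0 = z a := fun a => by rw [← hz]; rfl
  have m1 : ∀ a : Fin n, α1 26 a 0 0 = if 0 < z a then (1 - x a) / z a else
      if z a < 0 then (-1 - x a) / z a else 1 := fun a => by
    rw [hα1]
    refine (congrFun (vec_par h (a := 26) (by rfl) α) a).trans ?_
    rw [he1]
    simp only [eval, rd1, Function.update_apply, Nat.reduceEqDiff, if_true, if_false,
      h.r6, hxa, hza]
    norm_num
  have f26 : α2 26 = α1 26 := by rw [hα2, den_of_keeps (by rfl)]
  have f4 : α3 4 = α 4 := by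
    rw [hα3, den_of_keeps (by rfl), hα2, den_of_keeps (by rfl), hα1, den_of_keeps (by rfl)]
  have f25 : α3 25 = α 25 := by
    rw [hα3, den_of_keeps (by rfl), hα2, den_of_keeps (by rfl), hα1, den_of_keeps (by rfl)]
  have m2 : α2 27 0 0 0 = 1 := by
    rw [hα2, scal_par h (by rfl)]; simp [eval]
  obtain ⟨hs1, hsr, hst⟩ := min_loop h m2 hα3
  rw [f26] at hsr hst
  set s := α3 27 0 0 0 with hs
  have m4 : vec n (γ 4) = x + s • z := by
    funext a
    rw [e5]
    refine (congrFun (vec_par h (a := 4) (by rfl) α4) a).trans ?_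
    have : (rd1 28 10).eval (Function.update (Function.update (Function.update σ 10 (a : ℕ)) 11 0)
        12 0) α4 = vec n (α4 28) a := by simp [rd1, eval, h.r6, vec]
    rw [this, hα4]
    refine (congrFun (vec_par h (a := 28) (by rfl) α3) a).trans ?_
    simp only [eval, rd0, rd1, Function.update_apply, Nat.reduceEqDiff, if_true, if_false,
      h.r6, f4, f25, hxa, hza]
    rfl
  have hr0 : ∀ a : Fin n, 0 ≤ α1 26 a 0 0 := fun a => by
    rw [m1]
    split_ifs with hp hn
    · exact div_nonneg (by linarith [hmem a]) hp.le
    · exact div_nonneg_of_nonpos (by linarith [hmem a]) hn.le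
    · norm_num
  have hs0 : 0 ≤ s := by
    rcases hst with h1 | ⟨a, h1⟩
    · rw [h1]; norm_num
    · rw [h1]; exact hr0 a
  refine ⟨s, hs0, hs1, m4, fun a => ?_, ?_⟩
  · have h1 := hsr a
    rw [m1] at h1
    obtain ⟨h2, h3⟩ := hmem a
    rcases lt_trichotomy (z a) 0 with hn | h0 | hp
    · rw [if_neg hn.not_gt, if_pos hn, le_div_iff_of_neg hn] at h1
      exact ⟨by linarith, by nlinarith⟩
    · rw [h0]; exact ⟨by linarith, by linarith⟩
    · rw [if_pos hp, le_div_iff₀ hp] at h1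
      exact ⟨by nlinarith, by linarith⟩
  · rcases hst with h1 | ⟨a, h1⟩
    · exact .inl h1
    · rw [m1] at h1
      rcases lt_trichotomy (z a) 0 with hn | h0 | hp
      · rw [if_neg hn.not_gt, if_pos hn, eq_div_iff hn.ne] at h1
        exact .inr ⟨a, hn.ne, .inr (by linarith)⟩
      · left
        simpa [h0] using h1
      · rw [if_pos hp, eq_div_iff hp.ne'] at h1
        exact .inr ⟨a, hp.ne', .inl (by linarith)⟩

/-- One step of the local search. -/
def stepStmt : Stmt :=
  .seq potentialStmt (.seq directionsStmt (.seq chooseStmt (.seq signStmt moveStmt)))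

theorem stepStmt_spec (h : Regs n m q σ) (hS : Setup A q k b) (hα : Data A q k b x₀ α)
    (hI : Invariant A q k b x₀ (vec n (α 4))) {γ : ℕ → ℕ → ℕ → ℕ → ℝ}
    (hγ : γ = stepStmt.den σ α) :
    Data A q k b x₀ γ ∧ Invariant A q k b x₀ (vec n (γ 4)) ∧
      (¬ n < 2 * (active (vec n (α 4))).card → vec n (γ 4) = vec n (α 4)) ∧
      (n < 2 * (active (vec n (α 4))).card → progress A q k b x₀ (vec n (α 4)) + 1 ≤
        progress A q k b x₀ (vec n (γ 4))) := by
  have hn : (0 : ℝ) < n := by exact_mod_cast hS.n_pos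
  have hb := hS.b_pos
  set x := vec n (α 4) with hx
  have hΦ := potential_pos hS hI.posDef
  have hk : k ≤ n := (Nat.lt_two_pow_self.le).trans hS.exponent_le
  set α1 := potentialStmt.den σ α with hα1
  set α2 := directionsStmt.den σ α1 with hα2
  set α3 := chooseStmt.den σ α2 with hα3
  set α4 := signStmt.den σ α3 with hα4
  have e5 : γ = moveStmt.den σ α4 := hγ
  have d1 : Data A q k b x₀ α1 := hα.of_keeps (by rfl)
  have d2 : Data A q k b x₀ α2 := d1.of_keeps (by rfl)
  have d3 : Data A q k b x₀ α3 := d2.of_keeps (by rfl)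
  have d4 : Data A q k b x₀ α4 := d3.of_keeps (by rfl)
  have d5 : Data A q k b x₀ γ := e5 ▸ d4.of_keeps (by rfl)
  obtain ⟨p1, p2, p3⟩ := potentialStmt_spec h hα hx.symm hk hI.posDef hα1
  have x1 : vec n (α1 4) = x := by rw [hα1, den_of_keeps (by rfl)]
  obtain ⟨g1, g2, g3⟩ := directionsStmt_spec h d1 x1 p1 (by positivity) hS.symm p3
    (hI.posDef.inv.posSemidef.pow _) hα2
  obtain ⟨c1, c2⟩ := chooseStmt_spec h g1 g2 g3 hα3
  have x3 : vec n (α3 4) = x := by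
    rw [hα3, den_of_keeps (by rfl), hα2, den_of_keeps (by rfl), x1]
  have p3' : α3 14 0 0 0 = potential A q k b x₀ x := by
    rw [hα3, den_of_keeps (by rfl), hα2, den_of_keeps (by rfl), p1]
  have q3 : mat (m + m) (α3 15) = (slack A b x₀ x)⁻¹ ^ (2 ^ k + 1) := by
    rw [hα3, den_of_keeps (by rfl), hα2, den_of_keeps (by rfl), p2]
  obtain ⟨ε, hε, hz, hlin⟩ := signStmt_spec h d3 x3 p3' q3 rfl hα4
  have x4 : vec n (α4 4) = x := by rw [hα4, den_of_keeps (by rfl), x3]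
  obtain ⟨s, hs0, hs1, hs, hmem, hfrozen⟩ := moveStmt_spec h x4 hI.mem hz e5
  by_cases hact : n < 2 * (active x).card
  · have hex := exists_small_direction hS.q_pos hS.q_dvd hS.symm hS.block hS.contract hI.posDef
      (slack_block hS x) (θ := 6 / b) (p := 2 ^ k) (by positivity) hΦ
      (by
        have : 0 ≤ (n : ℝ) / q * (b⁻¹) ^ 2 ^ k := by positivity
        unfold potential
        linarith) (small_potential hS hI) hact
    obtain ⟨i, hi, hi4, hy⟩ := c2 hact hex
    have := progress_step hS hI hi rfl rfl hi4 (z := ε • vec n (α3 23))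
      (δ := ε * (1 / √(n : ℝ))) (by
        rw [mul_pow, hε, div_pow, Real.sq_sqrt hn.le]; ring)
      (by rw [hy]; funext a; simp only [Pi.smul_apply, smul_eq_mul]; ring)
      hlin hs0 hs1 hmem hfrozen
    rw [hs]
    exact ⟨d5, this.1, fun hc => absurd hact hc, fun _ => this.2⟩
  · have : vec n (γ 4) = x := by
      rw [hs, c1 hact]; simp
    rw [this]
    exact ⟨d5, hI, fun _ => rfl, fun hc => absurd hc hact⟩

/-- The local search: `64 n ^ 2` steps. -/
def searchStmt : Stmt := .loop 21 5 (.loop 22 0 stepStmt)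

/-- Progress is claimed only while more than half of the coordinates are active; afterwards the
point stands still, so that state persists. The 64n² rounds are two nested loops because indices
cannot be multiplied. -/
theorem inner_loop (h : Regs n m q σ) (hS : Setup A q k b) (hα : Data A q k b x₀ α)
    (hI : Invariant A q k b x₀ (vec n (α 4))) {c : ℝ}
    (hc : n < 2 * (active (vec n (α 4))).card → c ≤ progress A q k b x₀ (vec n (α 4)))
    {γ : ℕ → ℕ → ℕ → ℕ → ℝ} (hγ : γ = (Stmt.loop 22 0 stepStmt).den σ α) :
    Data A q k b x₀ γ ∧ Invariant A q k b x₀ (vec n (γ 4)) ∧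
      (n < 2 * (active (vec n (γ 4))).card → c + n ≤ progress A q k b x₀ (vec n (γ 4))) := by
  set f : ℕ → ℕ → ℕ → ℕ → ℕ → ℝ := fun v => Nat.rec α (fun v β =>
    stepStmt.den (Function.update σ 22 v) β) v with hf
  have key : ∀ v : ℕ, Data A q k b x₀ (f v) ∧ Invariant A q k b x₀ (vec n (f v 4)) ∧
      (n < 2 * (active (vec n (f v 4))).card → c + v ≤ progress A q k b x₀ (vec n (f v 4))) := by
    intro v
    induction v with
    | zero => exact ⟨hα, hI, fun hn => by rw [Nat.cast_zero, add_zero]; exact hc hn⟩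
    | succ v ih =>
      obtain ⟨h1, h2, h3⟩ := ih
      obtain ⟨g1, g2, g3, g4⟩ := stepStmt_spec (h.update (r := 22) (by norm_num) v) hS h1 h2
        (γ := f (v + 1)) rfl
      refine ⟨g1, g2, fun hn => ?_⟩
      by_cases hact : n < 2 * (active (vec n (f v 4))).card
      · have := g4 hact
        have := h3 hact
        push_cast
        linarith
      · rw [g3 hact] at hn
        exact absurd hn hact
  have := key n
  have hγf : γ = f n := by rw [hγ, den_loop, h.r0]
  rwa [hγf]

/-- Otherwise every round would have made a unit of progress, and 64n² exceeds the cap 32n² + n. -/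
theorem searchStmt_spec (h : Regs n m q σ) (hS : Setup A q k b) (hα : Data A q k b x₀ α)
    (hx : vec n (α 4) = x₀) (hx₀ : ∀ i, -1 ≤ x₀ i ∧ x₀ i ≤ 1)
    {γ : ℕ → ℕ → ℕ → ℕ → ℝ} (hγ : γ = searchStmt.den σ α) :
    Invariant A q k b x₀ (vec n (γ 4)) ∧ 2 * (active (vec n (γ 4))).card ≤ n := by
  set f : ℕ → ℕ → ℕ → ℕ → ℕ → ℝ := fun v => Nat.rec α (fun v β =>
    (Stmt.loop 22 0 stepStmt).den (Function.update σ 21 v) β) v with hf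
  have key : ∀ v : ℕ, Data A q k b x₀ (f v) ∧ Invariant A q k b x₀ (vec n (f v 4)) ∧
      (n < 2 * (active (vec n (f v 4))).card →
        v * n ≤ progress A q k b x₀ (vec n (f v 4))) := by
    intro v
    induction v with
    | zero =>
      refine ⟨hα, ?_, fun _ => ?_⟩
      · change Invariant A q k b x₀ (vec n (α 4))
        rw [hx]; exact Invariant.self hS hx₀
      · change _ ≤ progress A q k b x₀ (vec n (α 4))
        rw [hx]; simpa using progress_self_nonneg hS
    | succ v ih =>
      obtain ⟨h1, h2, h3⟩ := ih
      obtain ⟨g1, g2, g3⟩ := inner_loop (h.update (r := 21) (by norm_num) v) hS h1 h2 h3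
        (γ := f (v + 1)) rfl
      refine ⟨g1, g2, fun hn => ?_⟩
      have := g3 hn
      push_cast
      linarith
  obtain ⟨-, h2, h3⟩ := key (64 * n)
  have hγf : γ = f (64 * n) := by rw [hγ, searchStmt, den_loop, h.r5]
  rw [hγf]
  refine ⟨h2, ?_⟩
  by_contra hcon
  have h4 := h3 (by omega)
  have h5 := progress_le hS h2
  have hn : (1 : ℝ) ≤ n := by exact_mod_cast hS.n_pos
  push_cast at h4
  nlinarith

end ArrayLang

namespace MatrixDiscrepancy
open Matrix Finset

/-! ### Doubling the matrices, operator norms, and the constants -/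

section Double

variable {n m q : ℕ}

/-- The block matrix `diag(B, -B)`. -/
def double (B : Matrix (Fin m) (Fin m) ℝ) : Matrix (Fin (m + m)) (Fin (m + m)) ℝ :=
  (fromBlocks B 0 0 (-B)).submatrix finSumFinEquiv.symm finSumFinEquiv.symm

@[simp] theorem double_castAdd_castAdd (B : Matrix (Fin m) (Fin m) ℝ) (i j : Fin m) :
    double B (Fin.castAdd m i) (Fin.castAdd m j) = B i j := by simp [double, -Fin.natAdd_eq_addNat]

@[simp] theorem double_castAdd_natAdd (B : Matrix (Fin m) (Fin m) ℝ) (i j : Fin m) :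
    double B (Fin.castAdd m i) (Fin.natAdd m j) = 0 := by simp [double, -Fin.natAdd_eq_addNat]

@[simp] theorem double_natAdd_castAdd (B : Matrix (Fin m) (Fin m) ℝ) (i j : Fin m) :
    double B (Fin.natAdd m i) (Fin.castAdd m j) = 0 := by simp [double, -Fin.natAdd_eq_addNat]

@[simp] theorem double_natAdd_natAdd (B : Matrix (Fin m) (Fin m) ℝ) (i j : Fin m) :
    double B (Fin.natAdd m i) (Fin.natAdd m j) = -B i j := by simp [double, -Fin.natAdd_eq_addNat]

theorem double_isSymm {B : Matrix (Fin m) (Fin m) ℝ} (hB : B.IsSymm) : (double B).IsSymm := by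
  rw [IsSymm, double, transpose_submatrix, fromBlocks_transpose, transpose_neg, hB.eq]
  simp

theorem double_trace (B : Matrix (Fin m) (Fin m) ℝ) : (double B).trace = 0 := by
  simp [trace, Fin.sum_univ_add, -Fin.natAdd_eq_addNat]

theorem double_mulVec_castAdd (B : Matrix (Fin m) (Fin m) ℝ) (w : Fin (m + m) → ℝ) (i : Fin m) :
    (double B *ᵥ w) (Fin.castAdd m i) = (B *ᵥ fun j => w (Fin.castAdd m j)) i := by
  simp [mulVec, dotProduct, Fin.sum_univ_add, -Fin.natAdd_eq_addNat]

theorem double_mulVec_natAdd (B : Matrix (Fin m) (Fin m) ℝ) (w : Fin (m + m) → ℝ) (i : Fin m) :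
    (double B *ᵥ w) (Fin.natAdd m i) = -(B *ᵥ fun j => w (Fin.natAdd m j)) i := by
  simp [mulVec, dotProduct, Fin.sum_univ_add, -Fin.natAdd_eq_addNat]

theorem dotProduct_eq_add (v w : Fin (m + m) → ℝ) : v ⬝ᵥ w =
    (fun j => v (Fin.castAdd m j)) ⬝ᵥ (fun j => w (Fin.castAdd m j)) +
    (fun j => v (Fin.natAdd m j)) ⬝ᵥ (fun j => w (Fin.natAdd m j)) := by
  simp [dotProduct, Fin.sum_univ_add, -Fin.natAdd_eq_addNat]

theorem double_contract {B : Matrix (Fin m) (Fin m) ℝ}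
    (hB : ∀ w : Fin m → ℝ, (B *ᵥ w) ⬝ᵥ (B *ᵥ w) ≤ w ⬝ᵥ w) (w : Fin (m + m) → ℝ) :
    (double B *ᵥ w) ⬝ᵥ (double B *ᵥ w) ≤ w ⬝ᵥ w := by
  rw [dotProduct_eq_add, dotProduct_eq_add w w]
  simp only [double_mulVec_castAdd, double_mulVec_natAdd]
  refine add_le_add (hB _) ?_
  have := hB fun j => w (Fin.natAdd m j)
  simpa [dotProduct] using this

/-- Since q divides m, the blocks of the second copy are again aligned to multiples of q. -/
theorem double_block {B : Matrix (Fin m) (Fin m) ℝ} (hq : 0 < q) (hqm : q ∣ m)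
    (hB : ∀ i j : Fin m, (i : ℕ) / q ≠ (j : ℕ) / q → B i j = 0) (i j : Fin (m + m))
    (hij : (i : ℕ) / q ≠ (j : ℕ) / q) : double B i j = 0 := by
  obtain ⟨c, rfl⟩ := hqm
  induction i using Fin.addCases with
  | left i =>
    induction j using Fin.addCases with
    | left j =>
      rw [double_castAdd_castAdd]
      exact hB i j (by simpa using hij)
    | right j => exact double_castAdd_natAdd _ _ _
  | right i =>
    induction j using Fin.addCases with
    | left j => exact double_natAdd_castAdd _ _ _
    | right j =>
      rw [double_natAdd_natAdd, neg_eq_zero]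
      refine hB i j fun e => hij ?_
      rw [Fin.val_natAdd, Fin.val_natAdd, Nat.mul_add_div hq, Nat.mul_add_div hq, e]

theorem double_comb (A : Fin n → Matrix (Fin m) (Fin m) ℝ) (f : Fin n → ℝ) :
    comb (fun a => double (A a)) f = double (comb A f) := by
  ext i j
  induction i using Fin.addCases <;> induction j using Fin.addCases <;>
    simp [comb, Matrix.sum_apply, -Fin.natAdd_eq_addNat]

theorem contract_of_opNorm_le {B : Matrix (Fin m) (Fin m) ℝ} (hB : opNorm B ≤ 1)
    (w : Fin m → ℝ) : (B *ᵥ w) ⬝ᵥ (B *ᵥ w) ≤ w ⬝ᵥ w := by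
  have h1 := (toEuclideanCLM (n := Fin m) (𝕜 := ℝ) B).le_of_opNorm_le hB (WithLp.toLp 2 w)
  rw [one_mul, toEuclideanCLM_toLp] at h1
  have h2 := pow_le_pow_left₀ (norm_nonneg _) h1 2
  rw [EuclideanSpace.real_norm_sq_eq, EuclideanSpace.real_norm_sq_eq] at h2
  simpa [dotProduct, sq] using h2

theorem opNorm_le_of_contract {B : Matrix (Fin m) (Fin m) ℝ} {b : ℝ} (hb : 0 ≤ b)
    (hB : ∀ w : Fin m → ℝ, (B *ᵥ w) ⬝ᵥ (B *ᵥ w) ≤ b ^ 2 * (w ⬝ᵥ w)) : opNorm B ≤ b := by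
  refine ContinuousLinearMap.opNorm_le_bound _ hb fun w => ?_
  refine (sq_le_sq₀ (norm_nonneg _) (by positivity)).1 ?_
  rw [mul_pow, EuclideanSpace.real_norm_sq_eq, EuclideanSpace.real_norm_sq_eq]
  have := hB w.ofLp
  simpa [dotProduct, sq] using this

/-- Test the upper bound at bw + Xw and the lower one at bw - Xw. In the difference the terms w·Xw
and Xw·X(Xw) cancel. -/
theorem dotProduct_self_mulVec_le {X : Matrix (Fin m) (Fin m) ℝ} (hX : X.IsSymm) {b : ℝ}
    (hb : 0 < b) (h1 : ∀ v : Fin m → ℝ, v ⬝ᵥ (X *ᵥ v) ≤ b * (v ⬝ᵥ v))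
    (h2 : ∀ v : Fin m → ℝ, -(b * (v ⬝ᵥ v)) ≤ v ⬝ᵥ (X *ᵥ v)) (w : Fin m → ℝ) :
    (X *ᵥ w) ⬝ᵥ (X *ᵥ w) ≤ b ^ 2 * (w ⬝ᵥ w) := by
  have hs : ∀ u v : Fin m → ℝ, u ⬝ᵥ (X *ᵥ v) = (X *ᵥ u) ⬝ᵥ v := fun u v => by
    rw [dotProduct_mulVec, ← mulVec_transpose, hX.eq]
  have e1 := h1 (b • w + X *ᵥ w)
  have e2 := h2 (b • w - X *ᵥ w)
  simp only [mulVec_add, mulVec_sub, mulVec_smul, dotProduct_add, add_dotProduct, dotProduct_sub,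
    sub_dotProduct, dotProduct_smul, smul_dotProduct, smul_eq_mul] at e1 e2
  have e3 : w ⬝ᵥ (X *ᵥ (X *ᵥ w)) = (X *ᵥ w) ⬝ᵥ (X *ᵥ w) := hs _ _
  have e4 : (X *ᵥ w) ⬝ᵥ w = w ⬝ᵥ (X *ᵥ w) := (hs _ _).symm
  rw [e3, e4] at e1 e2
  refine le_of_mul_le_mul_left ?_ hb
  linarith

/-- The one-sided bound for diag(X, -X), tested on (v, 0) and (0, v), bounds X from both sides. -/
theorem opNorm_le_of_slack_posDef {A : Fin n → Matrix (Fin m) (Fin m) ℝ}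
    (hA : ∀ a, (A a).IsSymm) {b : ℝ} (hb : 0 < b) {x₀ x : Fin n → ℝ}
    (h : (slack (fun a => double (A a)) b x₀ x).PosDef) : opNorm (comb A (x - x₀)) ≤ b := by
  set X := comb A (x - x₀) with hX
  have hXs : X.IsSymm := comb_isSymm hA _
  rw [slack, double_comb, ← hX] at h
  have key : ∀ w : Fin (m + m) → ℝ, w ⬝ᵥ (double X *ᵥ w) ≤ b * (w ⬝ᵥ w) := fun w => by
    have := h.posSemidef.dotProduct_mulVec_nonneg w
    rw [star_trivial, sub_mulVec, smul_mulVec, one_mulVec, dotProduct_sub, dotProduct_smul,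
      smul_eq_mul] at this
    linarith
  refine opNorm_le_of_contract hb.le (dotProduct_self_mulVec_le hXs hb (fun v => ?_) fun v => ?_)
  · have := key (Fin.append v 0)
    rw [dotProduct_eq_add, dotProduct_eq_add (Fin.append v 0)] at this
    simpa [double_mulVec_castAdd, double_mulVec_natAdd, dotProduct, -Fin.natAdd_eq_addNat] using
      this
  · have := key (Fin.append 0 v)
    rw [dotProduct_eq_add, dotProduct_eq_add (Fin.append 0 v)] at this
    simp [double_mulVec_castAdd, double_mulVec_natAdd, dotProduct, -Fin.natAdd_eq_addNat] at this
    simp only [dotProduct]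
    linarith

theorem opNorm_comb_le {A : Fin n → Matrix (Fin m) (Fin m) ℝ} (hA : ∀ a, opNorm (A a) ≤ 1)
    {f : Fin n → ℝ} {c : ℝ} (hf : ∀ a, |f a| ≤ c) : opNorm (comb A f) ≤ n * c := by
  rw [opNorm, comb, map_sum]
  refine (norm_sum_le _ _).trans ?_
  calc _ ≤ ∑ _a : Fin n, c := sum_le_sum fun a _ => by
        rw [map_smul, norm_smul, Real.norm_eq_abs]
        calc _ ≤ |f a| * 1 := mul_le_mul_of_nonneg_left (hA a) (abs_nonneg _)
          _ ≤ c := by rw [mul_one]; exact hf a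
    _ = _ := by simp

theorem setup_double {A : Fin n → Matrix (Fin m) (Fin m) ℝ} {k : ℕ} (hn : 0 < n)
    (hA : ∀ i, IsBlockDiagonal q (A i)) (hA1 : ∀ i, opNorm (A i) ≤ 1) (hk : 2 ^ k ≤ n)
    (hk' : (16 * (q * (m + m : ℕ) + n) : ℝ) ≤ 2 ^ 2 ^ k * n) :
    Setup (fun a => double (A a)) q k (24 * √(n * 2 ^ k)) where
  n_pos := hn
  q_pos := (hA ⟨0, hn⟩).1
  q_dvd := (hA ⟨0, hn⟩).2.1.add (hA ⟨0, hn⟩).2.1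
  symm i := double_isSymm (hA i).2.2.1
  block a := double_block (hA a).1 (hA a).2.1 (hA a).2.2.2
  contract a := double_contract (contract_of_opNorm_le (hA1 a))
  traceless a := double_trace _
  b_pos := by
    have : (0 : ℝ) < n := by exact_mod_cast hn
    positivity
  b_sq := by
    rw [mul_pow, Real.sq_sqrt (by positivity)]; norm_num
  exponent_le := hk
  exponent_ge := hk'

theorem ncard_frozen {x : Fin n → ℝ} (hx : ∀ i, -1 ≤ x i ∧ x i ≤ 1)
    (h : 2 * (active x).card ≤ n) :
    (n : ℝ) / 2 ≤ (({i : Fin n | x i = -1 ∨ x i = 1} : Set (Fin n)).ncard : ℝ) := by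
  classical
  have e : ({i : Fin n | x i = -1 ∨ x i = 1} : Set (Fin n)) = ↑((active x)ᶜ) := by
    ext i
    simp only [active, Set.mem_ofPred_eq, coe_compl, coe_filter, mem_univ, true_and,
      Set.mem_compl_iff, not_and, not_lt]
    obtain ⟨h1, h2⟩ := hx i
    constructor
    · rintro (h3 | h3) h4
      · exact absurd h4 (by rw [h3]; exact lt_irrefl _)
      · exact h3.ge
    · intro h3
      rcases h1.lt_or_eq with h4 | h4
      · exact .inr (le_antisymm h2 (h3 h4))
      · exact .inl h4.symm
  rw [e, Set.ncard_coe_finset, card_compl, Fintype.card_fin]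
  have h1 : (active x).card ≤ n := (card_le_univ _).trans_eq (Fintype.card_fin n)
  rw [Nat.cast_sub h1]
  have : (2 * (active x).card : ℝ) ≤ n := by exact_mod_cast h
  linarith

/-- The exponent found by the doubling search is of the order of the logarithm. -/
theorem exponent_le_log {k : ℕ} (hn : 0 < n)
    (hk : k = 0 ∨ (2 : ℝ) ^ 2 ^ (k - 1) * n < 16 * (q * (m + m : ℕ) + n)) :
    (2 : ℝ) ^ k ≤ 18 * Real.log (max 2 (2 * q * m / n)) := by
  have hn' : (0 : ℝ) < n := by exact_mod_cast hn
  set M : ℝ := max 2 (2 * q * m / n) with hM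
  have hM2 : 2 ≤ M := le_max_left _ _
  have hMr : 2 * q * m / n ≤ M := le_max_right _ _
  have hl2 : (2 : ℝ) / 3 < Real.log 2 := by linarith [Real.log_two_gt_d9]
  have hlM : Real.log 2 ≤ Real.log M := Real.log_le_log (by norm_num) hM2
  rcases hk with rfl | hk
  · rw [pow_zero]; linarith
  · rcases k with _ | k
    · rw [pow_zero]; linarith
    · rw [Nat.add_sub_cancel] at hk
      -- The last failed test gives 2^(2^k) < 16(2qm/n + 1) ≤ 32M ≤ M^6, since M ≥ 2. With log 2 >
      -- 2/3 this yields 2^(k+1) ≤ 2 · 6 · (3/2) · log M.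
      have h1 : (2 : ℝ) ^ 2 ^ k < M ^ 6 := by
        have h2 : (2 : ℝ) ^ 2 ^ k < 16 * (2 * q * m / n + 1) := by
          rw [← mul_lt_mul_iff_left₀ hn']
          refine hk.trans_eq ?_
          push_cast
          field_simp
          ring
        have h3 : 32 * M ≤ M ^ 6 := by
          have : (2 : ℝ) ^ 5 ≤ M ^ 5 := pow_le_pow_left₀ (by norm_num) hM2 5
          nlinarith
        linarith
      have h2 : (2 : ℝ) ^ k * Real.log 2 < 6 * Real.log M := by
        have := Real.log_lt_log (by positivity) h1
        rw [Real.log_pow, Real.log_pow] at this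
        exact_mod_cast this
      rw [pow_succ]
      have : (2 : ℝ) ^ k * (2 / 3) ≤ 2 ^ k * Real.log 2 :=
        mul_le_mul_of_nonneg_left hl2.le (by positivity)
      linarith

/-- The factor 18 is rounded up to the square 25, so the final constant is 24 · 5. -/
theorem barrier_le {p L : ℝ} (hpL : p ≤ 18 * L) : 24 * √(n * p) ≤ 120 * √(n * L) := by
  have h1 : √(n * p) ≤ √(25 * (n * L)) := by
    rcases le_or_gt 0 p with hp | hp
    · have hL : 0 ≤ L := by linarith
      refine Real.sqrt_le_sqrt ?_
      have := mul_le_mul_of_nonneg_left hpL (Nat.cast_nonneg (α := ℝ) n)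
      have := mul_nonneg (Nat.cast_nonneg (α := ℝ) n) hL
      linarith
    · rw [Real.sqrt_eq_zero_of_nonpos (mul_nonpos_of_nonneg_of_nonpos (Nat.cast_nonneg n) hp.le)]
      exact Real.sqrt_nonneg _
  rw [Real.sqrt_mul (by norm_num) (n * L), show √(25 : ℝ) = 5 by
    rw [show (25 : ℝ) = 5 ^ 2 by norm_num, Real.sqrt_sq (by norm_num)]] at h1
  linarith

end Double

end MatrixDiscrepancy

/-! ### Preparations and correctness of the whole program -/

namespace ArrayLang
open Matrix Finset MatrixDiscrepancy
open ArrayLang.Expr ArrayLang.Stmt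

variable {n m q : ℕ} {σ : ℕ → ℕ} {α : ℕ → ℕ → ℕ → ℕ → ℝ}

/-- The entries of the matrices `diag(A, -A)` for the matrices `A` in array `0`. -/
def doubleEntry : Expr :=
  cond (ofIdx 11) (ofIdx 1) (cond (ofIdx 12) (ofIdx 1) (read 0 10 11 12) (const 0))
    (cond (ofIdx 12) (ofIdx 1) (const 0)
      (shift 13 11 1 (shift 14 12 1 (sub (const 0) (read 0 10 13 14)))))

theorem double_par (h : Regs n m q σ) {A : Fin n → Matrix (Fin m) (Fin m) ℝ}
    (hA : ∀ (a : Fin n) (i j : Fin m), α 0 a i j = A a i j) (a : Fin n) (i j : Fin (m + m)) :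
    (par 3 0 4 4 doubleEntry).den σ α 3 a i j = double (A a) i j := by
  rw [den_par_self (by rfl) (by norm_num) (by norm_num) (by rw [h.r0]; exact a.2)
    (by rw [h.r4]; exact i.2) (by rw [h.r4]; exact j.2), doubleEntry]
  simp only [eval, Function.update_apply, Nat.reduceEqDiff, if_true, if_false, h.r1, Nat.cast_lt]
  induction i using Fin.addCases <;> induction j using Fin.addCases <;>
    simp [hA, -Fin.natAdd_eq_addNat]

/-- The comparison that is made in the search for the exponent. -/
def exponentTest (e f : Expr) : Expr :=
  cond (mul (rd0 6) (ofIdx 0)) (mul (const 16) (add (mul (ofIdx 2) (ofIdx 4)) (ofIdx 0))) e f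

/-- The search for the exponent, in array `5`, by doubling. -/
def exponentStmt : Stmt :=
  .seq (par 5 3 3 3 (const 1)) (.seq (par 6 3 3 3 (const 2)) (.loop 20 0
    (.seq (par 7 3 3 3 (exponentTest (add (rd0 5) (rd0 5)) (rd0 5)))
      (.seq (par 8 3 3 3 (exponentTest (mul (rd0 6) (rd0 6)) (rd0 6)))
        (.seq (par 5 3 3 3 (rd0 7)) (par 6 3 3 3 (rd0 8)))))))

/-- Arrays 5 and 6 hold 2^k and 2^(2^k), advanced by doubling and squaring. The new values are
buffered so that both tests see the same old one. If all n tests fail then k = n, so 2^k > n, the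
case in which the output is trivial. -/
theorem exponentStmt_spec (h : Regs n m q σ) {γ : ℕ → ℕ → ℕ → ℕ → ℝ}
    (hγ : γ = exponentStmt.den σ α) : ∃ k : ℕ, γ 5 0 0 0 = 2 ^ k ∧
      (k = 0 ∨ (2 : ℝ) ^ 2 ^ (k - 1) * n < 16 * (q * (m + m : ℕ) + n)) ∧
      (k = n ∨ (16 * (q * (m + m : ℕ) + n) : ℝ) ≤ 2 ^ 2 ^ k * n) := by
  set α1 := (par 5 3 3 3 (const 1)).den σ α with hα1
  set α2 := (par 6 3 3 3 (const 2)).den σ α1 with hα2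
  set e7 := exponentTest (add (rd0 5) (rd0 5)) (rd0 5) with he7
  set e8 := exponentTest (mul (rd0 6) (rd0 6)) (rd0 6) with he8
  set f : ℕ → ℕ → ℕ → ℕ → ℕ → ℝ := fun v => Nat.rec α2 (fun v β =>
    (Stmt.seq (par 7 3 3 3 e7) (.seq (par 8 3 3 3 e8)
      (.seq (par 5 3 3 3 (rd0 7)) (par 6 3 3 3 (rd0 8))))).den (Function.update σ 20 v) β) v with hf
  have hγf : γ = f n := by
    rw [hγ, exponentStmt, den_seq, den_seq, den_loop, h.r0]
  have s5 : α2 5 0 0 0 = 1 := by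
    rw [hα2, den_of_keeps (by rfl), hα1, scal_par h (by rfl)]; simp [eval]
  have s6 : α2 6 0 0 0 = 2 := by
    rw [hα2, scal_par h (by rfl)]; simp [eval]
  have key : ∀ v : ℕ, ∃ k : ℕ, f v 5 0 0 0 = 2 ^ k ∧ f v 6 0 0 0 = 2 ^ 2 ^ k ∧
      (k = 0 ∨ (2 : ℝ) ^ 2 ^ (k - 1) * n < 16 * (q * (m + m : ℕ) + n)) ∧
      (k = v ∨ (16 * (q * (m + m : ℕ) + n) : ℝ) ≤ 2 ^ 2 ^ k * n) := by
    intro v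
    induction v with
    | zero => exact ⟨0, s5.trans (by norm_num), s6.trans (by norm_num), .inl rfl, .inl rfl⟩
    | succ v ih =>
      obtain ⟨k, h5, h6, h7, h8⟩ := ih
      have hR := h.update (r := 20) (by norm_num) v
      set σ' := Function.update σ 20 v with hσ'
      set β := f v with hβ
      set β1 := (par 7 3 3 3 e7).den σ' β with hβ1
      set β2 := (par 8 3 3 3 e8).den σ' β1 with hβ2
      set β3 := (par 5 3 3 3 (rd0 7)).den σ' β2 with hβ3
      have hstep : f (v + 1) = (par 6 3 3 3 (rd0 8)).den σ' β3 := rfl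
      have r7 : β1 7 0 0 0 = if (2 : ℝ) ^ 2 ^ k * n < 16 * (q * (m + m : ℕ) + n) then
          2 ^ k + 2 ^ k else 2 ^ k := by
        rw [hβ1, scal_par hR (by rfl), he7, exponentTest]
        simp only [eval, rd0, Function.update_apply, Nat.reduceEqDiff, if_false, hR.r0, hR.r2,
          hR.r4, hR.r6, h5, h6]
        norm_num
      have g6 : β1 6 = β 6 := by rw [hβ1, den_of_keeps (by rfl)]
      have r8 : β2 8 0 0 0 = if (2 : ℝ) ^ 2 ^ k * n < 16 * (q * (m + m : ℕ) + n) then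
          2 ^ 2 ^ k * 2 ^ 2 ^ k else 2 ^ 2 ^ k := by
        rw [hβ2, scal_par hR (by rfl), he8, exponentTest]
        simp only [eval, rd0, Function.update_apply, Nat.reduceEqDiff, if_false, hR.r0, hR.r2,
          hR.r4, hR.r6, g6, h6]
        norm_num
      have t5 : f (v + 1) 5 0 0 0 = β1 7 0 0 0 := by
        rw [hstep, den_of_keeps (by rfl), hβ3, scal_par hR (by rfl)]
        simp only [eval, rd0, Function.update_apply, Nat.reduceEqDiff, if_false, hR.r6]
        rw [hβ2, den_of_keeps (by rfl)]
      have t6 : f (v + 1) 6 0 0 0 = β2 8 0 0 0 := by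
        rw [hstep, scal_par hR (by rfl)]
        simp only [eval, rd0, Function.update_apply, Nat.reduceEqDiff, if_false, hR.r6]
        rw [hβ3, den_of_keeps (by rfl)]
      rw [t5, t6, r7, r8]
      by_cases hc : (2 : ℝ) ^ 2 ^ k * n < 16 * (q * (m + m : ℕ) + n)
      · rw [if_pos hc, if_pos hc]
        refine ⟨k + 1, by ring, by ring, .inr (by simpa using hc), .inl ?_⟩
        rw [h8.resolve_right (not_le.2 hc)]
      · rw [if_neg hc, if_neg hc]
        exact ⟨k, rfl, rfl, h7, .inr (not_lt.1 hc)⟩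
  obtain ⟨k, h5, -, h7, h8⟩ := key n
  exact ⟨k, by rw [hγf, h5], h7, h8⟩

/-- The barrier, in array `9`, and the offset of the potential, in array `10`. -/
def barrierStmt : Stmt :=
  .seq (par 9 3 3 3 (mul (const 24) (sqrt (mul (ofIdx 0) (rd0 5)))))
    (.seq (par 10 3 3 3 (div (const 1) (rd0 9))) (.seq (power 10 8 3)
      (.seq (par 8 3 3 3 (mul (div (ofIdx 0) (ofIdx 2)) (rd0 10))) (par 10 3 3 3 (rd0 8)))))

theorem barrierStmt_spec (h : Regs n m q σ) {k : ℕ} (hk : k ≤ n) (hp : α 5 0 0 0 = 2 ^ k)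
    {γ : ℕ → ℕ → ℕ → ℕ → ℝ} (hγ : γ = barrierStmt.den σ α) :
    γ 9 0 0 0 = 24 * √(n * 2 ^ k) ∧
      γ 10 0 0 0 = n / q * ((24 * √(n * 2 ^ k))⁻¹) ^ 2 ^ k := by
  set α1 := (par 9 3 3 3 (mul (const 24) (sqrt (mul (ofIdx 0) (rd0 5))))).den σ α with hα1
  set α2 := (par 10 3 3 3 (div (const 1) (rd0 9))).den σ α1 with hα2
  set α3 := (power 10 8 3).den σ α2 with hα3
  set α4 := (par 8 3 3 3 (mul (div (ofIdx 0) (ofIdx 2)) (rd0 10))).den σ α3 with hα4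
  have e5 : γ = (par 10 3 3 3 (rd0 8)).den σ α4 := hγ
  have m1 : α1 9 0 0 0 = 24 * √(n * 2 ^ k) := by
    rw [hα1, scal_par h (by rfl)]
    simp only [eval, rd0, Function.update_apply, Nat.reduceEqDiff, if_false, h.r0, h.r6, hp]
    norm_num
  have m2 : α2 10 0 0 0 = (24 * √(n * 2 ^ k))⁻¹ := by
    rw [hα2, scal_par h (by rfl)]
    simp only [eval, rd0, Function.update_apply, Nat.reduceEqDiff, if_false, h.r6, m1]
    norm_num
  have p2 : α2 5 0 0 0 = 2 ^ k := by
    rw [hα2, den_of_keeps (by rfl), hα1, den_of_keeps (by rfl), hp]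
  have m3 : α3 10 0 0 0 = ((24 * √(n * 2 ^ k))⁻¹) ^ 2 ^ k := by
    -- The scalar power is computed as that of a 1 × 1 matrix: index register 3, which holds 1,
    -- serves as the size.
    have h1 := mat_power_size h (a := 10) (t := 8) h.r3 (by norm_num) (by norm_num) (by norm_num)
      (by norm_num) (by norm_num) (by norm_num) (by norm_num) hk p2
    have h2 : mat 1 (α2 10) = diagonal fun _ => (24 * √(n * 2 ^ k))⁻¹ := by
      ext i j
      rw [Subsingleton.elim i 0, Subsingleton.elim j 0, diagonal_apply_eq, ← m2]
      rfl
    rw [h2, diagonal_pow] at h1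
    have h3 := congrFun (congrFun h1 0) 0
    rw [diagonal_apply_eq] at h3
    exact h3
  have m4 : α4 8 0 0 0 = n / q * ((24 * √(n * 2 ^ k))⁻¹) ^ 2 ^ k := by
    rw [hα4, scal_par h (by rfl)]
    simp only [eval, rd0, Function.update_apply, Nat.reduceEqDiff, if_false, h.r0, h.r2, h.r6, m3]
  refine ⟨?_, ?_⟩
  · rw [e5, den_of_keeps (by rfl), hα4, den_of_keeps (by rfl), hα3, den_of_keeps (by rfl), hα2,
      den_of_keeps (by rfl), m1]
  · rw [e5, scal_par h (by rfl)]
    simp only [eval, rd0, Function.update_apply, Nat.reduceEqDiff, if_false, h.r6, m4]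

/-- The preparations for the local search. -/
def prepareStmt : Stmt :=
  .seq (par 3 0 4 4 doubleEntry) (.seq (par 4 0 3 3 (rd1 1 10)) (.seq exponentStmt barrierStmt))

/-- The output: all ones if the exponent is larger than `n`. -/
def outputStmt : Stmt := par 2 0 3 3 (cond (ofIdx 0) (rd0 5) (const 1) (rd1 4 10))

/-- The whole algorithm. -/
def mainStmt : Stmt := .seq prepareStmt (.seq searchStmt outputStmt)

theorem mainStmt_spec (h : Regs n m q σ) (hn : 0 < n) {A : Fin n → Matrix (Fin m) (Fin m) ℝ}
    {x₀ : Fin n → ℝ} (hα : ∀ (a : Fin n) (i j : Fin m), α 0 a i j = A a i j)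
    (hαx : vec n (α 1) = x₀) (hA : ∀ i, IsBlockDiagonal q (A i)) (hA1 : ∀ i, opNorm (A i) ≤ 1)
    (hx₀ : ∀ i, -1 ≤ x₀ i ∧ x₀ i ≤ 1) {x : Fin n → ℝ} (hx : x = vec n (mainStmt.den σ α 2)) :
    (∀ i, -1 ≤ x i ∧ x i ≤ 1) ∧
    opNorm (comb A (x - x₀)) ≤ 120 * √(n * Real.log (max 2 (2 * q * m / n))) ∧
    2 * (active x).card ≤ n := by
  set α1 := (par 3 0 4 4 doubleEntry).den σ α with hα1
  set α2 := (par 4 0 3 3 (rd1 1 10)).den σ α1 with hα2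
  set α3 := exponentStmt.den σ α2 with hα3
  set α4 := barrierStmt.den σ α3 with hα4
  set α5 := searchStmt.den σ α4 with hα5
  replace hx : x = vec n (outputStmt.den σ α5 2) := hx
  obtain ⟨k, h5, hk1, hk2⟩ := exponentStmt_spec h hα3
  have p5 : α5 5 0 0 0 = 2 ^ k := by
    rw [hα5, den_of_keeps (by rfl), hα4, den_of_keeps (by rfl), h5]
  have hxi : ∀ i : Fin n, x i = if (n : ℝ) < 2 ^ k then 1 else vec n (α5 4) i := fun i => by
    rw [hx, outputStmt]
    refine (congrFun (vec_par h (a := 2) (by rfl) α5) i).trans ?_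
    simp only [eval, rd0, rd1, Function.update_apply, Nat.reduceEqDiff, if_true, if_false, h.r0,
      h.r6, p5, Nat.cast_one]
    rfl
  have hlog := exponent_le_log hn hk1
  have hn' : (0 : ℝ) < n := by exact_mod_cast hn
  by_cases hc : (n : ℝ) < 2 ^ k
  · have hx1 : ∀ i, x i = 1 := fun i => by rw [hxi, if_pos hc]
    refine ⟨fun i => by rw [hx1]; norm_num, ?_, ?_⟩
    · have h1 := opNorm_comb_le hA1 (f := x - x₀) (c := 2) fun a => by
        have := hx₀ a
        rw [Pi.sub_apply, hx1, abs_le]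
        constructor <;> linarith
      refine h1.trans (le_trans ?_ (barrier_le hlog))
      -- When 2^k > n the target exceeds the trivial bound 2n, so any point of the cube is good
      -- enough and the all-ones vector is fully frozen.
      have h2 : (n : ℝ) ≤ √(n * 2 ^ k) := Real.le_sqrt_of_sq_le (by nlinarith)
      linarith
    · have : active x = ∅ := by
        ext i; simp [active, hx1]
      rw [this]; simp
  · have hx4 : x = vec n (α5 4) := funext fun i => by rw [hxi, if_neg hc]
    have hkn : 2 ^ k ≤ n := by exact_mod_cast not_lt.1 hc
    have hkn' : k < n := Nat.lt_two_pow_self.trans_le hkn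
    -- Here k < 2^k ≤ n, so the search for the exponent ended with a successful test.
    have hS := setup_double hn hA hA1 hkn (hk2.resolve_left hkn'.ne)
    obtain ⟨hb, ho⟩ := barrierStmt_spec h hkn'.le h5 hα4
    have x4 : vec n (α4 4) = x₀ := by
      rw [hα4, den_of_keeps (by rfl), hα3, den_of_keeps (by rfl), hα2, vec_par h (by rfl), ← hαx]
      funext i
      simp only [eval, rd1, Function.update_apply, Nat.reduceEqDiff, if_true, if_false, h.r6]
      rw [hα1, den_of_keeps (by rfl)]
      rfl
    have hD : Data (fun a => double (A a)) q k (24 * √(n * 2 ^ k)) x₀ α4 := by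
      refine ⟨?_, fun a i j => ?_, ?_, hb, ho⟩
      · rw [hα4, den_of_keeps (by rfl), hα3, den_of_keeps (by rfl), hα2, den_of_keeps (by rfl),
          hα1, den_of_keeps (by rfl), hαx]
      · rw [hα4, den_of_keeps (by rfl), hα3, den_of_keeps (by rfl), hα2, den_of_keeps (by rfl)]
        exact double_par h hα a i j
      · rw [hα4, den_of_keeps (by rfl), h5]
    obtain ⟨hI, hact⟩ := searchStmt_spec h hS hD x4 hx₀ hα5
    rw [← hx4] at hI hact
    exact ⟨hI.mem, (opNorm_le_of_slack_posDef (fun a => (hA a).2.2.1) hS.b_pos hI.posDef).trans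
      (barrier_le hlog), hact⟩

end ArrayLang

/-! ### Running time -/

namespace ArrayLang
open Finset RealRAM MatrixDiscrepancy
open ArrayLang.Expr ArrayLang.Stmt

variable {n m q : ℕ} {B : ℕ → ℕ}

/-- This dominates the lower monomials of the cost polynomials, also when m = 0, where n³ absorbs
those without m. -/
theorem pow_mul_pow_le (hn : 0 < n) {i j : ℕ} (hi : i ≤ 2) (hj : j ≤ 3) :
    n ^ i * m ^ j ≤ n ^ 3 + n ^ 2 * m ^ 3 := by
  have h1 : n ^ i ≤ n ^ 2 := Nat.pow_le_pow_right hn hi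
  have h2 : n ^ 2 ≤ n ^ 3 := Nat.pow_le_pow_right hn (by norm_num)
  have h3 : m ^ j ≤ 1 + m ^ 3 := by
    rcases Nat.eq_zero_or_pos m with rfl | hm
    · rcases j with _ | j <;> simp
    · exact (Nat.pow_le_pow_right hm hj).trans (by omega)
  calc n ^ i * m ^ j ≤ n ^ 2 * (1 + m ^ 3) := Nat.mul_le_mul h1 h3
    _ ≤ _ := by rw [mul_add, mul_one]; omega

/-- The leading terms are n³ for inverting the step matrix, nm³ for the power and the products P
A_a, and n²m² for the traces. After expansion the claim is linear in the monomials. -/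
theorem stepStmt_cost (hn : 0 < n) (h0 : B 0 = n) (h3 : B 3 = 1) (h4 : B 4 = m + m) :
    stepStmt.cost B ≤ 3000 * (n ^ 3 + n ^ 2 * m ^ 3) := by
  simp only [stepStmt, potentialStmt, slackStmt, invert, power, mulMat, sweepEntry, directionsStmt,
    chooseStmt, signStmt, moveStmt, par, ifEq, rd0, rd1, rd2, Stmt.cost, Expr.cost,
    Function.update_apply, Nat.reduceEqDiff, if_true, if_false, h0, h3, h4]
  have e00 := pow_mul_pow_le (m := m) hn (i := 0) (j := 0) (by norm_num) (by norm_num)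
  have e01 := pow_mul_pow_le (m := m) hn (i := 0) (j := 1) (by norm_num) (by norm_num)
  have e02 := pow_mul_pow_le (m := m) hn (i := 0) (j := 2) (by norm_num) (by norm_num)
  have e03 := pow_mul_pow_le (m := m) hn (i := 0) (j := 3) (by norm_num) (by norm_num)
  have e10 := pow_mul_pow_le (m := m) hn (i := 1) (j := 0) (by norm_num) (by norm_num)
  have e11 := pow_mul_pow_le (m := m) hn (i := 1) (j := 1) (by norm_num) (by norm_num)
  have e12 := pow_mul_pow_le (m := m) hn (i := 1) (j := 2) (by norm_num) (by norm_num)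
  have e13 := pow_mul_pow_le (m := m) hn (i := 1) (j := 3) (by norm_num) (by norm_num)
  have e20 := pow_mul_pow_le (m := m) hn (i := 2) (j := 0) (by norm_num) (by norm_num)
  have e21 := pow_mul_pow_le (m := m) hn (i := 2) (j := 1) (by norm_num) (by norm_num)
  have e22 := pow_mul_pow_le (m := m) hn (i := 2) (j := 2) (by norm_num) (by norm_num)
  have e30 : n ^ 3 ≤ n ^ 3 + n ^ 2 * m ^ 3 := Nat.le_add_right _ _
  ring_nf at *
  omega

theorem mainStmt_cost (hn : 0 < n) (h0 : B 0 = n) (h3 : B 3 = 1) (h4 : B 4 = m + m)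
    (h5 : B 5 = 64 * n) : mainStmt.cost B ≤ 300000 * (n ^ 2 * (n ^ 3 + n ^ 2 * m ^ 3)) := by
  have hs := stepStmt_cost (m := m) (B := Function.update (Function.update B 21 (64 * n)) 22 n) hn
    (by simpa using h0) (by simpa using h3) (by simpa using h4)
  have e00 := pow_mul_pow_le (m := m) hn (i := 0) (j := 0) (by norm_num) (by norm_num)
  have e10 := pow_mul_pow_le (m := m) hn (i := 1) (j := 0) (by norm_num) (by norm_num)
  have e11 := pow_mul_pow_le (m := m) hn (i := 1) (j := 1) (by norm_num) (by norm_num)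
  have e12 := pow_mul_pow_le (m := m) hn (i := 1) (j := 2) (by norm_num) (by norm_num)
  have hprep : (Stmt.seq prepareStmt outputStmt).cost B ≤ 3000 * (n ^ 3 + n ^ 2 * m ^ 3) := by
    simp only [prepareStmt, outputStmt, doubleEntry, exponentStmt, exponentTest, barrierStmt, power,
      par, rd0, rd1, rd2, Stmt.cost, Expr.cost, Function.update_apply, Nat.reduceEqDiff, if_false,
      h0, h3, h4]
    ring_nf at *
    omega
  have hsearch : searchStmt.cost B ≤
      64 * (n * (n * (3000 * (n ^ 3 + n ^ 2 * m ^ 3) + 2) + 4)) + 2 := by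
    simp only [searchStmt, Stmt.cost, h5]
    have : Function.update B 21 (64 * n) 0 = n := by simpa using h0
    rw [this]
    calc _ ≤ 64 * n * (n * (3000 * (n ^ 3 + n ^ 2 * m ^ 3) + 2) + 2 + 2) + 2 := by gcongr
      _ = _ := by ring
  have hsum : mainStmt.cost B = (Stmt.seq prepareStmt outputStmt).cost B + searchStmt.cost B := by
    simp only [mainStmt, Stmt.cost]; ring
  set T := n ^ 3 + n ^ 2 * m ^ 3 with hT
  have hT1 : 1 ≤ T := by simpa using e00
  have hn2 : 1 ≤ n ^ 2 := Nat.one_le_pow _ _ hn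
  have hnn : n ≤ n ^ 2 := Nat.le_self_pow (by norm_num) n
  have a1 : T ≤ n ^ 2 * T := Nat.le_mul_of_pos_left _ hn2
  have a2 : n ^ 2 ≤ n ^ 2 * T := Nat.le_mul_of_pos_right _ hT1
  rw [hsum]
  calc _ ≤ 3000 * T + (64 * (n * (n * (3000 * T + 2) + 4)) + 2) := Nat.add_le_add hprep hsearch
    _ = 3000 * T + 192000 * (n ^ 2 * T) + 128 * n ^ 2 + 256 * n + 2 := by ring
    _ ≤ _ := by omega

/-- The program of the algorithm. -/
def mainProg : Prog :=
  .seq (.instr (.idxConst 3 1)) (.seq (.instr (.idxAdd 4 1 1)) (.seq (.instr (.idxAdd 5 0 0))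
    (.seq (.instr (.idxAdd 5 5 5)) (.seq (.instr (.idxAdd 5 5 5)) (.seq (.instr (.idxAdd 5 5 5))
      (.seq (.instr (.idxAdd 5 5 5)) (.seq (.instr (.idxAdd 5 5 5)) mainStmt.compile)))))))

theorem exec_mainProg {n m : ℕ} (q : ℕ) (hn : 0 < n) (A : Fin n → Matrix (Fin m) (Fin m) ℝ)
    (x₀ : Fin n → ℝ) : ∃ (σ : ℕ → ℕ) (s : State) (t : ℕ), Regs n m q σ ∧
      Exec mainProg (input q A x₀) s t ∧
      t ≤ 300008 * (n ^ 2 * (n ^ 3 + n ^ 2 * m ^ 3)) ∧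
      s.arr = mainStmt.den σ (input q A x₀).arr := by
  set σ : ℕ → ℕ := fun r => if r = 5 then 64 * n else if r = 4 then m + m else if r = 3 then 1 else
    (input q A x₀).idx r with hσ
  set s₁ : State := ⟨σ, (input q A x₀).reg, (input q A x₀).arr⟩ with hs₁
  have hR : Regs n m q σ := ⟨rfl, rfl, rfl, rfl, rfl, rfl, rfl⟩
  have hready : Ready [0, 1, 2, 3, 4, 5] σ s₁.idx := by
    refine ⟨fun r hr => ?_, by simp, rfl, fun _ => le_rfl⟩
    simp only [List.mem_cons, List.not_mem_nil, or_false, not_or] at hr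
    simp [hs₁, hσ, input, hr]
  obtain ⟨s, t, he, ht, -, ha⟩ := mainStmt.exec_compile [0, 1, 2, 3, 4, 5] σ s₁ (by rfl) hready
  -- Register 5 becomes n + n and is then doubled five times, giving 64n. These eight instructions
  -- account for the 8 in 300008.
  have hst : (Instr.idxAdd 5 5 5).exec ((Instr.idxAdd 5 5 5).exec ((Instr.idxAdd 5 5 5).exec
      ((Instr.idxAdd 5 5 5).exec ((Instr.idxAdd 5 5 5).exec ((Instr.idxAdd 5 0 0).exec
        ((Instr.idxAdd 4 1 1).exec ((Instr.idxConst 3 1).exec (input q A x₀)))))))) = s₁ := by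
    simp only [Instr.exec, hs₁, State.mk.injEq, and_true]
    funext r
    simp only [Function.update_apply, Nat.reduceEqDiff, if_true, if_false, hσ]
    split_ifs <;> simp [input]
    ring
  refine ⟨σ, s, _, hR, .seq (.instr _ _) (.seq (.instr _ _) (.seq (.instr _ _) (.seq (.instr _ _)
    (.seq (.instr _ _) (.seq (.instr _ _) (.seq (.instr _ _) (.seq (.instr _ _)
      (hst.symm ▸ he)))))))), ?_, ha⟩
  have h1 := mainStmt_cost (m := m) (B := σ) hn rfl rfl rfl rfl
  have h2 : 1 ≤ n ^ 2 * (n ^ 3 + n ^ 2 * m ^ 3) := Nat.one_le_iff_ne_zero.2 (by positivity)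
  omega

end ArrayLang
theorem mainTheorem5 :
    ∃ (P : RealRAM.Prog) (K C : ℝ), 0 < K ∧ 0 < C ∧
      ∀ (n m q : ℕ), 0 < n → 0 < q → q ∣ m →
      ∀ (A : Fin n → Matrix (Fin m) (Fin m) ℝ) (x₀ : Fin n → ℝ),
        (∀ i, IsBlockDiagonal q (A i)) → (∀ i, opNorm (A i) ≤ 1) →
        (∀ i, x₀ i ∈ Set.Icc (-1 : ℝ) 1) →
        ∃ (x : Fin n → ℝ) (t : ℕ),
          RealRAM.Computes P (RealRAM.input q A x₀) x t ∧
          (t : ℝ) ≤ C * ((n : ℝ) ^ 5 + (n : ℝ) ^ 4 * (m : ℝ) ^ 3) ∧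
          (∀ i, x i ∈ Set.Icc (-1 : ℝ) 1) ∧
          opNorm (∑ i, (x i - x₀ i) • A i) ≤
            K * Real.sqrt ((n : ℝ) * Real.log (max 2 (2 * (q : ℝ) * (m : ℝ) / (n : ℝ)))) ∧
          (n : ℝ) / 2 ≤ (({i : Fin n | x i = -1 ∨ x i = 1} : Set (Fin n)).ncard : ℝ) := by
  refine ⟨ArrayLang.mainProg, 120, 300008, by norm_num, by norm_num, ?_⟩
  intro n m q hn _ _ A x₀ hA hA1 hx₀
  obtain ⟨σ, s, t, hR, hexec, ht, hs⟩ := ArrayLang.exec_mainProg q hn A x₀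
  obtain ⟨h1, h2, h3⟩ := ArrayLang.mainStmt_spec hR hn (A := A) (x₀ := x₀)
    (α := (RealRAM.input q A x₀).arr) (fun a i j => by simp [RealRAM.input])
    (funext fun i => by simp [ArrayLang.vec, RealRAM.input]) hA hA1 hx₀ rfl
  refine ⟨_, t, ⟨s, hexec, ?_⟩, ?_, h1, h2, MatrixDiscrepancy.ncard_frozen h1 h3⟩
  · rw [← hs]; rfl
  · have : (t : ℝ) ≤ 300008 * ((n : ℝ) ^ 2 * (n ^ 3 + n ^ 2 * m ^ 3)) := by exact_mod_cast ht
    linarith
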